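/- Let $X=(X_t)_{t\in[0,1]}$ be a centered real Gaussian process on a probability space $(\Omega,\mathcal F,P)$, jointly measurable in $(t,\omega)$, and put $X_t:=X_1$ for $t>1$. Write $Q(s,t)=E[X_sX_t]$, $Q_u=Q(u,u)$ and $\delta^2(s,t)=E[(X_t-X_s)^2]$. Let $r\mapsto\delta^2(r)$ be a univariate nondecreasing concave function on $[0,1]$ (with $\delta(r)=\sqrt{\delta^2(r)}$) such that $\delta^2(s,t)\le\delta^2(|t-s|)$ for all $s,t\in[0,1]$ and $\delta(r)=o(r^{1/6})$ as $r\downarrow0$. Assume: * In the sense of distributions, off the diagonal of the unit square, $\partial^2\delta^2/\partial s\partial t$ is a signed measure $\mu$, finite on compact sets that do not meet the diagonal, and there is a constant $C$ such that for all small enough $\varepsilon>0$ its total variation satisfies $|\mu|\big(\{(s,t):0\le s\le t-\varepsilon,\ t\le 1\}\big)\le C\varepsilon^{-2/3}$. * $u\mapsto Q_u$ is nondecreasing and concave on $[0,1]$. For every $u\in[0,1]$ the function $v\mapsto\delta^2(u,v)$ is nondecreasing and concave on $(u,1]$. For every $v\in[0,1]$ the function $u\mapsto-\delta^2(u,v)$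 is nondecreasing on $[0,v)$, and it is either concave or convex there. * There are constants $a>1$, $0<b<1/2$, $c>1/4$, $c'>0$ such that for all $0<u<v\le1$: (i) $c\,\delta^2(u)\le Q_u$; (ii) $c'\,\delta^2(u)\,\delta^2(v-u)\le Q_uQ_v-Q(u,v)^2$; and (iii) $\dfrac{\delta(au)-\delta(u)}{(a-1)u}<b\,\dfrac{\delta(u)}{u}$ for all $u>0$ with $au\le 1$. Then for every $f\in C^6(\mathbf R)$ and every $t\in[0,1]$ the symmetric (generalized Stratonovich) integral $$\int_0^t f'(X_u)\,d^\circ X_u:=\lim_{\varepsilon\downarrow0}\frac1\varepsilon\int_0^t (X_{u+\varepsilon}-X_u)\,\tfrac12\big(f'(X_{u+\varepsilon})+f'(X_u)\big)\,du$$ exists as a limit in probability (for every $\varepsilon>0$ the Lebesgue integral on the right is almost surely well defined), and almost surely $$f(X_t)=f(X_0)+\int_0^t f'(X_u)\,d^\circ X_u .$$ -/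

import Mathlib

open MeasureTheory ProbabilityTheory Filter Set
open scoped Topology

noncomputable section

/-- A process indexed by `[0,1]`, continued by its value at `0` to the left of `0` and by its value
at `1` to the right of `1` (the usual convention of the calculus via regularization, needed to make
sense of `X (u + ε)` for `u` near `1`). -/
def extendProcess {Ω : Type*} (X : Icc (0 : ℝ) 1 → Ω → ℝ) (t : ℝ) : Ω → ℝ :=
  X (projIcc 0 1 zero_le_one t)

/-- The covariance function `Q(s,t) = E[X_s X_t]` of a centered process. -/
def covFun {Ω : Type*} [MeasurableSpace Ω] (X : Icc (0 : ℝ) 1 → Ω → ℝ) (P : Measure Ω)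
    (s t : ℝ) : ℝ :=
  ∫ ω, extendProcess X s ω * extendProcess X t ω ∂P

/-- The squared canonical metric `δ²(s,t) = E[(X_t - X_s)²]`. -/
def canonicalMetricSq {Ω : Type*} [MeasurableSpace Ω] (X : Icc (0 : ℝ) 1 → Ω → ℝ)
    (P : Measure Ω) (s t : ℝ) : ℝ :=
  ∫ ω, (extendProcess X t ω - extendProcess X s ω) ^ 2 ∂P

/-- The open unit square without its diagonal. -/
def offDiagonalSquare : Set (ℝ × ℝ) :=
  {p | p.1 ∈ Ioo (0 : ℝ) 1 ∧ p.2 ∈ Ioo (0 : ℝ) 1 ∧ p.1 ≠ p.2}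

/-- The off-diagonal simplex `{(s,t) : 0 ≤ s ≤ t - ε, t ≤ 1}`. -/
def offDiagonalSimplex (ε : ℝ) : Set (ℝ × ℝ) :=
  {p | 0 ≤ p.1 ∧ p.1 ≤ p.2 - ε ∧ p.2 ≤ 1}

/-- The mixed second derivative `∂²φ/∂s∂t` of a function of two real variables. -/
def mixedDeriv (φ : ℝ × ℝ → ℝ) (p : ℝ × ℝ) : ℝ :=
  fderiv ℝ (fun q => fderiv ℝ φ q (0, 1)) p (1, 0)

/-- In the sense of distributions, off the diagonal of the unit square, `∂²F/∂s∂t` is the signed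
measure with Jordan decomposition `μpos - μneg`. Both parts are finite on the compact subsets of the
square without its diagonal but may have infinite mass near the diagonal; the total variation
measure is `μpos + μneg`. -/
structure HasMixedDerivMeasure (F : ℝ → ℝ → ℝ) (μpos μneg : Measure (ℝ × ℝ)) : Prop where
  mutuallySingular : μpos ⟂ₘ μneg
  lt_top_of_isCompact : ∀ K : Set (ℝ × ℝ), IsCompact K → K ⊆ offDiagonalSquare →
    μpos K < ⊤ ∧ μneg K < ⊤
  integral_eq : ∀ φ : ℝ × ℝ → ℝ, ContDiff ℝ (⊤ : ℕ∞) φ → HasCompactSupport φ →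
    tsupport φ ⊆ offDiagonalSquare →
    ∫ p : ℝ × ℝ, F p.1 p.2 * mixedDeriv φ p = ∫ p, φ p ∂μpos - ∫ p, φ p ∂μneg

/-- The regularity hypotheses of order `m` on the process `X`, relative to a univariate function
`δsq` on `[0,1]` (the square of the univariate `δ`). -/
structure RegularityHypotheses {Ω : Type*} [MeasurableSpace Ω] (m : ℕ)
    (X : Icc (0 : ℝ) 1 → Ω → ℝ) (P : Measure Ω) (δsq : ℝ → ℝ) : Prop where
  /-- The univariate `δ²` is increasing and concave. -/
  monotoneOn_univariate : MonotoneOn δsq (Icc 0 1)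
  concaveOn_univariate : ConcaveOn ℝ (Icc 0 1) δsq
  /-- `δ²(s,t) ≤ δ²(|t - s|)`. -/
  metric_le : ∀ s ∈ Icc (0 : ℝ) 1, ∀ t ∈ Icc (0 : ℝ) 1,
    canonicalMetricSq X P s t ≤ δsq |t - s|
  /-- `δ(r) = o(r^{1/(2m)})` as `r → 0`. -/
  isLittleO_univariate :
    (fun r : ℝ => √(δsq r)) =o[𝓝[>] 0] fun r : ℝ => r ^ (1 / (2 * (m : ℝ)))
  /-- The mixed derivative of `δ²` is a signed measure off the diagonal, with total variation
  `O(ε^{-(m-1)/m})` at distance `ε` from the diagonal. -/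
  mixed_deriv : ∃ μpos μneg : Measure (ℝ × ℝ),
    HasMixedDerivMeasure (canonicalMetricSq X P) μpos μneg ∧
    ∃ C : ℝ, ∀ᶠ ε : ℝ in 𝓝[>] 0,
      (μpos + μneg) (offDiagonalSimplex ε) ≤ ENNReal.ofReal (C * ε ^ (-((m : ℝ) - 1) / m))
  /-- The variance is increasing and concave. -/
  monotoneOn_variance : MonotoneOn (fun u => covFun X P u u) (Icc 0 1)
  concaveOn_variance : ConcaveOn ℝ (Icc 0 1) fun u => covFun X P u u
  /-- For `u < v`, the function `v ↦ δ²(u,v)` is increasing and concave. -/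
  monotoneOn_right : ∀ u ∈ Icc (0 : ℝ) 1, MonotoneOn (fun v => canonicalMetricSq X P u v) (Ioc u 1)
  concaveOn_right : ∀ u ∈ Icc (0 : ℝ) 1,
    ConcaveOn ℝ (Ioc u 1) fun v => canonicalMetricSq X P u v
  /-- For `u < v`, the function `u ↦ -δ²(u,v)` is increasing, and it is concave or convex. -/
  monotoneOn_left : ∀ v ∈ Icc (0 : ℝ) 1,
    MonotoneOn (fun u => -canonicalMetricSq X P u v) (Ico 0 v)
  concaveOn_or_convexOn_left : ∀ v ∈ Icc (0 : ℝ) 1,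
    ConcaveOn ℝ (Ico 0 v) (fun u => -canonicalMetricSq X P u v) ∨
    ConvexOn ℝ (Ico 0 v) fun u => -canonicalMetricSq X P u v
  /-- The coercivity and strict concavity conditions. -/
  coercive : ∃ a b c c' : ℝ, 1 < a ∧ 0 < b ∧ b < 1 / 2 ∧ 1 / 4 < c ∧ 0 < c' ∧
    (∀ u v : ℝ, 0 < u → u < v → v ≤ 1 →
      c * δsq u ≤ covFun X P u u ∧
      c' * δsq u * δsq (v - u) ≤ covFun X P u u * covFun X P v v - covFun X P u v ^ 2) ∧
    ∀ u : ℝ, 0 < u → a * u ≤ 1 →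
      (√(δsq (a * u)) - √(δsq u)) / ((a - 1) * u) < b * (√(δsq u) / u)

/-- The integrand `(X_{u+ε} - X_u) (Y_{u+ε} + Y_u) / 2` of the symmetric regularization. -/
def symmetricIntegrand {Ω : Type*} (Y X : Icc (0 : ℝ) 1 → Ω → ℝ) (ε : ℝ) (ω : Ω) (u : ℝ) : ℝ :=
  (extendProcess X (u + ε) ω - extendProcess X u ω) *
    ((1 / 2) * (extendProcess Y (u + ε) ω + extendProcess Y u ω))

/-- The random variable `I` is the symmetric (generalized Stratonovich) integral
`∫_0^t Y_u d°X_u`: its regularizations are almost surely well-defined Lebesgue integrals, and they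
converge to `I` in probability as `ε` decreases to `0`. -/
structure IsSymmetricIntegral {Ω : Type*} [MeasurableSpace Ω] (P : Measure Ω)
    (Y X : Icc (0 : ℝ) 1 → Ω → ℝ) (t : ℝ) (I : Ω → ℝ) : Prop where
  aemeasurable : AEMeasurable I P
  intervalIntegrable : ∀ ε : ℝ, 0 < ε →
    ∀ᵐ ω ∂P, IntervalIntegrable (symmetricIntegrand Y X ε ω) volume 0 t
  tendsto : TendstoInMeasure P
    (fun (ε : ℝ) ω => (1 / ε) * ∫ u in (0 : ℝ)..t, symmetricIntegrand Y X ε ω u) (𝓝[>] 0) I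

end

/-! The candidate for the integral is $f(X_t)-f(X_0)$, so the formula is immediate and everything
lies in the convergence. The integrand of the regularization is $f(X_{u+\varepsilon})-f(X_u)$ minus
the error $T_u$ of the trapezoidal rule for $f'$ between $X_u$ and $X_{u+\varepsilon}$. The average
$\varepsilon^{-1}\int_0^t(f(X_{u+\varepsilon})-f(X_u))\,du$ telescopes to two boundary averages and
tends to $f(X_t)-f(X_0)$ by continuity of the process in $L^2$
(`tendstoInMeasure_average_increment`). It remains to show $\varepsilon^{-1}\int_0^t T_u\,du\to0$ in
$L^2$, that is, to bound $\varepsilon^{-2}\iint|E[T_uT_v]|\,du\,dv$.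

The error $T$ is odd and of third order in the increment. Near the diagonal and the boundary, a
region of area $O(\varepsilon)$, the crude bound $|E[T_uT_v]|\lesssim\delta^6(\varepsilon)$
suffices. Elsewhere cancellation is needed: with $G,G'$ the increments and $Z,Z'$ the midpoints,
`abs_integral_trapezoidError_mul_le` gives
$|E[T_uT_v]|\lesssim\delta^4(\varepsilon)\,(|\mathrm{cov}(G,G')|+\sum\mathrm{cov}(\text{midpoint},\text{increment})^2)$.
For this the midpoints are regressed on $(G,G')$ and the product is expanded around the residuals.
The linear terms vanish by the symmetry $(G,G')\mapsto(-G,-G')$; the leading term would vanish by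
oddness if $G,G'$ were independent, and costs one factor of their covariance.

The covariance of the increments is minus half the rectangular increment of $\delta^2(s,t)$. By
Tonelli its integral is at most a constant times $\varepsilon^2|\mu|$ of the simplex at distance
$\varepsilon$ from the diagonal, which is $O(\varepsilon^{2-2/3})$
(`lintegral_rectangular_increment_le`). The covariances with midpoints are combinations of
increments of $Q_u$, $\delta^2(u,\cdot)$ and $\delta^2(\cdot,v)$. Comparison of slopes bounds them
by a constant times $\varepsilon(u^{-5/6}+(v-u)^{-5/6})$ (`abs_inner_midpoint_increment_le`), whose
square also integrates to $O(\varepsilon^{2-2/3})$. Hence the second moment is at most a constant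
times $x^3+x^2$ with $x=\delta^2(\varepsilon)\varepsilon^{-1/3}\to0$.

These estimates need bounded derivatives, whereas $f$ is arbitrary. A dyadic chaining argument
yields an integrable variable dominating $|X_u|$ almost surely for each $u$
(`lintegral_pathMajorant_lt_top`, `ae_enorm_extendProcess_le`). This gives the integrability of the
regularizations, and lets $f$ be replaced by compactly supported functions outside events of small
probability (`tendstoInMeasure_of_eq_outside`). -/

/-! ### Trapezoidal error: oddness, size and expansion in the midpoint -/

/-- The error of the trapezoidal rule for `f'` on the interval of midpoint `m` and length `h`. -/
noncomputable def trapezoidError (f : ℝ → ℝ) (m h : ℝ) : ℝ :=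
  f (m + h / 2) - f (m - h / 2) - h * (1 / 2 * (deriv f (m + h / 2) + deriv f (m - h / 2)))

lemma trapezoidError_neg (f : ℝ → ℝ) (m h : ℝ) :
    trapezoidError f m (-h) = -trapezoidError f m h := by
  have h1 : m + -h / 2 = m - h / 2 := by ring
  have h2 : m - -h / 2 = m + h / 2 := by ring
  simp only [trapezoidError, h1, h2]; ring

lemma trapezoidError_zero (f : ℝ → ℝ) (m : ℝ) : trapezoidError f m 0 = 0 := by
  simp [trapezoidError]

lemma abs_sub_le_of_deriv_bound {g g' : ℝ → ℝ} {C : ℝ} (hg : ∀ x, HasDerivAt g (g' x) x)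
    (a b : ℝ) (hC : ∀ x ∈ uIcc a b, |g' x| ≤ C) : |g b - g a| ≤ C * |b - a| := by
  have := (convex_uIcc a b).norm_image_sub_le_of_norm_hasDerivWithin_le
    (f := g) (f' := g') (C := C) (x := a) (y := b) (fun x _ => (hg x).hasDerivWithinAt)
    (fun x hx => hC x hx) left_mem_uIcc right_mem_uIcc
  simpa using this

section
variable {f : ℝ → ℝ} {M : ℝ}

/-- The first-order terms cancel, leaving $h$ times a difference of $f''$ over an interval of length
$|h|$. The derivative is thus quadratic in $h$ and the error itself cubic. -/
lemma hasDerivAt_trapezoidError_right (hf : ContDiff ℝ 2 f) (m h : ℝ) :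
    HasDerivAt (trapezoidError f m)
      (-(h / 4) * (deriv (deriv f) (m + h / 2) - deriv (deriv f) (m - h / 2))) h := by
  have hf1 : ContDiff ℝ 1 (deriv f) := hf.deriv'
  have d0 : ∀ x, HasDerivAt f (deriv f x) x :=
    fun x => (hf.differentiable (by norm_num) x).hasDerivAt
  have d1 : ∀ x, HasDerivAt (deriv f) (deriv (deriv f) x) x :=
    fun x => (hf1.differentiable (by norm_num) x).hasDerivAt
  have p : HasDerivAt (fun h : ℝ => m + h / 2) (1 / 2) h := ((hasDerivAt_id h).div_const 2).const_add m
  have q : HasDerivAt (fun h : ℝ => m - h / 2) (-(1 / 2)) h := ((hasDerivAt_id h).div_const 2).const_sub m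
  have a := (d0 _).comp h p
  have b := (d0 _).comp h q
  have c := (d1 _).comp h p
  have d := (d1 _).comp h q
  have e := (a.sub b).sub ((hasDerivAt_id h).mul ((c.add d).const_mul (1 / 2)))
  refine e.congr_deriv ?_
  simp only [id, Function.comp_apply, Pi.add_apply]
  ring

/-- Forming the error commutes with differentiation in the midpoint. Every term of a Taylor
expansion in the midpoint is again a trapezoidal error, hence odd and cubic in $h$. -/
lemma hasDerivAt_trapezoidError_left (hf : ContDiff ℝ 2 f) (m h : ℝ) :
    HasDerivAt (fun m => trapezoidError f m h) (trapezoidError (deriv f) m h) m := by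
  have hf1 : ContDiff ℝ 1 (deriv f) := hf.deriv'
  have d0 : ∀ x, HasDerivAt f (deriv f x) x :=
    fun x => (hf.differentiable (by norm_num) x).hasDerivAt
  have d1 : ∀ x, HasDerivAt (deriv f) (deriv (deriv f) x) x :=
    fun x => (hf1.differentiable (by norm_num) x).hasDerivAt
  have a := (d0 (m + h / 2)).comp_add_const m (h / 2)
  have b := (d0 (m - h / 2)).comp_sub_const m (h / 2)
  have c := (d1 (m + h / 2)).comp_add_const m (h / 2)
  have d := (d1 (m - h / 2)).comp_sub_const m (h / 2)
  exact (a.sub b).sub (((c.add d).const_mul (1 / 2)).const_mul h)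

lemma abs_trapezoidError_sub_le (hf : ContDiff ℝ 3 f) (hM : ∀ x, |deriv (deriv (deriv f)) x| ≤ M)
    (m h h' : ℝ) :
    |trapezoidError f m h - trapezoidError f m h'| ≤ M * (|h - h'| * (h ^ 2 + h' ^ 2)) := by
  have hf2 : ContDiff ℝ 1 (deriv (deriv f)) := ContDiff.deriv' (ContDiff.deriv' (n := 2) hf)
  have M0 : 0 ≤ M := (abs_nonneg _).trans (hM 0)
  have key : ∀ x ∈ uIcc h' h,
      |-(x / 4) * (deriv (deriv f) (m + x / 2) - deriv (deriv f) (m - x / 2))|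
        ≤ M * (h ^ 2 + h' ^ 2) := by
    intro x hx
    have h1 := abs_sub_le_of_deriv_bound
      (fun y => (hf2.differentiable (by norm_num) y).hasDerivAt) (m - x / 2) (m + x / 2)
      (fun y _ => hM y)
    have h2 : m + x / 2 - (m - x / 2) = x := by ring
    rw [h2] at h1
    have h3 : x ^ 2 ≤ h ^ 2 + h' ^ 2 := by
      rcases mem_uIcc.1 hx with h4 | h4 <;> rcases le_total 0 x with h5 | h5 <;>
        nlinarith [sq_nonneg h, sq_nonneg h']
    rw [abs_mul]
    calc _ ≤ |x| / 4 * (M * |x|) := by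
          gcongr
          rw [abs_neg, abs_div]; norm_num
      _ = M * x ^ 2 / 4 := by rw [← sq_abs x]; ring
      _ ≤ M * (h ^ 2 + h' ^ 2) := by nlinarith [mul_le_mul_of_nonneg_left h3 M0, sq_nonneg x]
  have := abs_sub_le_of_deriv_bound
    (fun y => hasDerivAt_trapezoidError_right (hf.of_le (by norm_num)) m y) h' h key
  calc _ ≤ _ := this
    _ = _ := by ring

lemma abs_trapezoidError_le (hf : ContDiff ℝ 3 f) (hM : ∀ x, |deriv (deriv (deriv f)) x| ≤ M)
    (m h : ℝ) : |trapezoidError f m h| ≤ M * |h| ^ 3 := by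
  have := abs_trapezoidError_sub_le hf hM m h 0
  rw [trapezoidError_zero] at this
  simp only [sub_zero] at this
  calc _ ≤ _ := this
    _ = _ := by rw [← sq_abs h]; ring

lemma abs_trapezoidError_add_sub_le (hf : ContDiff ℝ 4 f)
    (hM : ∀ x, |deriv (deriv (deriv (deriv f))) x| ≤ M) (m l h : ℝ) :
    |trapezoidError f (m + l) h - trapezoidError f m h| ≤ M * |h| ^ 3 * |l| := by
  have hf1 : ContDiff ℝ 3 (deriv f) := ContDiff.deriv' (n := 3) hf
  have := abs_sub_le_of_deriv_bound
    (fun y => hasDerivAt_trapezoidError_left (hf.of_le (by norm_num)) y h) m (m + l)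
    (fun y _ => abs_trapezoidError_le hf1 hM y h)
  simpa using this

/-- The mean value bound is applied to the error minus its linear part. That function has derivative
`trapezoidError (deriv f) y h - trapezoidError (deriv f) m h`, which is small by the first-order
estimate for `deriv f`. -/
lemma abs_trapezoidError_taylor_le (hf : ContDiff ℝ 5 f)
    (hM : ∀ x, |deriv (deriv (deriv (deriv (deriv f)))) x| ≤ M) (m l h : ℝ) :
    |trapezoidError f (m + l) h - trapezoidError f m h - l * trapezoidError (deriv f) m h|
      ≤ M * |h| ^ 3 * l ^ 2 := by
  have hf1 : ContDiff ℝ 4 (deriv f) := ContDiff.deriv' (n := 4) hf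
  have M0 : 0 ≤ M := (abs_nonneg _).trans (hM 0)
  have d : ∀ y, HasDerivAt (fun y => trapezoidError f y h - (y - m) * trapezoidError (deriv f) m h)
      (trapezoidError (deriv f) y h - trapezoidError (deriv f) m h) y := by
    intro y
    have := (hasDerivAt_trapezoidError_left (hf.of_le (by norm_num)) y h).sub
      (((hasDerivAt_id y).sub_const m).mul_const (trapezoidError (deriv f) m h))
    exact this.congr_deriv (by ring)
  have := abs_sub_le_of_deriv_bound d m (m + l) (C := M * |h| ^ 3 * |l|) (fun y hy => by
    have h1 := abs_trapezoidError_add_sub_le hf1 hM m (y - m) h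
    rw [add_sub_cancel] at h1
    refine h1.trans (mul_le_mul_of_nonneg_left ?_ (by positivity))
    simpa using abs_sub_left_of_mem_uIcc hy)
  simp only [add_sub_cancel_left, sub_self, zero_mul, sub_zero] at this
  calc _ = |trapezoidError f (m + l) h - l * trapezoidError (deriv f) m h - trapezoidError f m h| := by
        congr 1; ring
    _ ≤ _ := this
    _ = _ := by rw [← sq_abs l]; ring

/-- The product of two trapezoidal errors, expanded to first order in the midpoints. -/
lemma abs_trapezoidError_mul_taylor_le (hf : ContDiff ℝ 5 f)
    (h3 : ∀ x, |deriv (deriv (deriv f)) x| ≤ M)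
    (h4 : ∀ x, |deriv (deriv (deriv (deriv f))) x| ≤ M)
    (h5 : ∀ x, |deriv (deriv (deriv (deriv (deriv f)))) x| ≤ M) (m l h m' l' h' : ℝ) :
    |trapezoidError f (m + l) h * trapezoidError f (m' + l') h'
      - trapezoidError f m h * trapezoidError f m' h'
      - l * trapezoidError (deriv f) m h * trapezoidError f m' h'
      - l' * trapezoidError f m h * trapezoidError (deriv f) m' h'|
      ≤ 2 * M ^ 2 * (|h| ^ 3 * |h'| ^ 3 * (l ^ 2 + l' ^ 2)) := by
  have hf1 : ContDiff ℝ 3 (deriv f) := ContDiff.deriv' (n := 3) (hf.of_le (by norm_num))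
  have M0 : 0 ≤ M := (abs_nonneg _).trans (h3 0)
  have a := abs_trapezoidError_taylor_le hf h5 m l h
  have a' := abs_trapezoidError_taylor_le hf h5 m' l' h'
  have b := abs_trapezoidError_le hf1 h4 m h
  have c := abs_trapezoidError_le (hf.of_le (by norm_num)) h3 m h
  have c' := abs_trapezoidError_le (hf.of_le (by norm_num)) h3 (m' + l') h'
  have e' := abs_trapezoidError_add_sub_le (hf.of_le (by norm_num)) h4 m' l' h'
  set A := trapezoidError f (m + l) h
  set A0 := trapezoidError f m h
  set A1 := trapezoidError (deriv f) m h
  set B := trapezoidError f (m' + l') h'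
  set B0 := trapezoidError f m' h'
  set B1 := trapezoidError (deriv f) m' h'
  have id : A * B - A0 * B0 - l * A1 * B0 - l' * A0 * B1
      = (A - A0 - l * A1) * B + l * A1 * (B - B0) + A0 * (B - B0 - l' * B1) := by ring
  rw [id]
  calc _ ≤ |A - A0 - l * A1| * |B| + |l| * |A1| * |B - B0| + |A0| * |B - B0 - l' * B1| := by
        refine (abs_add_le _ _).trans (add_le_add ((abs_add_le _ _).trans (add_le_add ?_ ?_)) ?_)
        · rw [abs_mul]
        · rw [abs_mul, abs_mul]
        · rw [abs_mul]
    _ ≤ M * |h| ^ 3 * l ^ 2 * (M * |h'| ^ 3) + |l| * (M * |h| ^ 3) * (M * |h'| ^ 3 * |l'|)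
        + M * |h| ^ 3 * (M * |h'| ^ 3 * l' ^ 2) := by gcongr
    _ = M ^ 2 * (|h| ^ 3 * |h'| ^ 3 * (l ^ 2 + l' ^ 2 + |l| * |l'|)) := by ring
    _ ≤ M ^ 2 * (|h| ^ 3 * |h'| ^ 3 * (2 * (l ^ 2 + l' ^ 2))) := by
        gcongr
        rw [← sq_abs l, ← sq_abs l']
        nlinarith [sq_nonneg (|l| - |l'|), sq_nonneg (|l|), sq_nonneg (|l'|)]
    _ = _ := by ring

lemma continuous_trapezoidError (hf : ContDiff ℝ 1 f) :
    Continuous fun p : ℝ × ℝ => trapezoidError f p.1 p.2 := by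
  have h1 : Continuous (deriv f) := hf.continuous_deriv le_rfl
  have h0 := hf.continuous
  unfold trapezoidError
  fun_prop

end

/-! ### Gaussian moments and sign symmetries -/

/-- The absolute moments of the standard normal law. -/
noncomputable def gaussianAbsMoment (n : ℕ) : ℝ := ∫ x, |x| ^ n ∂gaussianReal 0 1

/-- A common bound for the first absolute moments of the standard normal law. -/
noncomputable def gaussianMomentBound : ℝ := ∑ n ∈ Finset.range 49, gaussianAbsMoment n

lemma gaussianAbsMoment_nonneg (n : ℕ) : 0 ≤ gaussianAbsMoment n :=
  integral_nonneg fun _ => by positivity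

lemma gaussianAbsMoment_le {n : ℕ} (hn : n < 49) : gaussianAbsMoment n ≤ gaussianMomentBound :=
  Finset.single_le_sum (f := gaussianAbsMoment) (fun i _ => gaussianAbsMoment_nonneg i)
    (Finset.mem_range.2 hn)

lemma gaussianMomentBound_nonneg : 0 ≤ gaussianMomentBound :=
  Finset.sum_nonneg fun i _ => gaussianAbsMoment_nonneg i

lemma integral_mul_le_sqrt_mul_sqrt {Ω : Type*} [MeasurableSpace Ω] {P : Measure Ω} {f g : Ω → ℝ}
    (hf : MemLp f 2 P) (hg : MemLp g 2 P) (hf0 : 0 ≤ f) (hg0 : 0 ≤ g) :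
    ∫ ω, f ω * g ω ∂P ≤ √(∫ ω, f ω ^ 2 ∂P) * √(∫ ω, g ω ^ 2 ∂P) := by
  have h2 : ENNReal.ofReal 2 = 2 := by norm_num
  have := integral_mul_le_Lp_mul_Lq_of_nonneg (μ := P) Real.HolderConjugate.two_two
    (ae_of_all _ hf0) (ae_of_all _ hg0) (by rwa [h2]) (by rwa [h2])
  simpa [Real.sqrt_eq_rpow] using this

section
variable {Ω : Type*} [MeasurableSpace Ω] {P : Measure Ω}

lemma memLp_abs_pow_of_hasGaussianLaw {G : Ω → ℝ} (hG : HasGaussianLaw G P) (n : ℕ) :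
    MemLp (fun ω => |G ω| ^ n) 2 P := by
  have := hG.isProbabilityMeasure
  rcases Nat.eq_zero_or_pos n with rfl | hn
  · simpa using memLp_const (1 : ℝ)
  have h1 : MemLp G ((n : ENNReal) * 2) P :=
    hG.memLp (ENNReal.mul_ne_top (ENNReal.natCast_ne_top n) (by norm_num))
  have := h1.norm_rpow_div (n : ENNReal)
  rw [mul_comm, ENNReal.mul_div_cancel_right (by exact_mod_cast hn.ne')
    (ENNReal.natCast_ne_top n)] at this
  simpa using this

lemma integral_abs_pow_of_hasGaussianLaw {G : Ω → ℝ} (hG : HasGaussianLaw G P)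
    (h0 : ∫ ω, G ω ∂P = 0) (n : ℕ) :
    ∫ ω, |G ω| ^ n ∂P = √Var[G; P] ^ n * gaussianAbsMoment n := by
  have hv := variance_nonneg G P
  have h1 : P.map G = (gaussianReal 0 1).map (fun x => √Var[G; P] * x) := by
    rw [hG.map_eq_gaussianReal, gaussianReal_map_const_mul]
    congr 1
    · simpa using h0
    · ext; simp [Real.sq_sqrt hv, hv]
  have h2 : ∫ ω, |G ω| ^ n ∂P = ∫ x, |x| ^ n ∂(P.map G) :=
    (integral_map (φ := G) (f := fun x : ℝ => |x| ^ n) hG.aemeasurable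
      (by fun_prop)).symm
  rw [h2, h1, integral_map (by fun_prop) (by fun_prop)]
  simp_rw [abs_mul, mul_pow, abs_of_nonneg (Real.sqrt_nonneg Var[G; P])]
  rw [integral_const_mul, gaussianAbsMoment]

lemma integrable_abs_pow_mul_abs_pow {G G' : Ω → ℝ} (hG : HasGaussianLaw G P)
    (hG' : HasGaussianLaw G' P) (i j : ℕ) :
    Integrable (fun ω => |G ω| ^ i * |G' ω| ^ j) P :=
  (memLp_abs_pow_of_hasGaussianLaw hG i).integrable_mul (memLp_abs_pow_of_hasGaussianLaw hG' j)

/-- Cauchy–Schwarz separates the two variables whatever their correlation. It doubles the exponents,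
so exponents up to 24 need the moments up to order 48 collected in `gaussianMomentBound`. -/
lemma integral_abs_pow_mul_abs_pow_le {G G' : Ω → ℝ} (hG : HasGaussianLaw G P)
    (hG' : HasGaussianLaw G' P) (h0 : ∫ ω, G ω ∂P = 0) (h0' : ∫ ω, G' ω ∂P = 0)
    {i j : ℕ} (hi : i ≤ 24) (hj : j ≤ 24) :
    ∫ ω, |G ω| ^ i * |G' ω| ^ j ∂P ≤
      gaussianMomentBound * (√Var[G; P] ^ i * √Var[G'; P] ^ j) := by
  have h := integral_mul_le_sqrt_mul_sqrt (memLp_abs_pow_of_hasGaussianLaw hG i)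
    (memLp_abs_pow_of_hasGaussianLaw hG' j) (fun _ => by positivity) (fun _ => by positivity)
  simp_rw [← pow_mul, integral_abs_pow_of_hasGaussianLaw hG h0,
    integral_abs_pow_of_hasGaussianLaw hG' h0', pow_mul] at h
  rw [Real.sqrt_mul (by positivity), Real.sqrt_mul (by positivity),
    Real.sqrt_sq (by positivity), Real.sqrt_sq (by positivity)] at h
  have a : √(gaussianAbsMoment (i * 2)) ≤ √gaussianMomentBound :=
    Real.sqrt_le_sqrt (gaussianAbsMoment_le (by omega))
  have b : √(gaussianAbsMoment (j * 2)) ≤ √gaussianMomentBound :=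
    Real.sqrt_le_sqrt (gaussianAbsMoment_le (by omega))
  calc _ ≤ _ := h
    _ ≤ (√Var[G; P] ^ i * √gaussianMomentBound) * (√Var[G'; P] ^ j * √gaussianMomentBound) := by
        gcongr
    _ = (√gaussianMomentBound * √gaussianMomentBound) * (√Var[G; P] ^ i * √Var[G'; P] ^ j) := by
        ring
    _ = _ := by rw [Real.mul_self_sqrt gaussianMomentBound_nonneg]

/-- A centered Gaussian vector is invariant in law under the sign changes that preserve its
covariance matrix. -/
lemma identDistrib_mul_of_hasGaussianLaw {ι : Type*} [Fintype ι] {Y : ι → Ω → ℝ}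
    (hY : HasGaussianLaw (fun ω i => Y i ω) P) (h0 : ∀ i, ∫ ω, Y i ω ∂P = 0) (s : ι → ℝ)
    (hs : ∀ i j, s i * s j * cov[Y i, Y j; P] = cov[Y i, Y j; P]) :
    IdentDistrib (fun ω i => Y i ω) (fun ω i => s i * Y i ω) P P := by
  classical
  have := hY.isProbabilityMeasure
  let A : (ι → ℝ) →L[ℝ] (ι → ℝ) :=
    ContinuousLinearMap.pi fun i => s i • ContinuousLinearMap.proj i
  have hY' : HasGaussianLaw (fun ω i => s i * Y i ω) P := hY.map A
  -- The law of a centered Gaussian vector is determined by the variances of its linear forms, and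
  -- these are quadratic forms in the covariance matrix, which the sign change preserves.
  refine ⟨hY.aemeasurable, hY'.aemeasurable, Measure.ext_of_charFunDual ?_⟩
  funext L
  have hL : ∀ y : ι → ℝ, L y = ∑ i, L (Pi.single i 1) * y i := by
    intro y
    conv_lhs => rw [pi_eq_sum_univ' y]
    simp [map_sum, mul_comm]
  have m : ∀ i, MemLp (Y i) 2 P := fun i => (hY.eval i).memLp_two
  rw [hY.charFunDual_map_eq, hY'.charFunDual_map_eq]
  have e1 : L ∘ (fun ω i => Y i ω) = fun ω => ∑ i, L (Pi.single i 1) * Y i ω := by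
    ext ω; exact hL _
  have e2 : L ∘ (fun ω i => s i * Y i ω) = fun ω => ∑ i, (L (Pi.single i 1) * s i) * Y i ω := by
    ext ω; simp only [Function.comp_apply]; rw [hL]; simp [mul_assoc]
  have mean : ∀ c : ι → ℝ, ∫ ω, ∑ i, c i * Y i ω ∂P = 0 := by
    intro c
    rw [integral_finsetSum _ fun i _ => ((m i).integrable (by norm_num)).const_mul _]
    simp [integral_const_mul, h0]
  have var : ∀ c : ι → ℝ, Var[fun ω => ∑ i, c i * Y i ω; P]
      = ∑ i, ∑ j, c i * (c j * cov[Y i, Y j; P]) := by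
    intro c
    rw [← covariance_self (Finset.aemeasurable_fun_sum _ fun i _ => (m i).aemeasurable.const_mul _),
      covariance_fun_sum_fun_sum (fun i => (m i).const_mul _) (fun i => (m i).const_mul _)]
    simp only [covariance_const_mul_left, covariance_const_mul_right]
    exact Finset.sum_congr rfl fun i _ => Finset.sum_congr rfl fun j _ => by ring
  have hm1 : ∫ ω, (L ∘ fun ω i => Y i ω) ω ∂P = 0 := by rw [e1]; exact mean _
  have hm2 : ∫ ω, (L ∘ fun ω i => s i * Y i ω) ω ∂P = 0 := by rw [e2]; exact mean _
  rw [e1, e2, var, var]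
  have : ∀ i j, L (Pi.single i 1) * s i * (L (Pi.single j 1) * s j * cov[Y i, Y j; P])
      = L (Pi.single i 1) * (L (Pi.single j 1) * cov[Y i, Y j; P]) := fun i j => by
    conv_rhs => rw [← hs i j]
    ring
  simp only [this, mean]

lemma integral_eq_zero_of_identDistrib_of_odd {E : Type*} [MeasurableSpace E] {Y Y' : Ω → E}
    (h : IdentDistrib Y Y' P P) {Φ : E → ℝ} (hΦ : Measurable Φ)
    (hodd : ∀ ω, Φ (Y' ω) = -Φ (Y ω)) : ∫ ω, Φ (Y ω) ∂P = 0 := by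
  have h1 := (h.comp hΦ).integral_eq
  simp only [Function.comp_apply, hodd, integral_neg] at h1
  linarith

end

/-! ### Regression on two increments and the main covariance estimate -/

/-- The linear algebra of the regression of a variable on two weakly correlated variables: here
`v`, `w` are the variances, `t` the covariance of the regressors and `r`, `q` the covariances with
the regressors. -/
lemma exists_regression_coeff {v w t : ℝ} (hv : 0 < v) (hw : 0 < w) (ht : 4 * t ^ 2 < v * w)
    (r q : ℝ) : ∃ a b : ℝ, r - a * v - b * t = 0 ∧ q - a * t - b * w = 0 ∧
      a ^ 2 * v ≤ 4 * (r ^ 2 / v + q ^ 2 / w) ∧ b ^ 2 * w ≤ 4 * (r ^ 2 / v + q ^ 2 / w) := by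
  have hvw := mul_pos hv hw
  set d := v * w - t ^ 2 with hd
  -- The squared correlation is below $1/4$, so the determinant stays comparable to $vw$ and the
  -- normal equations are well conditioned.
  have d0 : 3 / 4 * (v * w) < d := by rw [hd]; linarith
  have dp : 0 < d := lt_trans (by positivity) d0
  have d2 : 9 / 16 * (v * w) ^ 2 ≤ d ^ 2 := by nlinarith
  have main : ∀ {v w : ℝ} (r q : ℝ), 0 < v → 0 < w → 4 * t ^ 2 < v * w →
      9 / 16 * (v * w) ^ 2 ≤ d ^ 2 →
      ((w * r - t * q) / d) ^ 2 * v ≤ 4 * (r ^ 2 / v + q ^ 2 / w) := by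
    intro v w r q hv hw ht d2
    -- This is $(x-y)^2\le2x^2+2y^2$ together with $t^2<vw/4$.
    have h1 : (w * r - t * q) ^ 2 ≤ 2 * (w ^ 2 * r ^ 2) + v * w / 2 * q ^ 2 := by
      nlinarith [sq_nonneg (w * r + t * q), mul_le_mul_of_nonneg_right ht.le (sq_nonneg q)]
    have h2 : 4 * (r ^ 2 / v + q ^ 2 / w) = 4 * (w * r ^ 2 + v * q ^ 2) / (v * w) := by
      field_simp
    rw [h2, div_pow, div_mul_eq_mul_div, div_le_div_iff₀ (by positivity) (by positivity)]
    have h3 : (w * r - t * q) ^ 2 * v * (v * w) ≤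
        (2 * (w ^ 2 * r ^ 2) + v * w / 2 * q ^ 2) * v * (v * w) := by gcongr
    have h4 : 4 * (w * r ^ 2 + v * q ^ 2) * (9 / 16 * (v * w) ^ 2)
        ≤ 4 * (w * r ^ 2 + v * q ^ 2) * d ^ 2 := by gcongr
    refine h3.trans (le_trans ?_ h4)
    have : 0 ≤ v ^ 2 * w ^ 3 * r ^ 2 := by positivity
    have : 0 ≤ v ^ 3 * w ^ 2 * q ^ 2 := by positivity
    nlinarith
  refine ⟨(w * r - t * q) / d, (v * q - t * r) / d, ?_, ?_, main r q hv hw ht d2, ?_⟩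
  · field_simp
    rw [hd]; ring
  · field_simp
    rw [hd]; ring
  · rw [add_comm (r ^ 2 / v)]
    exact main q r hw hv (by linarith) (by rw [mul_comm w v]; exact d2)

section
variable {Ω : Type*} [MeasurableSpace Ω] {P : Measure Ω}

lemma hasGaussianLaw_matrix {ι κ : Type*} [Fintype ι] [Fintype κ] {V : ι → Ω → ℝ}
    (hV : HasGaussianLaw (fun ω i => V i ω) P) (A : κ → ι → ℝ) :
    HasGaussianLaw (fun ω k => ∑ i, A k i * V i ω) P := by
  let L : (ι → ℝ) →L[ℝ] (κ → ℝ) :=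
    ContinuousLinearMap.pi fun k => ∑ i, A k i • ContinuousLinearMap.proj i
  have h : (fun ω k => ∑ i, A k i * V i ω) = L ∘ fun ω i => V i ω := by
    ext ω k
    simp [L]
  rw [h]
  exact hV.map L

variable {f : ℝ → ℝ} {M : ℝ}

lemma abs_trapezoidError_mul_le (hf : ContDiff ℝ 3 f)
    (h3 : ∀ x, |deriv (deriv (deriv f)) x| ≤ M) (m h m' h' : ℝ) :
    |trapezoidError f m h * trapezoidError f m' h'| ≤ M ^ 2 * (|h| ^ 3 * |h'| ^ 3) := by
  have M0 : 0 ≤ M := (abs_nonneg _).trans (h3 0)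
  rw [abs_mul]
  calc _ ≤ M * |h| ^ 3 * (M * |h'| ^ 3) := by
        gcongr <;> exact abs_trapezoidError_le hf h3 _ _
    _ = _ := by ring

lemma aestronglyMeasurable_trapezoidError (hf : ContDiff ℝ 1 f) {Z G : Ω → ℝ}
    (hZ : AEMeasurable Z P) (hG : AEMeasurable G P) :
    AEStronglyMeasurable (fun ω => trapezoidError f (Z ω) (G ω)) P :=
  ((continuous_trapezoidError hf).measurable.comp_aemeasurable
    (hZ.prodMk hG)).aestronglyMeasurable

lemma integrable_trapezoidError_mul (hf : ContDiff ℝ 3 f)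
    (h3 : ∀ x, |deriv (deriv (deriv f)) x| ≤ M) {G G' Z Z' : Ω → ℝ}
    (hG : HasGaussianLaw G P) (hG' : HasGaussianLaw G' P)
    (hZ : AEMeasurable Z P) (hZ' : AEMeasurable Z' P) :
    Integrable (fun ω => trapezoidError f (Z ω) (G ω) * trapezoidError f (Z' ω) (G' ω)) P := by
  refine ((integrable_abs_pow_mul_abs_pow hG hG' 3 3).const_mul (M ^ 2)).mono'
    ((aestronglyMeasurable_trapezoidError (hf.of_le (by norm_num)) hZ hG.aemeasurable).mul
      (aestronglyMeasurable_trapezoidError (hf.of_le (by norm_num)) hZ' hG'.aemeasurable))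
    (ae_of_all _ fun ω => abs_trapezoidError_mul_le hf h3 _ _ _ _)

/-- No cancellation is used here, so the bound needs nothing about the correlations. It serves near
the diagonal and when the increments are strongly correlated. -/
lemma abs_integral_trapezoidError_mul_le_crude (hf : ContDiff ℝ 3 f)
    (h3 : ∀ x, |deriv (deriv (deriv f)) x| ≤ M) {G G' Z Z' : Ω → ℝ}
    (hG : HasGaussianLaw G P) (hG' : HasGaussianLaw G' P)
    (h0 : ∫ ω, G ω ∂P = 0) (h0' : ∫ ω, G' ω ∂P = 0) :
    |∫ ω, trapezoidError f (Z ω) (G ω) * trapezoidError f (Z' ω) (G' ω) ∂P|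
      ≤ M ^ 2 * gaussianMomentBound * (√Var[G; P] ^ 3 * √Var[G'; P] ^ 3) := by
  rw [← Real.norm_eq_abs]
  calc _ ≤ ∫ ω, M ^ 2 * (|G ω| ^ 3 * |G' ω| ^ 3) ∂P :=
        norm_integral_le_of_norm_le ((integrable_abs_pow_mul_abs_pow hG hG' 3 3).const_mul _)
          (ae_of_all _ fun ω => abs_trapezoidError_mul_le hf h3 _ _ _ _)
    _ ≤ _ := by
        rw [integral_const_mul, mul_assoc]
        refine mul_le_mul_of_nonneg_left ?_ (sq_nonneg M)
        exact integral_abs_pow_mul_abs_pow_le hG hG' h0 h0' (by norm_num) (by norm_num)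

end

section
variable {Ω : Type*} [MeasurableSpace Ω] {P : Measure Ω} {f : ℝ → ℝ} {M : ℝ}

/-- If the second increment were $W$ alone, the product would be odd under $G\mapsto-G$, a symmetry
of the joint law, and its expectation would vanish. Passing from $W$ to $\kappa G+W$ changes the
second error by a quantity proportional to $\kappa G$, whence the factor $|\kappa|$. -/
lemma abs_integral_trapezoidError_mul_le_of_uncorrelated (hf : ContDiff ℝ 3 f)
    (h3 : ∀ x, |deriv (deriv (deriv f)) x| ≤ M) {G W N N' : Ω → ℝ} (κ : ℝ)
    (hY : HasGaussianLaw (fun ω i => (![G, W, N, N'] : Fin 4 → Ω → ℝ) i ω) P)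
    (hG0 : ∫ ω, G ω ∂P = 0) (hW0 : ∫ ω, W ω ∂P = 0) (hN0 : ∫ ω, N ω ∂P = 0)
    (hN0' : ∫ ω, N' ω ∂P = 0) (hW : cov[G, W; P] = 0) (hN : cov[G, N; P] = 0)
    (hN' : cov[G, N'; P] = 0) :
    |∫ ω, trapezoidError f (N ω) (G ω) * trapezoidError f (N' ω) (κ * G ω + W ω) ∂P|
      ≤ 2 * M ^ 2 * gaussianMomentBound *
        (|κ| * √Var[G; P] ^ 4 * Var[fun ω => κ * G ω + W ω; P]) := by
  have := hY.isProbabilityMeasure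
  have hG : HasGaussianLaw G P := hY.eval 0
  have hWg : HasGaussianLaw W P := hY.eval 1
  have hNg : HasGaussianLaw N P := hY.eval 2
  have hNg' : HasGaussianLaw N' P := hY.eval 3
  have hG' : HasGaussianLaw (fun ω => κ * G ω + W ω) P := by
    have := (hasGaussianLaw_matrix hY (fun (_ : Fin 1) => ![κ, 1, 0, 0])).eval 0
    simpa [Fin.sum_univ_four] using this
  have hG0' : ∫ ω, κ * G ω + W ω ∂P = 0 := by
    rw [integral_add (hG.integrable.const_mul _) hWg.integrable, integral_const_mul, hG0, hW0]
    simp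
  set G' : Ω → ℝ := fun ω => κ * G ω + W ω with hG'def
  -- $W$ is the residual of $G'$ after projection on $G$, so its variance is no larger.
  have hvar : Var[W; P] ≤ Var[G'; P] := by
    have : Var[G'; P] = κ ^ 2 * Var[G; P] + Var[W; P] := by
      rw [hG'def, variance_fun_add (hG.memLp_two.const_mul κ) hWg.memLp_two,
        covariance_const_mul_left, hW, variance_const_mul]
      ring
    rw [this]
    have := variance_nonneg G P
    nlinarith [mul_nonneg (sq_nonneg κ) this]
  have hzero : ∫ ω, trapezoidError f (N ω) (G ω) * trapezoidError f (N' ω) (W ω) ∂P = 0 := by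
    have hid := identDistrib_mul_of_hasGaussianLaw hY (by
      intro i; fin_cases i <;> simpa) ![-1, 1, 1, 1] (by
      intro i j
      fin_cases i <;> fin_cases j <;> simp [hW, hN, hN', covariance_comm _ G])
    have hc := continuous_trapezoidError (f := f) (hf.of_le (by norm_num))
    have hΦ : Measurable fun y : Fin 4 → ℝ =>
        trapezoidError f (y 2) (y 0) * trapezoidError f (y 3) (y 1) :=
      (Continuous.mul (hc.comp (by fun_prop : Continuous fun y : Fin 4 → ℝ => (y 2, y 0)))
        (hc.comp (by fun_prop : Continuous fun y : Fin 4 → ℝ => (y 3, y 1)))).measurable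
    have := integral_eq_zero_of_identDistrib_of_odd hid hΦ (fun ω => by
      simp [trapezoidError_neg])
    simpa using this
  have M0 : 0 ≤ M := (abs_nonneg _).trans (h3 0)
  have i1 := integrable_trapezoidError_mul hf h3 hG hG' hNg.aemeasurable hNg'.aemeasurable
  have i2 := integrable_trapezoidError_mul hf h3 hG hWg hNg.aemeasurable hNg'.aemeasurable
  have hsub : ∫ ω, trapezoidError f (N ω) (G ω) * trapezoidError f (N' ω) (G' ω) ∂P
      = ∫ ω, trapezoidError f (N ω) (G ω) * (trapezoidError f (N' ω) (G' ω)
        - trapezoidError f (N' ω) (W ω)) ∂P := by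
    simp_rw [mul_sub]
    rw [integral_sub i1 i2, hzero, sub_zero]
  change |∫ ω, trapezoidError f (N ω) (G ω) * trapezoidError f (N' ω) (G' ω) ∂P| ≤ _
  rw [hsub, ← Real.norm_eq_abs]
  have b1 := integral_abs_pow_mul_abs_pow_le hG hG' hG0 hG0' (i := 4) (j := 2)
    (by norm_num) (by norm_num)
  have b2 := integral_abs_pow_mul_abs_pow_le hG hWg hG0 hW0 (i := 4) (j := 2)
    (by norm_num) (by norm_num)
  have j1 := integrable_abs_pow_mul_abs_pow hG hG' 4 2
  have j2 := integrable_abs_pow_mul_abs_pow hG hWg 4 2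
  rw [Real.sq_sqrt (variance_nonneg _ _)] at b1 b2
  calc _ ≤ ∫ ω, M ^ 2 * |κ| * (|G ω| ^ 4 * |G' ω| ^ 2 + |G ω| ^ 4 * |W ω| ^ 2) ∂P := by
        refine norm_integral_le_of_norm_le ((j1.add j2).const_mul _) (ae_of_all _ fun ω => ?_)
        rw [Real.norm_eq_abs, abs_mul]
        have c1 := abs_trapezoidError_le hf h3 (N ω) (G ω)
        have c2 := abs_trapezoidError_sub_le hf h3 (N' ω) (G' ω) (W ω)
        have c3 : G' ω - W ω = κ * G ω := by simp [hG'def]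
        rw [c3, abs_mul] at c2
        calc _ ≤ M * |G ω| ^ 3 * (M * (|κ| * |G ω| * (G' ω ^ 2 + W ω ^ 2))) := by gcongr
          _ = _ := by rw [← sq_abs (G' ω), ← sq_abs (W ω)]; ring
    _ ≤ M ^ 2 * |κ| * (gaussianMomentBound * (√Var[G; P] ^ 4 * Var[G'; P])
          + gaussianMomentBound * (√Var[G; P] ^ 4 * Var[W; P])) := by
        rw [integral_const_mul, integral_add j1 j2]
        gcongr
    _ ≤ M ^ 2 * |κ| * (gaussianMomentBound * (√Var[G; P] ^ 4 * Var[G'; P])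
          + gaussianMomentBound * (√Var[G; P] ^ 4 * Var[G'; P])) := by
        have := gaussianMomentBound_nonneg
        gcongr
    _ = _ := by ring

/-- Simultaneously reversing $G$ and $G'$ preserves the law, since the residuals are uncorrelated
with both, and it changes the sign of all three factors. No independence between $G$ and $G'$ is
needed. -/
lemma integral_linear_mul_trapezoidError_eq_zero {G G' N N' : Ω → ℝ}
    (a b : ℝ) (hY : HasGaussianLaw (fun ω i => (![G, G', N, N'] : Fin 4 → Ω → ℝ) i ω) P)
    (hG0 : ∫ ω, G ω ∂P = 0) (hG0' : ∫ ω, G' ω ∂P = 0) (hN0 : ∫ ω, N ω ∂P = 0)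
    (hN0' : ∫ ω, N' ω ∂P = 0) (h1 : cov[G, N; P] = 0) (h2 : cov[G, N'; P] = 0)
    (h3 : cov[G', N; P] = 0) (h4 : cov[G', N'; P] = 0) {f₁ f₂ : ℝ → ℝ}
    (hf₁ : ContDiff ℝ 1 f₁) (hf₂ : ContDiff ℝ 1 f₂) :
    ∫ ω, (a * G ω + b * G' ω) * trapezoidError f₁ (N ω) (G ω)
      * trapezoidError f₂ (N' ω) (G' ω) ∂P = 0 := by
  have h1' : cov[N, G; P] = 0 := by rw [covariance_comm, h1]
  have h2' : cov[N', G; P] = 0 := by rw [covariance_comm, h2]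
  have h3' : cov[N, G'; P] = 0 := by rw [covariance_comm, h3]
  have h4' : cov[N', G'; P] = 0 := by rw [covariance_comm, h4]
  have hid := identDistrib_mul_of_hasGaussianLaw hY (by
    intro i; fin_cases i <;> simpa) ![-1, -1, 1, 1] (by
    intro i j
    fin_cases i <;> fin_cases j <;> simp [h1, h2, h3, h4, h1', h2', h3', h4'])
  have c1 := continuous_trapezoidError hf₁
  have c2 := continuous_trapezoidError hf₂
  have hΦ : Measurable fun y : Fin 4 → ℝ => (a * y 0 + b * y 1) *
      trapezoidError f₁ (y 2) (y 0) * trapezoidError f₂ (y 3) (y 1) :=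
    (Continuous.mul (Continuous.mul (by fun_prop)
      (c1.comp (by fun_prop : Continuous fun y : Fin 4 → ℝ => (y 2, y 0))))
      (c2.comp (by fun_prop : Continuous fun y : Fin 4 → ℝ => (y 3, y 1)))).measurable
  have := integral_eq_zero_of_identDistrib_of_odd hid hΦ (fun ω => by
    simp [trapezoidError_neg]; ring)
  simpa using this

lemma integrable_linear_mul_trapezoidError {G G' N N' : Ω → ℝ} (a b : ℝ)
    (hG : HasGaussianLaw G P) (hG' : HasGaussianLaw G' P) (hN : AEMeasurable N P)
    (hN' : AEMeasurable N' P) {f₁ f₂ : ℝ → ℝ} (hf₁ : ContDiff ℝ 3 f₁) (hf₂ : ContDiff ℝ 3 f₂)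
    (h₁ : ∀ x, |deriv (deriv (deriv f₁)) x| ≤ M) (h₂ : ∀ x, |deriv (deriv (deriv f₂)) x| ≤ M) :
    Integrable (fun ω => (a * G ω + b * G' ω) * trapezoidError f₁ (N ω) (G ω)
      * trapezoidError f₂ (N' ω) (G' ω)) P := by
  have M0 : 0 ≤ M := (abs_nonneg _).trans (h₁ 0)
  have j1 := (integrable_abs_pow_mul_abs_pow hG hG' 4 3).const_mul (M ^ 2 * |a|)
  have j2 := (integrable_abs_pow_mul_abs_pow hG hG' 3 4).const_mul (M ^ 2 * |b|)
  have m := hG.aemeasurable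
  have m' := hG'.aemeasurable
  refine (j1.add j2).mono' (AEStronglyMeasurable.mul (AEStronglyMeasurable.mul (by fun_prop)
    (aestronglyMeasurable_trapezoidError (hf₁.of_le (by norm_num)) hN m))
    (aestronglyMeasurable_trapezoidError (hf₂.of_le (by norm_num)) hN' m')) (ae_of_all _ fun ω => ?_)
  rw [Real.norm_eq_abs, abs_mul, abs_mul]
  calc _ ≤ (|a| * |G ω| + |b| * |G' ω|) * (M * |G ω| ^ 3) * (M * |G' ω| ^ 3) := by
        gcongr
        · exact (abs_add_le _ _).trans (by rw [abs_mul, abs_mul])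
        · exact abs_trapezoidError_le hf₁ h₁ _ _
        · exact abs_trapezoidError_le hf₂ h₂ _ _
    _ = _ := by simp only [Pi.add_apply]; ring

/-- A regression coefficient may blow up when the variances are small. The moment multiplying it in
the Taylor remainder carries enough powers of $v$ and $w$ to absorb both denominators, leaving a
bound free of lower bounds on the variances. -/
lemma mul_moment_le_of_sq_mul_le {v w D c x y z : ℝ} (hv : 0 < v) (hw : 0 < w) (hD : v ≤ D)
    (hD' : w ≤ D) (c0 : 0 ≤ c) (h : x ^ 2 * v ≤ 4 * (y ^ 2 / v + z ^ 2 / w)) :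
    x ^ 2 * (c * (√v ^ 5 * √w ^ 3)) ≤ c * (4 * (D ^ 2 * (y ^ 2 + z ^ 2))) := by
  have sv := Real.sq_sqrt hv.le
  have sw := Real.sq_sqrt hw.le
  have D0 : 0 ≤ D := hv.le.trans hD
  have hs : √v * √w ≤ D := by
    rw [← Real.sqrt_mul hv.le]
    exact Real.sqrt_le_iff.2 ⟨D0, by nlinarith⟩
  have e : √v ^ 3 * √w ^ 3 = √v * √w * (v * w) := by
    calc _ = √v * √w * (√v ^ 2 * √w ^ 2) := by ring
      _ = _ := by rw [sv, sw]
  calc _ = c * (x ^ 2 * √v ^ 2 * (√v ^ 3 * √w ^ 3)) := by ring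
    _ = c * (x ^ 2 * v * (√v ^ 3 * √w ^ 3)) := by rw [sv]
    _ ≤ c * (4 * (y ^ 2 / v + z ^ 2 / w) * (√v ^ 3 * √w ^ 3)) := by gcongr
    _ = c * (4 * (√v * √w) * (y ^ 2 * w + z ^ 2 * v)) := by rw [e]; field_simp
    _ ≤ c * (4 * D * (y ^ 2 * D + z ^ 2 * D)) := by gcongr
    _ = _ := by ring

lemma integral_sub_sub_sub_of_eq_zero {A B C E : Ω → ℝ} (hA : Integrable A P)
    (hB : Integrable B P) (hC : Integrable C P) (hE : Integrable E P) (hC0 : ∫ ω, C ω ∂P = 0)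
    (hE0 : ∫ ω, E ω ∂P = 0) :
    ∫ ω, (A ω - B ω - C ω - E ω) ∂P = ∫ ω, A ω ∂P - ∫ ω, B ω ∂P := by
  rw [integral_sub (f := fun ω => A ω - B ω - C ω) ((hA.sub hB).sub hC) hE,
    integral_sub (f := fun ω => A ω - B ω) (hA.sub hB) hC, integral_sub hA hB, hC0, hE0]
  ring

/-- The cost of replacing the midpoints by their residuals. The hypotheses `z1` and `z2` remove the
linear terms, so only squares of the regression coefficients appear. -/
lemma abs_integral_trapezoidError_mul_sub_le (hf : ContDiff ℝ 5 f)
    (h3 : ∀ x, |deriv (deriv (deriv f)) x| ≤ M)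
    (h4 : ∀ x, |deriv (deriv (deriv (deriv f))) x| ≤ M)
    (h5 : ∀ x, |deriv (deriv (deriv (deriv (deriv f)))) x| ≤ M) {G G' Z Z' N N' : Ω → ℝ}
    (hG : HasGaussianLaw G P) (hG' : HasGaussianLaw G' P)
    (hG0 : ∫ ω, G ω ∂P = 0) (hG0' : ∫ ω, G' ω ∂P = 0)
    (mN : AEMeasurable N P) (mN' : AEMeasurable N' P) {a b a' b' : ℝ}
    (hN : ∀ ω, Z ω = N ω + (a * G ω + b * G' ω)) (hN' : ∀ ω, Z' ω = N' ω + (a' * G ω + b' * G' ω))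
    (hZ : AEMeasurable Z P) (hZ' : AEMeasurable Z' P)
    (z1 : ∫ ω, (a * G ω + b * G' ω) * trapezoidError (deriv f) (N ω) (G ω)
      * trapezoidError f (N' ω) (G' ω) ∂P = 0)
    (z2 : ∫ ω, (a' * G ω + b' * G' ω) * trapezoidError f (N ω) (G ω)
      * trapezoidError (deriv f) (N' ω) (G' ω) ∂P = 0) :
    |∫ ω, trapezoidError f (Z ω) (G ω) * trapezoidError f (Z' ω) (G' ω) ∂P
      - ∫ ω, trapezoidError f (N ω) (G ω) * trapezoidError f (N' ω) (G' ω) ∂P|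
      ≤ 4 * M ^ 2 * ((a ^ 2 + a' ^ 2) *
          (gaussianMomentBound * (√Var[G; P] ^ 5 * √Var[G'; P] ^ 3))
        + (b ^ 2 + b' ^ 2) * (gaussianMomentBound * (√Var[G; P] ^ 3 * √Var[G'; P] ^ 5))) := by
  have hf3 : ContDiff ℝ 3 f := hf.of_le (by norm_num)
  have hf13 : ContDiff ℝ 3 (deriv f) := ContDiff.deriv' (n := 3) (hf.of_le (by norm_num))
  have I := integrable_trapezoidError_mul hf3 h3 hG hG' hZ hZ'
  have I0 := integrable_trapezoidError_mul hf3 h3 hG hG' mN mN'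
  have I1 := integrable_linear_mul_trapezoidError a b hG hG' mN mN' hf13 hf3 h4 h3
  have I2 := integrable_linear_mul_trapezoidError a' b' hG hG' mN mN' hf3 hf13 h3 h4
  have j1 := integrable_abs_pow_mul_abs_pow hG hG' 5 3
  have j2 := integrable_abs_pow_mul_abs_pow hG hG' 3 5
  have b1 := integral_abs_pow_mul_abs_pow_le hG hG' hG0 hG0' (i := 5) (j := 3)
    (by norm_num) (by norm_num)
  have b2 := integral_abs_pow_mul_abs_pow_le hG hG' hG0 hG0' (i := 3) (j := 5)
    (by norm_num) (by norm_num)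
  have hres : |∫ ω, (trapezoidError f (Z ω) (G ω) * trapezoidError f (Z' ω) (G' ω)
      - trapezoidError f (N ω) (G ω) * trapezoidError f (N' ω) (G' ω)
      - (a * G ω + b * G' ω) * trapezoidError (deriv f) (N ω) (G ω)
        * trapezoidError f (N' ω) (G' ω)
      - (a' * G ω + b' * G' ω) * trapezoidError f (N ω) (G ω)
        * trapezoidError (deriv f) (N' ω) (G' ω)) ∂P|
      ≤ 4 * M ^ 2 * ((a ^ 2 + a' ^ 2) * (gaussianMomentBound * (√Var[G; P] ^ 5 * √Var[G'; P] ^ 3))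
        + (b ^ 2 + b' ^ 2) * (gaussianMomentBound * (√Var[G; P] ^ 3 * √Var[G'; P] ^ 5))) := by
    rw [← Real.norm_eq_abs]
    calc _ ≤ ∫ ω, 4 * M ^ 2 * ((a ^ 2 + a' ^ 2) * (|G ω| ^ 5 * |G' ω| ^ 3)
          + (b ^ 2 + b' ^ 2) * (|G ω| ^ 3 * |G' ω| ^ 5)) ∂P := by
          refine norm_integral_le_of_norm_le (((j1.const_mul _).add (j2.const_mul _)).const_mul _)
            (ae_of_all _ fun ω => ?_)
          have k := abs_trapezoidError_mul_taylor_le hf h3 h4 h5 (N ω) (a * G ω + b * G' ω) (G ω)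
            (N' ω) (a' * G ω + b' * G' ω) (G' ω)
          rw [← hN, ← hN'] at k
          refine k.trans ?_
          have k3 : (a * G ω + b * G' ω) ^ 2 + (a' * G ω + b' * G' ω) ^ 2
              ≤ 2 * ((a ^ 2 + a' ^ 2) * |G ω| ^ 2 + (b ^ 2 + b' ^ 2) * |G' ω| ^ 2) := by
            rw [sq_abs, sq_abs]
            nlinarith [sq_nonneg (a * G ω - b * G' ω), sq_nonneg (a' * G ω - b' * G' ω)]
          calc _ ≤ 2 * M ^ 2 * (|G ω| ^ 3 * |G' ω| ^ 3 * (2 * ((a ^ 2 + a' ^ 2) * |G ω| ^ 2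
                + (b ^ 2 + b' ^ 2) * |G' ω| ^ 2))) := by gcongr
            _ = _ := by ring
      _ ≤ _ := by
          rw [integral_const_mul, integral_add (j1.const_mul _) (j2.const_mul _),
            integral_const_mul, integral_const_mul]
          gcongr
  rwa [integral_sub_sub_sub_of_eq_zero I I0 I1 I2 z1 z2] at hres

set_option maxHeartbeats 1000000 in
/-- Main covariance estimate: the trapezoidal errors along two increments `G`, `G'` of a centered
Gaussian family, with midpoints `Z`, `Z'`, are weakly correlated as soon as the increments are weakly
correlated with each other and with the midpoints. -/
lemma abs_integral_trapezoidError_mul_le (hf : ContDiff ℝ 5 f)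
    (h3 : ∀ x, |deriv (deriv (deriv f)) x| ≤ M)
    (h4 : ∀ x, |deriv (deriv (deriv (deriv f))) x| ≤ M)
    (h5 : ∀ x, |deriv (deriv (deriv (deriv (deriv f)))) x| ≤ M) {G G' Z Z' : Ω → ℝ}
    (hV : HasGaussianLaw (fun ω i => (![G, G', Z, Z'] : Fin 4 → Ω → ℝ) i ω) P)
    (hG0 : ∫ ω, G ω ∂P = 0) (hG0' : ∫ ω, G' ω ∂P = 0) (hZ0 : ∫ ω, Z ω ∂P = 0)
    (hZ0' : ∫ ω, Z' ω ∂P = 0) {D : ℝ} (hD : Var[G; P] ≤ D) (hD' : Var[G'; P] ≤ D) :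
    |∫ ω, trapezoidError f (Z ω) (G ω) * trapezoidError f (Z' ω) (G' ω) ∂P|
      ≤ 32 * M ^ 2 * gaussianMomentBound * (D ^ 2 * (|cov[G, G'; P]|
        + (cov[Z, G; P] ^ 2 + cov[Z, G'; P] ^ 2 + cov[Z', G; P] ^ 2 + cov[Z', G'; P] ^ 2))) := by
  have := hV.isProbabilityMeasure
  have hG : HasGaussianLaw G P := hV.eval 0
  have hG' : HasGaussianLaw G' P := hV.eval 1
  have hZ : HasGaussianLaw Z P := hV.eval 2
  have hZ' : HasGaussianLaw Z' P := hV.eval 3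
  have c0 := gaussianMomentBound_nonneg
  have M0 : 0 ≤ M := (abs_nonneg _).trans (h3 0)
  have hf3 : ContDiff ℝ 3 f := hf.of_le (by norm_num)
  have hf13 : ContDiff ℝ 3 (deriv f) := ContDiff.deriv' (n := 3) (hf.of_le (by norm_num))
  set c := gaussianMomentBound
  set v := Var[G; P] with hv
  set w := Var[G'; P] with hw
  set t := cov[G, G'; P] with ht
  set r := cov[Z, G; P] with hr
  set q := cov[Z, G'; P] with hq
  set r' := cov[Z', G; P] with hr'
  set q' := cov[Z', G'; P] with hq'
  have v0 : 0 ≤ v := variance_nonneg _ _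
  have w0 : 0 ≤ w := variance_nonneg _ _
  have D0 : 0 ≤ D := v0.trans hD
  have s0 := Real.sqrt_nonneg v
  have s0' := Real.sqrt_nonneg w
  have sv := Real.sq_sqrt v0
  have sw := Real.sq_sqrt w0
  set s := √v
  set s' := √w
  have vwD : v * w ≤ D ^ 2 := by nlinarith
  -- If $vw\le4t^2$, then $\sqrt{vw}\le2|t|$ and the crude bound $(vw)^{3/2}$ already contains a
  -- factor $|t|$. Otherwise $v$ and $w$ are positive and the regression is well conditioned.
  rcases le_or_gt (v * w) (4 * t ^ 2) with hcase | hcase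
  · have hss : s * s' ≤ 2 * |t| := by
      refine abs_le_of_sq_le_sq' ?_ (by positivity) |>.2
      rw [mul_pow, mul_pow, sv, sw, sq_abs]
      linarith
    calc _ ≤ M ^ 2 * c * (s ^ 3 * s' ^ 3) :=
          abs_integral_trapezoidError_mul_le_crude hf3 h3 hG hG' hG0 hG0'
      _ = M ^ 2 * c * (v * w * (s * s')) := by rw [← sv, ← sw]; ring
      _ ≤ M ^ 2 * c * (D ^ 2 * (2 * |t|)) := by gcongr
      _ ≤ 32 * M ^ 2 * c * (D ^ 2 * (|t| + 0)) := by
          have : 0 ≤ M ^ 2 * c * (D ^ 2 * |t|) := by positivity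
          linarith
      _ ≤ _ := by gcongr; positivity
  have hvp : 0 < v := by
    rcases v0.lt_or_eq with h | h
    · exact h
    · rw [← h] at hcase; nlinarith
  have hwp : 0 < w := by
    rcases w0.lt_or_eq with h | h
    · exact h
    · rw [← h] at hcase; nlinarith
  obtain ⟨a, b, e1, e2, ha, hb⟩ := exists_regression_coeff hvp hwp hcase r q
  obtain ⟨a', b', e1', e2', ha', hb'⟩ := exists_regression_coeff hvp hwp hcase r' q'
  set N : Ω → ℝ := fun ω => Z ω - a * G ω - b * G' ω with hN
  set N' : Ω → ℝ := fun ω => Z' ω - a' * G ω - b' * G' ω with hN'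
  -- $\kappa G$ is the projection of $G'$ on $G$, so $W$ is uncorrelated with $G$. In the final
  -- bound $|\kappa|v^2w=vw|t|\le D^2|t|$.
  set κ : ℝ := t / v with hκ
  set W : Ω → ℝ := fun ω => G' ω - κ * G ω with hW
  have hGW : ∀ ω, κ * G ω + W ω = G' ω := fun ω => by simp [hW]
  have lG := hG.memLp_two
  have lG' := hG'.memLp_two
  have lZ := hZ.memLp_two
  have lZ' := hZ'.memLp_two
  have hvG : cov[G, G; P] = v := covariance_self hG.aemeasurable
  have hwG : cov[G', G'; P] = w := covariance_self hG'.aemeasurable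
  have ht' : cov[G', G; P] = t := by rw [covariance_comm]
  have covN : ∀ {U H : Ω → ℝ} (a b : ℝ), MemLp U 2 P → MemLp H 2 P →
      cov[H, fun ω => U ω - a * G ω - b * G' ω; P]
        = cov[U, H; P] - a * cov[H, G; P] - b * cov[H, G'; P] := by
    intro U H a b hU hH
    rw [covariance_fun_sub_right hH (show MemLp (fun ω => U ω - a * G ω) 2 P from hU.sub (lG.const_mul a)) (lG'.const_mul b),
      covariance_fun_sub_right hH hU (lG.const_mul a), covariance_const_mul_right,
      covariance_const_mul_right, covariance_comm H U]
  have cGN : cov[G, N; P] = 0 := by rw [hN, covN a b lZ lG, hvG]; exact e1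
  have cGN' : cov[G, N'; P] = 0 := by rw [hN', covN a' b' lZ' lG, hvG]; exact e1'
  have cG'N : cov[G', N; P] = 0 := by rw [hN, covN a b lZ lG', ht', hwG]; exact e2
  have cG'N' : cov[G', N'; P] = 0 := by rw [hN', covN a' b' lZ' lG', ht', hwG]; exact e2'
  have cGW : cov[G, W; P] = 0 := by
    rw [hW, covariance_fun_sub_right lG lG' (lG.const_mul κ), covariance_const_mul_right, hvG, ← ht,
      hκ]
    field_simp
    ring
  have hN0 : ∫ ω, N ω ∂P = 0 := by
    rw [hN, integral_sub (show Integrable (fun ω => Z ω - a * G ω) P from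
      hZ.integrable.sub (hG.integrable.const_mul a)) (hG'.integrable.const_mul b), integral_sub hZ.integrable
      (hG.integrable.const_mul a), integral_const_mul, integral_const_mul, hG0, hG0', hZ0]
    simp
  have hN0' : ∫ ω, N' ω ∂P = 0 := by
    rw [hN', integral_sub (show Integrable (fun ω => Z' ω - a' * G ω) P from
      hZ'.integrable.sub (hG.integrable.const_mul a')) (hG'.integrable.const_mul b'), integral_sub hZ'.integrable
      (hG.integrable.const_mul a'), integral_const_mul, integral_const_mul, hG0, hG0', hZ0']
    simp
  have hW0 : ∫ ω, W ω ∂P = 0 := by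
    rw [hW, integral_sub hG'.integrable (hG.integrable.const_mul κ), integral_const_mul, hG0, hG0']
    simp
  have hY1 : HasGaussianLaw (fun ω i => (![G, G', N, N'] : Fin 4 → Ω → ℝ) i ω) P := by
    convert hasGaussianLaw_matrix hV
      ![![1, 0, 0, 0], ![0, 1, 0, 0], ![-a, -b, 1, 0], ![-a', -b', 0, 1]] using 1
    ext ω i
    fin_cases i <;> simp [Fin.sum_univ_four, hN, hN'] <;> ring
  have hY2 : HasGaussianLaw (fun ω i => (![G, W, N, N'] : Fin 4 → Ω → ℝ) i ω) P := by
    convert hasGaussianLaw_matrix hV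
      ![![1, 0, 0, 0], ![-κ, 1, 0, 0], ![-a, -b, 1, 0], ![-a', -b', 0, 1]] using 1
    ext ω i
    fin_cases i <;> simp [Fin.sum_univ_four, hN, hN', hW] <;> ring
  have mN : AEMeasurable N P := (hY1.eval 2).aemeasurable
  have mN' : AEMeasurable N' P := (hY1.eval 3).aemeasurable
  have z0 := abs_integral_trapezoidError_mul_le_of_uncorrelated hf3 h3 κ hY2 hG0 hW0 hN0 hN0' cGW
    cGN cGN'
  simp only [hGW] at z0
  have z1 := integral_linear_mul_trapezoidError_eq_zero a b hY1 hG0 hG0' hN0 hN0' cGN cGN' cG'N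
    cG'N' (f₁ := deriv f) (f₂ := f) (hf13.of_le (by norm_num)) (hf3.of_le (by norm_num))
  have z2 := integral_linear_mul_trapezoidError_eq_zero a' b' hY1 hG0 hG0' hN0 hN0' cGN cGN' cG'N
    cG'N' (f₁ := f) (f₂ := deriv f) (hf3.of_le (by norm_num)) (hf13.of_le (by norm_num))
  have hres := abs_integral_trapezoidError_mul_sub_le hf h3 h4 h5 hG hG' hG0 hG0' mN mN'
    (a := a) (b := b) (a' := a') (b' := b') (fun ω => by simp only [hN]; ring)
    (fun ω => by simp only [hN']; ring) hZ.aemeasurable hZ'.aemeasurable z1 z2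
  have t1 : ∀ {x y z : ℝ}, x ^ 2 * v ≤ 4 * (y ^ 2 / v + z ^ 2 / w) →
      x ^ 2 * (c * (s ^ 5 * s' ^ 3)) ≤ c * (4 * (D ^ 2 * (y ^ 2 + z ^ 2))) :=
    fun h => mul_moment_le_of_sq_mul_le hvp hwp hD hD' c0 h
  have t2 : ∀ {x y z : ℝ}, x ^ 2 * w ≤ 4 * (y ^ 2 / v + z ^ 2 / w) →
      x ^ 2 * (c * (s ^ 3 * s' ^ 5)) ≤ c * (4 * (D ^ 2 * (y ^ 2 + z ^ 2))) := fun {x y z} h => by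
    rw [add_comm] at h
    rw [mul_comm (s ^ 3), add_comm (y ^ 2)]
    exact mul_moment_le_of_sq_mul_le hwp hvp hD' hD c0 h
  have hres' : 4 * M ^ 2 * ((a ^ 2 + a' ^ 2) * (c * (s ^ 5 * s' ^ 3))
        + (b ^ 2 + b' ^ 2) * (c * (s ^ 3 * s' ^ 5)))
      ≤ 32 * M ^ 2 * c * (D ^ 2 * (r ^ 2 + q ^ 2 + r' ^ 2 + q' ^ 2)) := by
    calc _ = 4 * M ^ 2 * (a ^ 2 * (c * (s ^ 5 * s' ^ 3)) + a' ^ 2 * (c * (s ^ 5 * s' ^ 3))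
          + (b ^ 2 * (c * (s ^ 3 * s' ^ 5)) + b' ^ 2 * (c * (s ^ 3 * s' ^ 5)))) := by ring
      _ ≤ 4 * M ^ 2 * (c * (4 * (D ^ 2 * (r ^ 2 + q ^ 2))) + c * (4 * (D ^ 2 * (r' ^ 2 + q' ^ 2)))
          + (c * (4 * (D ^ 2 * (r ^ 2 + q ^ 2))) + c * (4 * (D ^ 2 * (r' ^ 2 + q' ^ 2))))) := by
          exact mul_le_mul_of_nonneg_left (add_le_add (add_le_add (t1 ha) (t1 ha'))
            (add_le_add (t2 hb) (t2 hb'))) (by positivity)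
      _ = _ := by ring
  have hz : 2 * M ^ 2 * c * (|κ| * s ^ 4 * w) ≤ 32 * M ^ 2 * c * (D ^ 2 * |t|) := by
    have h1 : |κ| * s ^ 4 * w = v * w * |t| := by
      rw [hκ, abs_div, abs_of_pos hvp, show s ^ 4 = v * v by rw [← sv]; ring]
      field_simp
    rw [h1]
    calc _ ≤ 2 * M ^ 2 * c * (D ^ 2 * |t|) := by gcongr
      _ ≤ _ := by gcongr; norm_num
  have tri := abs_sub_abs_le_abs_sub
    (∫ ω, trapezoidError f (Z ω) (G ω) * trapezoidError f (Z' ω) (G' ω) ∂P)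
    (∫ ω, trapezoidError f (N ω) (G ω) * trapezoidError f (N' ω) (G' ω) ∂P)
  rw [mul_add, mul_add]
  linarith

end

/-! ### Covariances of increments and midpoints from monotonicity and concavity -/

section
open scoped InnerProductSpace

/-- The exponent $-2/3$ is weakened to $-5/6$ so that all covariance bounds have the same form. The
factor 2 allows measuring the distance from $u+\varepsilon$ instead of $u$. -/
lemma rpow_div_self_le {r r' : ℝ} (hr : 0 < r) (hr' : 0 < r') (h1 : r' ≤ 1) (h : r' / 2 ≤ r) :
    r ^ (1 / 3 : ℝ) / r ≤ 2 * r' ^ (-(5 / 6) : ℝ) := by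
  calc r ^ (1 / 3 : ℝ) / r = r ^ (-(2 / 3) : ℝ) := by
        rw [← Real.rpow_sub_one hr.ne']; norm_num
    _ ≤ (r' / 2) ^ (-(2 / 3) : ℝ) :=
        Real.rpow_le_rpow_of_nonpos (by positivity) h (by norm_num)
    _ = r' ^ (-(2 / 3) : ℝ) * 2 ^ (2 / 3 : ℝ) := by
        rw [Real.div_rpow hr'.le (by norm_num), Real.rpow_neg (by norm_num : (0:ℝ) ≤ 2), div_inv_eq_mul]
    _ ≤ r' ^ (-(5 / 6) : ℝ) * 2 ^ (1 : ℝ) := by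
        gcongr ?_ * ?_
        · exact Real.rpow_le_rpow_of_exponent_ge hr' h1 (by norm_num)
        · exact Real.rpow_le_rpow_of_exponent_le (by norm_num) (by norm_num)
    _ = _ := by rw [Real.rpow_one]; ring

/-- By concavity the slope over $[v,v+\varepsilon]$ is at most a slope to the left of $v$, and that
one is controlled by the Hölder bound $\delta^2\lesssim\rho^{1/3}$ at distance $\rho=v-w$. -/
lemma metric_right_increment_le {H : Type*} [NormedAddCommGroup H] {Y : ℝ → H} {L : ℝ}
    (hL : ∀ s ∈ Icc (0 : ℝ) 1, ∀ t ∈ Icc (0 : ℝ) 1, ‖Y t - Y s‖ ≤ L * |t - s| ^ (1 / 6 : ℝ))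
    {w : ℝ} (hw : w ∈ Icc (0 : ℝ) 1)
    (hm : MonotoneOn (fun v => ‖Y v - Y w‖ ^ 2) (Ioc w 1))
    (hc : ConcaveOn ℝ (Ioc w 1) fun v => ‖Y v - Y w‖ ^ 2)
    {v ε r : ℝ} (hε : 0 < ε) (hr : 0 < r) (hr1 : r ≤ 1) (hw' : w + r / 2 ≤ v) (hv : v + ε ≤ 1) :
    0 ≤ ‖Y (v + ε) - Y w‖ ^ 2 - ‖Y v - Y w‖ ^ 2 ∧
      ‖Y (v + ε) - Y w‖ ^ 2 - ‖Y v - Y w‖ ^ 2 ≤ 4 * L ^ 2 * (ε * r ^ (-(5 / 6) : ℝ)) := by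
  have nv : v ∈ Ioc w 1 := ⟨by linarith, by linarith⟩
  have nve : v + ε ∈ Ioc w 1 := ⟨by linarith, by linarith⟩
  have hw0 := hw.1
  refine ⟨sub_nonneg.2 (hm nv nve (by linarith)), ?_⟩
  -- Concavity is only known on `Ioc w 1`, so the comparison slope starts halfway between `w` and
  -- `v` rather than at `w`.
  set x := (w + v) / 2 with hx
  have nx : x ∈ Ioc w 1 := ⟨by linarith, by linarith⟩
  have h := hc.slope_anti_adjacent nx nve (by linarith : x < v) (by linarith)
  simp only [add_sub_cancel_left] at h
  set ρ := v - w with hρ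
  have hρ0 : 0 < ρ := by linarith
  have hxρ : v - x = ρ / 2 := by rw [hx, hρ]; ring
  rw [hxρ, div_le_div_iff₀ hε (by positivity)] at h
  have h1 : ‖Y v - Y w‖ ^ 2 ≤ L ^ 2 * ρ ^ (1 / 3 : ℝ) := by
    have a := hL w hw v ⟨by linarith, nv.2⟩
    rw [abs_of_pos hρ0] at a
    calc _ ≤ (L * ρ ^ (1 / 6 : ℝ)) ^ 2 := by gcongr
      _ = _ := by
        rw [mul_pow, ← Real.rpow_natCast (ρ ^ (1 / 6 : ℝ)), ← Real.rpow_mul hρ0.le]; norm_num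
  have h2 := rpow_div_self_le hρ0 hr hr1 (by linarith)
  rw [div_le_iff₀ hρ0] at h2
  have h3 : (‖Y (v + ε) - Y w‖ ^ 2 - ‖Y v - Y w‖ ^ 2) * ρ
      ≤ 4 * L ^ 2 * (ε * r ^ (-(5 / 6) : ℝ)) * ρ := by
    have h4 := mul_le_mul_of_nonneg_left h2 (sq_nonneg L)
    have h5 : 0 ≤ ‖Y x - Y w‖ ^ 2 := by positivity
    nlinarith
  exact le_of_mul_le_mul_right h3 hρ0

section
variable {H : Type*} [NormedAddCommGroup H] [InnerProductSpace ℝ H]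

lemma norm_sub_sq_sub_norm_sub_sq (x y z : H) :
    ‖z - x‖ ^ 2 - ‖z - y‖ ^ 2 = ⟪y - x, (z - x) + (z - y)⟫_ℝ := by
  have h : y - x = (z - x) - (z - y) := by abel
  rw [h, inner_sub_left, inner_add_right, inner_add_right, real_inner_self_eq_norm_sq,
    real_inner_self_eq_norm_sq, real_inner_comm (z - x) (z - y)]
  ring

lemma inner_sub_eq_norm_sq (x x' y : H) :
    ⟪y, x' - x⟫_ℝ = (‖x'‖ ^ 2 - ‖x‖ ^ 2 + (‖y - x‖ ^ 2 - ‖y - x'‖ ^ 2)) / 2 := by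
  rw [norm_sub_sq_real, norm_sub_sq_real, inner_sub_right]
  ring

lemma norm_sq_sub_norm_sq (x y : H) : ‖y‖ ^ 2 - ‖x‖ ^ 2 = ⟪y - x, y + x⟫_ℝ := by
  rw [inner_sub_left, inner_add_right, inner_add_right, real_inner_self_eq_norm_sq,
    real_inner_self_eq_norm_sq, real_inner_comm x y]
  ring

variable {Y : ℝ → H} {B L : ℝ}

/-- Concavity compares the slope on $[u,u+\varepsilon]$ with that on $[0,u]$. The latter is at most
$2BLu^{1/6}/u$, because a difference of squared norms is linear in the increment; this is the origin
of the exponent $-5/6$. -/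
lemma norm_sq_increment_le (hB : ∀ t ∈ Icc (0 : ℝ) 1, ‖Y t‖ ≤ B)
    (hL : ∀ s ∈ Icc (0 : ℝ) 1, ∀ t ∈ Icc (0 : ℝ) 1, ‖Y t - Y s‖ ≤ L * |t - s| ^ (1 / 6 : ℝ))
    (hQ : MonotoneOn (fun u => ‖Y u‖ ^ 2) (Icc 0 1))
    (hQ' : ConcaveOn ℝ (Icc 0 1) fun u => ‖Y u‖ ^ 2)
    {u ε : ℝ} (hε : 0 < ε) (hu : 0 < u) (hu1 : u + ε ≤ 1) :
    0 ≤ ‖Y (u + ε)‖ ^ 2 - ‖Y u‖ ^ 2 ∧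
      ‖Y (u + ε)‖ ^ 2 - ‖Y u‖ ^ 2 ≤ 2 * B * L * (ε * u ^ (-(5 / 6) : ℝ)) := by
  have m0 : (0 : ℝ) ∈ Icc (0 : ℝ) 1 := by simp
  have mu : u ∈ Icc (0 : ℝ) 1 := ⟨hu.le, by linarith⟩
  have mue : u + ε ∈ Icc (0 : ℝ) 1 := ⟨by linarith, hu1⟩
  refine ⟨sub_nonneg.2 (hQ mu mue (by linarith)), ?_⟩
  have h := hQ'.slope_anti_adjacent m0 mue hu (by linarith : u < u + ε)
  simp only [add_sub_cancel_left, sub_zero] at h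
  rw [div_le_div_iff₀ hε hu] at h
  have h1 : ‖Y u‖ ^ 2 - ‖Y 0‖ ^ 2 ≤ L * u ^ (1 / 6 : ℝ) * (2 * B) := by
    rw [norm_sq_sub_norm_sq]
    refine (real_inner_le_norm _ _).trans ?_
    have a := hL 0 m0 u mu
    rw [sub_zero, abs_of_pos hu] at a
    have b := norm_add_le (Y u) (Y 0)
    have c := hB u mu
    have d := hB 0 m0
    refine mul_le_mul a (by linarith) (norm_nonneg _) ((norm_nonneg _).trans a)
  have h2 : u ^ (1 / 6 : ℝ) = u ^ (-(5 / 6) : ℝ) * u := by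
    rw [← Real.rpow_add_one hu.ne']; norm_num
  rw [h2] at h1
  have h3 : (‖Y (u + ε)‖ ^ 2 - ‖Y u‖ ^ 2) * u ≤ 2 * B * L * (ε * u ^ (-(5 / 6) : ℝ)) * u := by
    nlinarith
  exact le_of_mul_le_mul_right h3 hu

/-- In the concave case the comparison slope lies on $[0,u]$ and produces $u^{-5/6}$. In the convex
case it lies between $u+\varepsilon$ and the midpoint towards $w$, and produces the power of the
distance to the diagonal. The stated sum covers both. -/
lemma metric_left_increment_le (hB : ∀ t ∈ Icc (0 : ℝ) 1, ‖Y t‖ ≤ B)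
    (hL : ∀ s ∈ Icc (0 : ℝ) 1, ∀ t ∈ Icc (0 : ℝ) 1, ‖Y t - Y s‖ ≤ L * |t - s| ^ (1 / 6 : ℝ))
    {w : ℝ} (hw : w ∈ Icc (0 : ℝ) 1)
    (hm : MonotoneOn (fun u => -‖Y w - Y u‖ ^ 2) (Ico 0 w))
    (hc : ConcaveOn ℝ (Ico 0 w) (fun u => -‖Y w - Y u‖ ^ 2) ∨
      ConvexOn ℝ (Ico 0 w) fun u => -‖Y w - Y u‖ ^ 2)
    {u ε r : ℝ} (hε : 0 < ε) (hu : 0 < u) (hr : 0 < r) (hr1 : r ≤ 1) (hw' : u + ε + r / 2 ≤ w) :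
    0 ≤ ‖Y w - Y u‖ ^ 2 - ‖Y w - Y (u + ε)‖ ^ 2 ∧
      ‖Y w - Y u‖ ^ 2 - ‖Y w - Y (u + ε)‖ ^ 2 ≤
        (4 * B * L + 4 * L ^ 2) * (ε * (u ^ (-(5 / 6) : ℝ) + r ^ (-(5 / 6) : ℝ))) := by
  have m0 : (0 : ℝ) ∈ Icc (0 : ℝ) 1 := by simp
  have hw1 := hw.2
  have mu : u ∈ Icc (0 : ℝ) 1 := ⟨hu.le, by linarith⟩
  have mue : u + ε ∈ Icc (0 : ℝ) 1 := ⟨by linarith, by linarith⟩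
  have n0 : (0 : ℝ) ∈ Ico 0 w := ⟨le_rfl, by linarith⟩
  have nu : u ∈ Ico 0 w := ⟨hu.le, by linarith⟩
  have nue : u + ε ∈ Ico 0 w := ⟨by linarith, by linarith⟩
  have B0 : 0 ≤ B := (norm_nonneg _).trans (hB 0 m0)
  have L0 : 0 ≤ L := by
    have := (norm_nonneg _).trans (hL 0 m0 1 (by simp))
    simpa using this
  have U0 : 0 ≤ u ^ (-(5 / 6) : ℝ) := by positivity
  have R0 : 0 ≤ r ^ (-(5 / 6) : ℝ) := by positivity
  have h0 := hm nu nue (by linarith)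
  refine ⟨by simp only at h0; linarith, ?_⟩
  rcases hc with hc | hc
  · have h := hc.slope_anti_adjacent n0 nue hu (by linarith : u < u + ε)
    simp only [add_sub_cancel_left, sub_zero] at h
    rw [div_le_div_iff₀ hε hu] at h
    have h1 : ‖Y w - Y 0‖ ^ 2 - ‖Y w - Y u‖ ^ 2 ≤ L * u ^ (1 / 6 : ℝ) * (4 * B) := by
      rw [norm_sub_sq_sub_norm_sub_sq]
      refine (real_inner_le_norm _ _).trans ?_
      have a := hL 0 m0 u mu
      rw [sub_zero, abs_of_pos hu] at a
      have b := norm_add_le (Y w - Y 0) (Y w - Y u)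
      have b1 := norm_sub_le (Y w) (Y 0)
      have b2 := norm_sub_le (Y w) (Y u)
      have c := hB u mu
      have d := hB 0 m0
      have e := hB w hw
      exact mul_le_mul a (by linarith) (norm_nonneg _) ((norm_nonneg _).trans a)
    have h2 : u ^ (1 / 6 : ℝ) = u ^ (-(5 / 6) : ℝ) * u := by
      rw [← Real.rpow_add_one hu.ne']; norm_num
    rw [h2] at h1
    have h3 : (‖Y w - Y u‖ ^ 2 - ‖Y w - Y (u + ε)‖ ^ 2) * u
        ≤ 4 * B * L * (ε * u ^ (-(5 / 6) : ℝ)) * u := by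
      nlinarith
    refine (le_of_mul_le_mul_right h3 hu).trans ?_
    gcongr
    · nlinarith
    · linarith
  · set x := (u + ε + w) / 2 with hx
    have nx : x ∈ Ico 0 w := ⟨by linarith, by linarith⟩
    have h := hc.slope_mono_adjacent nu nx (by linarith : u < u + ε) (by linarith)
    simp only [add_sub_cancel_left] at h
    set ρ := w - (u + ε) with hρ
    have hρ0 : 0 < ρ := by linarith
    have hxρ : x - (u + ε) = ρ / 2 := by rw [hx, hρ]; ring
    rw [hxρ, div_le_div_iff₀ hε (by positivity)] at h
    have h1 : ‖Y w - Y (u + ε)‖ ^ 2 ≤ L ^ 2 * ρ ^ (1 / 3 : ℝ) := by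
      have a := hL (u + ε) mue w hw
      rw [abs_of_pos hρ0] at a
      calc _ ≤ (L * ρ ^ (1 / 6 : ℝ)) ^ 2 := by gcongr
        _ = _ := by
          rw [mul_pow, ← Real.rpow_natCast (ρ ^ (1 / 6 : ℝ)), ← Real.rpow_mul hρ0.le]; norm_num
    have h2 := rpow_div_self_le hρ0 hr hr1 (by linarith)
    rw [div_le_iff₀ hρ0] at h2
    have h3 : (‖Y w - Y u‖ ^ 2 - ‖Y w - Y (u + ε)‖ ^ 2) * ρ
        ≤ 4 * L ^ 2 * (ε * r ^ (-(5 / 6) : ℝ)) * ρ := by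
      have h4 := mul_le_mul_of_nonneg_left h2 (sq_nonneg L)
      have h5 : 0 ≤ ‖Y w - Y x‖ ^ 2 := by positivity
      nlinarith
    refine (le_of_mul_le_mul_right h3 hρ0).trans ?_
    gcongr
    · nlinarith [mul_nonneg B0 L0]
    · linarith

/-- The covariances between increments and midpoints. -/
lemma abs_inner_midpoint_increment_le (hB : ∀ t ∈ Icc (0 : ℝ) 1, ‖Y t‖ ≤ B)
    (hL : ∀ s ∈ Icc (0 : ℝ) 1, ∀ t ∈ Icc (0 : ℝ) 1, ‖Y t - Y s‖ ≤ L * |t - s| ^ (1 / 6 : ℝ))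
    (hQ : MonotoneOn (fun u => ‖Y u‖ ^ 2) (Icc 0 1))
    (hQ' : ConcaveOn ℝ (Icc 0 1) fun u => ‖Y u‖ ^ 2)
    (hr : ∀ u ∈ Icc (0 : ℝ) 1, MonotoneOn (fun v => ‖Y v - Y u‖ ^ 2) (Ioc u 1))
    (hr' : ∀ u ∈ Icc (0 : ℝ) 1, ConcaveOn ℝ (Ioc u 1) fun v => ‖Y v - Y u‖ ^ 2)
    (hl : ∀ v ∈ Icc (0 : ℝ) 1, MonotoneOn (fun u => -‖Y v - Y u‖ ^ 2) (Ico 0 v))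
    (hl' : ∀ v ∈ Icc (0 : ℝ) 1, ConcaveOn ℝ (Ico 0 v) (fun u => -‖Y v - Y u‖ ^ 2) ∨
      ConvexOn ℝ (Ico 0 v) fun u => -‖Y v - Y u‖ ^ 2)
    {u v ε : ℝ} (hε : 0 < ε) (hu : 0 < u) (huv : u + 3 * ε ≤ v) (hv : v + ε ≤ 1) :
    let R := (3 * B * L + 4 * L ^ 2) * (ε * (u ^ (-(5 / 6) : ℝ) + (v - u) ^ (-(5 / 6) : ℝ)))
    |⟪(1 / 2 : ℝ) • (Y (u + ε) + Y u), Y (u + ε) - Y u⟫_ℝ| ≤ R ∧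
    |⟪(1 / 2 : ℝ) • (Y (u + ε) + Y u), Y (v + ε) - Y v⟫_ℝ| ≤ R ∧
    |⟪(1 / 2 : ℝ) • (Y (v + ε) + Y v), Y (u + ε) - Y u⟫_ℝ| ≤ R ∧
    |⟪(1 / 2 : ℝ) • (Y (v + ε) + Y v), Y (v + ε) - Y v⟫_ℝ| ≤ R := by
  intro R
  have m0 : (0 : ℝ) ∈ Icc (0 : ℝ) 1 := by simp
  have B0 : 0 ≤ B := (norm_nonneg _).trans (hB 0 m0)
  have L0 : 0 ≤ L := by
    have := (norm_nonneg _).trans (hL 0 m0 1 (by simp))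
    simpa using this
  have BL := mul_nonneg B0 L0
  have qu := norm_sq_increment_le hB hL hQ hQ' hε hu (by linarith)
  have qv := norm_sq_increment_le hB hL hQ hQ' hε (by linarith : 0 < v) hv
  have mono : v ^ (-(5 / 6) : ℝ) ≤ u ^ (-(5 / 6) : ℝ) :=
    Real.rpow_le_rpow_of_nonpos hu (by linarith) (by norm_num)
  have U0 : 0 ≤ u ^ (-(5 / 6) : ℝ) := by positivity
  have R0 : 0 ≤ (v - u) ^ (-(5 / 6) : ℝ) := Real.rpow_nonneg (by linarith) _
  have mu : u ∈ Icc (0 : ℝ) 1 := ⟨hu.le, by linarith⟩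
  have mue : u + ε ∈ Icc (0 : ℝ) 1 := ⟨by linarith, by linarith⟩
  have mv : v ∈ Icc (0 : ℝ) 1 := ⟨by linarith, by linarith⟩
  have mve : v + ε ∈ Icc (0 : ℝ) 1 := ⟨by linarith, by linarith⟩
  have p1 := metric_left_increment_le hB hL mv (hl v mv) (hl' v mv) hε hu
    (by linarith : 0 < v - u) (by linarith) (by linarith)
  have p2 := metric_left_increment_le hB hL mve (hl _ mve) (hl' _ mve) hε hu
    (by linarith : 0 < v - u) (by linarith) (by linarith)
  have q1 := metric_right_increment_le hL mu (hr u mu) (hr' u mu) hε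
    (by linarith : 0 < v - u) (by linarith) (by linarith) hv
  have q2 := metric_right_increment_le hL mue (hr _ mue) (hr' _ mue) hε
    (by linarith : 0 < v - u) (by linarith) (by linarith) hv
  rw [norm_sub_rev (Y (v + ε)) (Y u), norm_sub_rev (Y v) (Y u)] at q1
  rw [norm_sub_rev (Y (v + ε)) (Y (u + ε)), norm_sub_rev (Y v) (Y (u + ε))] at q2
  have self : ∀ x y : H, ⟪(1 / 2 : ℝ) • (x + y), x - y⟫_ℝ = (‖x‖ ^ 2 - ‖y‖ ^ 2) / 2 := by
    intro x y
    rw [norm_sq_sub_norm_sq, real_inner_smul_left, real_inner_comm]; ring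
  -- By polarization, the covariance of an increment with another midpoint is a combination of
  -- increments of the variance and of the squared metric, all of which have just been bounded.
  have cross : ∀ x x' y y' : H, ⟪(1 / 2 : ℝ) • (y' + y), x' - x⟫_ℝ =
      (‖x'‖ ^ 2 - ‖x‖ ^ 2) / 2 + (‖y - x‖ ^ 2 - ‖y - x'‖ ^ 2) / 4
        + (‖y' - x‖ ^ 2 - ‖y' - x'‖ ^ 2) / 4 := by
    intro x x' y y'
    rw [real_inner_smul_left, inner_add_left, inner_sub_eq_norm_sq, inner_sub_eq_norm_sq]; ring
  have e1 : 0 ≤ ε * u ^ (-(5 / 6) : ℝ) := by positivity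
  have e2 : 0 ≤ ε * (v - u) ^ (-(5 / 6) : ℝ) := by positivity
  have e3 : ε * v ^ (-(5 / 6) : ℝ) ≤ ε * u ^ (-(5 / 6) : ℝ) := by gcongr
  set a := ε * u ^ (-(5 / 6) : ℝ)
  set b := ε * (v - u) ^ (-(5 / 6) : ℝ)
  have hR : R = (3 * B * L + 4 * L ^ 2) * (a + b) := by simp only [R, a, b]; ring
  rw [mul_add ε] at p1 p2
  have f1 : 0 ≤ B * L * a := by positivity
  have f2 : 0 ≤ B * L * b := by positivity
  have f3 : 0 ≤ L ^ 2 * a := by positivity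
  have f4 : 0 ≤ L ^ 2 * b := by positivity
  have f5 := mul_le_mul_of_nonneg_left e3 BL
  rw [self, self, cross, cross, hR]
  refine ⟨?_, ?_, ?_, ?_⟩ <;> rw [abs_le] <;> constructor <;> linarith

end

end

/-! ### Rectangular increments and the mixed derivative measure -/

lemma deriv_smoothTransition_eq_zero {x : ℝ} (hx : x ∉ Icc (0 : ℝ) 1) :
    deriv Real.smoothTransition x = 0 := by
  rcases not_and_or.1 hx with h | h
  · have : Real.smoothTransition =ᶠ[𝓝 x] fun _ => 0 := by
      filter_upwards [Iio_mem_nhds (not_le.1 h)] with y hy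
      exact Real.smoothTransition.zero_of_nonpos (le_of_lt hy)
    rw [this.deriv_eq]; simp
  · have : Real.smoothTransition =ᶠ[𝓝 x] fun _ => 1 := by
      filter_upwards [Ioi_mem_nhds (not_le.1 h)] with y hy
      exact Real.smoothTransition.one_of_one_le (le_of_lt hy)
    rw [this.deriv_eq]; simp

lemma continuous_deriv_smoothTransition : Continuous (deriv Real.smoothTransition) :=
  (Real.smoothTransition.contDiff (n := 1)).continuous_deriv le_rfl

lemma hasDerivAt_smoothTransition (x : ℝ) :
    HasDerivAt Real.smoothTransition (deriv Real.smoothTransition x) x :=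
  ((Real.smoothTransition.contDiff (n := 1)).differentiable (by norm_num) x).hasDerivAt

lemma hasCompactSupport_deriv_smoothTransition : HasCompactSupport (deriv Real.smoothTransition) :=
  HasCompactSupport.intro isCompact_Icc fun _ hx => deriv_smoothTransition_eq_zero hx

lemma integrable_deriv_smoothTransition : Integrable (deriv Real.smoothTransition) :=
  continuous_deriv_smoothTransition.integrable_of_hasCompactSupport
    hasCompactSupport_deriv_smoothTransition

lemma integral_deriv_smoothTransition : ∫ x, deriv Real.smoothTransition x = 1 := by
  have h := integral_of_hasDerivAt_of_tendsto hasDerivAt_smoothTransition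
    integrable_deriv_smoothTransition (m := 0) (n := 1)
    (tendsto_const_nhds.congr' (by
      filter_upwards [eventually_le_atBot 0] with y hy
      rw [Real.smoothTransition.zero_of_nonpos hy]))
    (tendsto_const_nhds.congr' (by
      filter_upwards [eventually_ge_atTop 1] with y hy
      rw [Real.smoothTransition.one_of_one_le hy]))
  rw [h, sub_zero]

/-- A product kernel of mass one. -/
noncomputable def stepKernel (q : ℝ × ℝ) : ℝ :=
  deriv Real.smoothTransition q.1 * deriv Real.smoothTransition q.2

lemma continuous_stepKernel : Continuous stepKernel :=
  (continuous_deriv_smoothTransition.comp continuous_fst).mul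
    (continuous_deriv_smoothTransition.comp continuous_snd)

lemma integrable_stepKernel : Integrable stepKernel :=
  integrable_deriv_smoothTransition.mul_prod integrable_deriv_smoothTransition

lemma integral_stepKernel : ∫ q, stepKernel q = 1 := by
  have := integral_prod_mul (μ := volume) (ν := volume) (deriv Real.smoothTransition)
    (deriv Real.smoothTransition)
  rw [integral_deriv_smoothTransition, one_mul] at this
  exact this

lemma integrable_mul_rescaled_stepKernel {F : ℝ × ℝ → ℝ} (hF : Continuous F) {M : ℝ}
    (hM : ∀ p, |F p| ≤ M) (p₀ : ℝ × ℝ) {κ : ℝ} (hκ : κ ≠ 0) :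
    Integrable fun p => F p * (κ⁻¹ ^ 2 * stepKernel (κ⁻¹ • (p - p₀))) := by
  refine Integrable.bdd_mul (c := M) ?_ hF.aestronglyMeasurable (ae_of_all _ hM)
  refine Integrable.const_mul ?_ _
  have h1 : Integrable fun p : ℝ × ℝ => stepKernel (κ⁻¹ • p) :=
    integrable_stepKernel.comp_smul (inv_ne_zero hκ)
  exact h1.comp_sub_right p₀

/-- `stepKernel` has mass one, so its rescalings form an approximate identity at `p₀`. -/
lemma tendsto_integral_mul_rescaled_stepKernel {F : ℝ × ℝ → ℝ} (hF : Continuous F) {M : ℝ}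
    (hM : ∀ p, |F p| ≤ M) (p₀ : ℝ × ℝ) :
    Tendsto (fun κ : ℝ => ∫ p, F p * (κ⁻¹ ^ 2 * stepKernel (κ⁻¹ • (p - p₀)))) (𝓝[>] 0)
      (𝓝 (F p₀)) := by
  have key : ∀ κ : ℝ, 0 < κ → ∫ p, F p * (κ⁻¹ ^ 2 * stepKernel (κ⁻¹ • (p - p₀)))
      = ∫ q, F (p₀ + κ • q) * stepKernel q := by
    intro κ hκ
    rw [← integral_add_right_eq_self _ p₀]
    have := Measure.integral_comp_smul (volume : Measure (ℝ × ℝ))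
      (fun p => F (p + p₀) * (κ⁻¹ ^ 2 * stepKernel (κ⁻¹ • (p + p₀ - p₀)))) κ
    have hd : Module.finrank ℝ (ℝ × ℝ) = 2 := by simp
    rw [hd] at this
    have h2 : ∫ q, F (p₀ + κ • q) * stepKernel q
        = κ ^ 2 * ∫ q, F (κ • q + p₀) * (κ⁻¹ ^ 2 * stepKernel (κ⁻¹ • (κ • q + p₀ - p₀))) := by
      rw [← integral_const_mul]
      congr 1
      ext q
      rw [add_sub_cancel_right, smul_smul, inv_mul_cancel₀ hκ.ne', one_smul, add_comm p₀]
      field_simp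
    rw [h2, this, abs_of_nonneg (by positivity), smul_eq_mul]
    field_simp
  have lim : Tendsto (fun κ : ℝ => ∫ q, F (p₀ + κ • q) * stepKernel q) (𝓝[>] 0)
      (𝓝 (∫ q, F p₀ * stepKernel q)) := by
    refine tendsto_integral_filter_of_dominated_convergence (fun q => M * |stepKernel q|)
      (Eventually.of_forall fun κ => ?_) (Eventually.of_forall fun κ => ae_of_all _ fun q => ?_)
      (integrable_stepKernel.abs.const_mul M) (ae_of_all _ fun q => ?_)
    · exact ((hF.comp (by fun_prop)).mul continuous_stepKernel).aestronglyMeasurable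
    · rw [Real.norm_eq_abs, abs_mul]
      gcongr
      exact hM _
    · have : Tendsto (fun κ : ℝ => F (p₀ + κ • q) * stepKernel q) (𝓝 0)
          (𝓝 (F (p₀ + (0 : ℝ) • q) * stepKernel q)) :=
        Continuous.tendsto (by fun_prop) 0
      rw [zero_smul, add_zero] at this
      exact this.mono_left nhdsWithin_le_nhds
  rw [integral_const_mul, integral_stepKernel, mul_one] at lim
  refine lim.congr' ?_
  filter_upwards [self_mem_nhdsWithin] with κ hκ
  exact (key κ hκ).symm

lemma mixedDeriv_mul {A B : ℝ → ℝ} (hA : ContDiff ℝ 1 A) (hB : ContDiff ℝ 2 B) (p : ℝ × ℝ) :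
    mixedDeriv (fun q => A q.1 * B q.2) p = deriv A p.1 * deriv B p.2 := by
  have dA : ∀ x, HasDerivAt A (deriv A x) x :=
    fun x => (hA.differentiable (by norm_num) x).hasDerivAt
  have dB : ∀ x, HasDerivAt B (deriv B x) x :=
    fun x => (hB.differentiable (by norm_num) x).hasDerivAt
  have hB' : ContDiff ℝ 1 (deriv B) := hB.deriv'
  have dB' : ∀ x, HasDerivAt (deriv B) (deriv (deriv B) x) x :=
    fun x => (hB'.differentiable (by norm_num) x).hasDerivAt
  have gen : ∀ {A B A' B' : ℝ → ℝ} (q : ℝ × ℝ), (∀ x, HasDerivAt A (A' x) x) →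
      (∀ x, HasDerivAt B (B' x) x) → HasFDerivAt (fun q : ℝ × ℝ => A q.1 * B q.2)
      (A q.1 • (B' q.2 • ContinuousLinearMap.snd ℝ ℝ ℝ)
        + B q.2 • (A' q.1 • ContinuousLinearMap.fst ℝ ℝ ℝ)) q := by
    intro A B A' B' q hA hB
    exact ((hA q.1).comp_hasFDerivAt q hasFDerivAt_fst).mul
      ((hB q.2).comp_hasFDerivAt q hasFDerivAt_snd)
  have h1 : (fun q => fderiv ℝ (fun q : ℝ × ℝ => A q.1 * B q.2) q (0, 1))
      = fun q => A q.1 * deriv B q.2 := by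
    ext q
    rw [(gen q dA dB).fderiv]
    simp
  rw [mixedDeriv, h1, (gen p dA dB').fderiv]
  simp [mul_comm]

/-- A smooth approximation of the indicator function of `[a, b]`. -/
noncomputable def smoothStep (a b κ x : ℝ) : ℝ :=
  Real.smoothTransition (κ⁻¹ * (x - a)) - Real.smoothTransition (κ⁻¹ * (x - b))

lemma contDiff_smoothStep (a b κ : ℝ) {n : ℕ∞} : ContDiff ℝ n (smoothStep a b κ) := by
  have := Real.smoothTransition.contDiff (n := n)
  exact (this.comp (by fun_prop)).sub (this.comp (by fun_prop))

lemma abs_smoothStep_le (a b κ x : ℝ) : |smoothStep a b κ x| ≤ 1 := by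
  have h1 := Real.smoothTransition.nonneg (κ⁻¹ * (x - a))
  have h2 := Real.smoothTransition.nonneg (κ⁻¹ * (x - b))
  have h3 := Real.smoothTransition.le_one (κ⁻¹ * (x - a))
  have h4 := Real.smoothTransition.le_one (κ⁻¹ * (x - b))
  rw [smoothStep, abs_le]
  constructor <;> linarith

lemma smoothStep_eq_zero {a b κ x : ℝ} (hκ : 0 < κ) (hab : a ≤ b) (hx : x ∉ Icc a (b + κ)) :
    smoothStep a b κ x = 0 := by
  have hi : 0 < κ⁻¹ := inv_pos.2 hκ
  rcases not_and_or.1 hx with h | h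
  · rw [smoothStep, Real.smoothTransition.zero_of_nonpos, Real.smoothTransition.zero_of_nonpos,
      sub_zero]
    · exact mul_nonpos_of_nonneg_of_nonpos hi.le (by linarith)
    · exact mul_nonpos_of_nonneg_of_nonpos hi.le (by linarith)
  · rw [smoothStep, Real.smoothTransition.one_of_one_le, Real.smoothTransition.one_of_one_le,
      sub_self]
    · rw [inv_mul_eq_div, le_div_iff₀ hκ]; linarith
    · rw [inv_mul_eq_div, le_div_iff₀ hκ]; linarith

lemma deriv_smoothStep (a b κ x : ℝ) : deriv (smoothStep a b κ) x =
    κ⁻¹ * deriv Real.smoothTransition (κ⁻¹ * (x - a))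
      - κ⁻¹ * deriv Real.smoothTransition (κ⁻¹ * (x - b)) := by
  have d : ∀ c, HasDerivAt (fun x => Real.smoothTransition (κ⁻¹ * (x - c)))
      (deriv Real.smoothTransition (κ⁻¹ * (x - c)) * (κ⁻¹ * 1)) x := fun c =>
    (hasDerivAt_smoothTransition _).comp x (((hasDerivAt_id x).sub_const c).const_mul κ⁻¹)
  have : HasDerivAt (smoothStep a b κ) _ x := (d a).sub (d b)
  rw [this.deriv]
  ring

/-- The rectangular increments of a function whose mixed derivative is a signed measure. -/
lemma abs_rectangular_increment_le {F : ℝ → ℝ → ℝ} {μpos μneg : Measure (ℝ × ℝ)}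
    (h : HasMixedDerivMeasure F μpos μneg) (hF : Continuous fun p : ℝ × ℝ => F p.1 p.2) {M : ℝ}
    (hM : ∀ s t, |F s t| ≤ M) {a b c d κ : ℝ} (hκ : 0 < κ) (hab : a ≤ b) (hcd : c ≤ d)
    (hK : Icc a (b + κ) ×ˢ Icc c (d + κ) ⊆ offDiagonalSquare) :
    |F a c - F a d - F b c + F b d|
      ≤ ((μpos + μneg) (Icc a (b + κ) ×ˢ Icc c (d + κ))).toReal := by
  set K : Set (ℝ × ℝ) := Icc a (b + κ) ×ˢ Icc c (d + κ) with hKdef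
  have hKc : IsCompact K := isCompact_Icc.prod isCompact_Icc
  obtain ⟨fp, fn⟩ := h.lt_top_of_isCompact K hKc hK
  have hM' : ∀ p : ℝ × ℝ, |F p.1 p.2| ≤ M := fun p => hM _ _
  -- A smoothed indicator of the rectangle is an admissible test function: it is bounded by 1 and
  -- supported in `K`. Since `smoothStep` vanishes to the left of `a`, the rectangle only has to be
  -- enlarged on its upper sides.
  have bound : ∀ κ', 0 < κ' → κ' ≤ κ →
      |∫ p : ℝ × ℝ, F p.1 p.2 * mixedDeriv
        (fun q => smoothStep a b κ' q.1 * smoothStep c d κ' q.2) p|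
      ≤ ((μpos + μneg) K).toReal := by
    intro κ' hκ' hle
    set φ : ℝ × ℝ → ℝ := fun q => smoothStep a b κ' q.1 * smoothStep c d κ' q.2 with hφ
    have zero : ∀ q, q ∉ K → φ q = 0 := by
      intro q hq
      rcases not_and_or.1 (fun h : q.1 ∈ Icc a (b + κ) ∧ q.2 ∈ Icc c (d + κ) => hq h) with h | h
      · rw [hφ]
        simp only
        rw [smoothStep_eq_zero hκ' hab (fun h' => h ⟨h'.1, by linarith [h'.2]⟩), zero_mul]
      · rw [hφ]
        simp only
        rw [smoothStep_eq_zero (x := q.2) hκ' hcd (fun h' => h ⟨h'.1, by linarith [h'.2]⟩),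
          mul_zero]
    have supp : tsupport φ ⊆ K :=
      closure_minimal (fun q hq => by_contra fun h => hq (zero q h)) hKc.isClosed
    have one : ∀ q, |φ q| ≤ K.indicator (fun _ => (1 : ℝ)) q := by
      intro q
      by_cases hq : q ∈ K
      · rw [indicator_of_mem hq, hφ]
        simp only [abs_mul]
        exact mul_le_one₀ (abs_smoothStep_le _ _ _ _) (abs_nonneg _) (abs_smoothStep_le _ _ _ _)
      · rw [zero q hq]; simp [hq]
    have hs : ContDiff ℝ (⊤ : ℕ∞) φ :=
      ((contDiff_smoothStep a b κ').comp contDiff_fst).mul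
        ((contDiff_smoothStep c d κ').comp contDiff_snd)
    rw [h.integral_eq φ hs (HasCompactSupport.intro hKc zero) (supp.trans hK)]
    have est : ∀ μ : Measure (ℝ × ℝ), μ K < ⊤ → |∫ p, φ p ∂μ| ≤ (μ K).toReal := by
      intro μ hμ
      have hi : Integrable (K.indicator fun _ => (1 : ℝ)) μ :=
        (integrable_indicator_iff hKc.measurableSet).2 (integrableOn_const hμ.ne)
      have := norm_integral_le_of_norm_le (f := φ) hi (ae_of_all _ one)
      rw [integral_indicator hKc.measurableSet] at this
      simpa [Measure.real] using this
    rw [Measure.add_apply, ENNReal.toReal_add fp.ne fn.ne]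
    exact (abs_sub _ _).trans (add_le_add (est _ fp) (est _ fn))
  have lim : ∀ p₀, Tendsto (fun κ' : ℝ => ∫ p : ℝ × ℝ,
      F p.1 p.2 * (κ'⁻¹ ^ 2 * stepKernel (κ'⁻¹ • (p - p₀)))) (𝓝[>] 0) (𝓝 (F p₀.1 p₀.2)) :=
    fun p₀ => tendsto_integral_mul_rescaled_stepKernel hF hM' p₀
  -- The mixed derivative of the smoothed indicator is a signed sum of four approximate Dirac masses
  -- at the corners, so the pairing with `F` converges to the rectangular increment.
  have lim4 := (((lim (a, c)).sub (lim (a, d))).sub (lim (b, c))).add (lim (b, d))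
  refine le_of_tendsto lim4.abs ?_
  filter_upwards [Ioc_mem_nhdsGT hκ] with κ' hκ'
  have hne : κ' ≠ 0 := hκ'.1.ne'
  have i : ∀ p₀ : ℝ × ℝ, Integrable fun p : ℝ × ℝ =>
      F p.1 p.2 * (κ'⁻¹ ^ 2 * stepKernel (κ'⁻¹ • (p - p₀))) := fun p₀ =>
    integrable_mul_rescaled_stepKernel hF hM' p₀ hne
  refine le_trans (le_of_eq ?_) (bound κ' hκ'.1 hκ'.2)
  congr 1
  have e1 := integral_sub (i (a, c)) (i (a, d))
  have e2 := integral_sub ((i (a, c)).sub (i (a, d))) (i (b, c))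
  have e3 := integral_add (((i (a, c)).sub (i (a, d))).sub (i (b, c))) (i (b, d))
  simp only [Pi.sub_apply] at e2 e3
  rw [← e1, ← e2, ← e3]
  congr 1
  ext p
  rw [mixedDeriv_mul (contDiff_smoothStep a b κ' (n := 1)) (contDiff_smoothStep c d κ' (n := 2)),
    deriv_smoothStep, deriv_smoothStep]
  simp only [stepKernel, Prod.smul_fst, Prod.smul_snd, Prod.fst_sub, Prod.snd_sub, smul_eq_mul]
  ring

/-! ### Integrals over separated pairs of times -/

/-- The pairs of times that stay at distance of order `ε` from each other and from the endpoints. -/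
def separatedPairs (ε : ℝ) : Set (ℝ × ℝ) := {p | ε ≤ p.1 ∧ p.1 + 3 * ε ≤ p.2 ∧ p.2 + 2 * ε ≤ 1}

lemma isClosed_separatedPairs (ε : ℝ) : IsClosed (separatedPairs ε) :=
  (isClosed_le (by fun_prop) (by fun_prop)).and
    ((isClosed_le (by fun_prop) (by fun_prop)).and (isClosed_le (by fun_prop) (by fun_prop)))

/-- Each increment is at most the mass of a square of side $\tfrac32\varepsilon$ with corner `p`. By
Tonelli, integrating over `p` counts every point of the simplex with the area
$\tfrac94\varepsilon^2$ of the set of corners whose square contains it. -/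
lemma lintegral_rectangular_increment_le {F : ℝ → ℝ → ℝ} {μpos μneg : Measure (ℝ × ℝ)}
    (h : HasMixedDerivMeasure F μpos μneg) (hF : Continuous fun p : ℝ × ℝ => F p.1 p.2) {M : ℝ}
    (hM : ∀ s t, |F s t| ≤ M) {ε : ℝ} (hε : 0 < ε)
    (hfin : (μpos + μneg) (offDiagonalSimplex ε) < ⊤) :
    ∫⁻ p in separatedPairs ε, ENNReal.ofReal
      |F p.1 p.2 - F p.1 (p.2 + ε) - F (p.1 + ε) p.2 + F (p.1 + ε) (p.2 + ε)|
      ≤ ENNReal.ofReal (9 / 4 * ε ^ 2) * (μpos + μneg) (offDiagonalSimplex ε) := by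
  set μ := μpos + μneg
  -- The measure may be infinite near the diagonal. Its restriction to the simplex is finite, as
  -- Tonelli requires.
  set ν := μ.restrict (offDiagonalSimplex ε) with hν
  have hνu : ν univ = μ (offDiagonalSimplex ε) := by rw [hν, Measure.restrict_apply_univ]
  have : IsFiniteMeasure ν := ⟨by rw [hνu]; exact hfin⟩
  set κ := ε / 2 with hκ
  let R : Set ((ℝ × ℝ) × (ℝ × ℝ)) := {x | x.1.1 ≤ x.2.1 ∧ x.2.1 ≤ x.1.1 + ε + κ ∧
    x.1.2 ≤ x.2.2 ∧ x.2.2 ≤ x.1.2 + ε + κ}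
  have hR : MeasurableSet R :=
    IsClosed.measurableSet <| (isClosed_le (by fun_prop) (by fun_prop)).and <|
      (isClosed_le (by fun_prop) (by fun_prop)).and <|
      (isClosed_le (by fun_prop) (by fun_prop)).and (isClosed_le (by fun_prop) (by fun_prop))
  have step : ∀ p ∈ separatedPairs ε, ENNReal.ofReal
      |F p.1 p.2 - F p.1 (p.2 + ε) - F (p.1 + ε) p.2 + F (p.1 + ε) (p.2 + ε)|
      ≤ ν (Prod.mk p ⁻¹' R) := by
    rintro ⟨u, v⟩ ⟨h1, h2, h3⟩
    simp only at h1 h2 h3 ⊢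
    -- The margins in `separatedPairs` keep the enlarged square inside the open unit square and at
    -- distance more than `ε` from the diagonal.
    have sub1 : Icc u (u + ε + κ) ×ˢ Icc v (v + ε + κ) ⊆ offDiagonalSquare := by
      rintro ⟨s, t⟩ ⟨⟨a1, a2⟩, ⟨b1, b2⟩⟩
      simp only at a1 a2 b1 b2
      exact ⟨⟨by simp only; linarith, by simp only; linarith⟩,
        ⟨by simp only; linarith, by simp only; linarith⟩, by simp only; linarith⟩
    have sub2 : Icc u (u + ε + κ) ×ˢ Icc v (v + ε + κ) ⊆ offDiagonalSimplex ε := by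
      rintro ⟨s, t⟩ ⟨⟨a1, a2⟩, ⟨b1, b2⟩⟩
      simp only at a1 a2 b1 b2
      exact ⟨by simp only; linarith, by simp only; linarith, by simp only; linarith⟩
    have hb := abs_rectangular_increment_le h hF hM (κ := κ) (a := u) (b := u + ε) (c := v)
      (d := v + ε) (by positivity) (by linarith) (by linarith) sub1
    have hsec : Prod.mk (u, v) ⁻¹' R = Icc u (u + ε + κ) ×ˢ Icc v (v + ε + κ) := by
      ext ⟨s, t⟩
      simp only [R, mem_preimage, mem_ofPred_eq, mem_prod, mem_Icc]
      tauto
    rw [hsec, hν, Measure.restrict_apply (measurableSet_Icc.prod measurableSet_Icc),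
      inter_eq_left.2 sub2]
    exact (ENNReal.ofReal_le_ofReal hb).trans ENNReal.ofReal_toReal_le
  calc _ ≤ ∫⁻ p in separatedPairs ε, ν (Prod.mk p ⁻¹' R) :=
        setLIntegral_mono' (isClosed_separatedPairs ε).measurableSet step
    _ ≤ ∫⁻ p : ℝ × ℝ, ν (Prod.mk p ⁻¹' R) := setLIntegral_le_lintegral _ _
    _ = ((volume : Measure (ℝ × ℝ)).prod ν) R := (Measure.prod_apply hR).symm
    _ = ∫⁻ q, volume ((fun p => (p, q)) ⁻¹' R) ∂ν := Measure.prod_apply_symm hR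
    _ ≤ ∫⁻ _, ENNReal.ofReal (9 / 4 * ε ^ 2) ∂ν := by
        refine lintegral_mono fun q => ?_
        have hsub : (fun p => (p, q)) ⁻¹' R
            ⊆ Icc (q.1 - (ε + κ)) q.1 ×ˢ Icc (q.2 - (ε + κ)) q.2 := by
          rintro ⟨u, v⟩ ⟨a, b, c, d⟩
          simp only at a b c d
          exact ⟨⟨by simp only; linarith, a⟩, ⟨by simp only; linarith, c⟩⟩
        refine (measure_mono hsub).trans ?_
        rw [Measure.volume_eq_prod, Measure.prod_prod, Real.volume_Icc, Real.volume_Icc,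
          ← ENNReal.ofReal_mul (by linarith)]
        refine ENNReal.ofReal_le_ofReal (le_of_eq ?_)
        rw [hκ]; ring
    _ = _ := by rw [lintegral_const, hνu]

lemma lintegral_Ici_rpow {ε : ℝ} (hε : 0 < ε) :
    ∫⁻ r in Ici ε, ENNReal.ofReal (r ^ (-(5 / 3) : ℝ)) = ENNReal.ofReal (3 / 2 * ε ^ (-(2 / 3) : ℝ)) := by
  rw [setLIntegral_congr Ioi_ae_eq_Ici.symm, ← ofReal_integral_eq_lintegral_ofReal
    (integrableOn_Ioi_rpow_of_lt (by norm_num) hε)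
    ((ae_restrict_mem measurableSet_Ioi).mono fun x hx =>
      Real.rpow_nonneg (hε.le.trans (le_of_lt hx)) _), integral_Ioi_rpow_of_lt (by norm_num) hε]
  congr 1
  norm_num
  ring

/-- The square of $r^{-5/6}$ is $r^{-5/3}$, whose integral beyond $\varepsilon$ is of order
$\varepsilon^{-2/3}$, the same order as the mass of the mixed derivative measure. The constant is
$2\cdot\tfrac32+2\cdot\tfrac32$, after $(a+b)^2\le2a^2+2b^2$. -/
lemma lintegral_separatedPairs_rpow_le {ε : ℝ} (hε : 0 < ε) :
    ∫⁻ p in separatedPairs ε, ENNReal.ofReal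
      ((p.1 ^ (-(5 / 6) : ℝ) + (p.2 - p.1) ^ (-(5 / 6) : ℝ)) ^ 2)
      ≤ ENNReal.ofReal (6 * ε ^ (-(2 / 3) : ℝ)) := by
  set w : ℝ → ENNReal := (Ici ε).indicator fun r => ENNReal.ofReal (r ^ (-(5 / 3) : ℝ)) with hw
  have hwm : Measurable w := by
    refine Measurable.indicator ?_ measurableSet_Ici
    fun_prop
  have hwi : ∫⁻ r, w r = ENNReal.ofReal (3 / 2 * ε ^ (-(2 / 3) : ℝ)) := by
    rw [hw, lintegral_indicator measurableSet_Ici, lintegral_Ici_rpow hε]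
  have sq : ∀ r : ℝ, 0 ≤ r → (r ^ (-(5 / 6) : ℝ)) ^ 2 = r ^ (-(5 / 3) : ℝ) := by
    intro r hr
    rw [← Real.rpow_natCast, ← Real.rpow_mul hr]; norm_num
  have step : ∀ p : ℝ × ℝ, (separatedPairs ε).indicator (fun p => ENNReal.ofReal
      ((p.1 ^ (-(5 / 6) : ℝ) + (p.2 - p.1) ^ (-(5 / 6) : ℝ)) ^ 2)) p
      ≤ (Icc (0 : ℝ) 1).indicator 1 p.2 * (2 * w p.1)
        + (Icc (0 : ℝ) 1).indicator 1 p.1 * (2 * w (p.2 - p.1)) := by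
    rintro ⟨u, v⟩
    by_cases hp : (u, v) ∈ separatedPairs ε
    · obtain ⟨h1, h2, h3⟩ := id hp
      simp only at h1 h2 h3
      have e1 : w u = ENNReal.ofReal (u ^ (-(5 / 3) : ℝ)) := indicator_of_mem h1 _
      have e2 : w (v - u) = ENNReal.ofReal ((v - u) ^ (-(5 / 3) : ℝ)) :=
        indicator_of_mem (by rw [mem_Ici]; linarith) _
      have m1 : v ∈ Icc (0 : ℝ) 1 := ⟨by linarith, by linarith⟩
      have m2 : u ∈ Icc (0 : ℝ) 1 := ⟨by linarith, by linarith⟩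
      rw [indicator_of_mem hp]
      simp only [indicator_of_mem m1, indicator_of_mem m2, Pi.one_apply, one_mul, e1, e2]
      rw [← mul_add, ← ENNReal.ofReal_add (Real.rpow_nonneg (by linarith) _)
        (Real.rpow_nonneg (by linarith) _), ← ENNReal.ofReal_ofNat 2,
        ← ENNReal.ofReal_mul (by norm_num)]
      refine ENNReal.ofReal_le_ofReal ?_
      rw [← sq u (by linarith), ← sq (v - u) (by linarith)]
      nlinarith [sq_nonneg (u ^ (-(5 / 6) : ℝ) - (v - u) ^ (-(5 / 6) : ℝ))]
    · rw [indicator_of_notMem hp]; exact zero_le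
  have m1 : Measurable fun p : ℝ × ℝ => (Icc (0 : ℝ) 1).indicator (1 : ℝ → ENNReal) p.2 * (2 * w p.1) :=
    ((measurable_one.indicator measurableSet_Icc).comp measurable_snd).mul
      ((hwm.comp measurable_fst).const_mul 2)
  have m2 : Measurable fun p : ℝ × ℝ =>
      (Icc (0 : ℝ) 1).indicator (1 : ℝ → ENNReal) p.1 * (2 * w (p.2 - p.1)) :=
    ((measurable_one.indicator measurableSet_Icc).comp measurable_fst).mul
      ((hwm.comp (measurable_snd.sub measurable_fst)).const_mul 2)
  have i1 : ∫⁻ x, (Icc (0 : ℝ) 1).indicator (1 : ℝ → ENNReal) x = 1 := by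
    rw [lintegral_indicator measurableSet_Icc]; simp
  have mi : Measurable ((Icc (0 : ℝ) 1).indicator (1 : ℝ → ENNReal)) :=
    measurable_one.indicator measurableSet_Icc
  rw [← lintegral_indicator (isClosed_separatedPairs ε).measurableSet]
  calc _ ≤ _ := lintegral_mono step
    _ = 2 * ENNReal.ofReal (3 / 2 * ε ^ (-(2 / 3) : ℝ))
        + 2 * ENNReal.ofReal (3 / 2 * ε ^ (-(2 / 3) : ℝ)) := by
        rw [lintegral_add_left m1, Measure.volume_eq_prod,
          lintegral_prod _ m1.aemeasurable, lintegral_prod _ m2.aemeasurable]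
        congr 1
        · simp_rw [lintegral_mul_const _ mi, i1, one_mul]
          rw [lintegral_const_mul _ hwm, hwi]
        · have : ∀ u : ℝ, ∫⁻ v, (Icc (0 : ℝ) 1).indicator (1 : ℝ → ENNReal) u * (2 * w (v - u))
              = (Icc (0 : ℝ) 1).indicator (1 : ℝ → ENNReal) u
                * (2 * ENNReal.ofReal (3 / 2 * ε ^ (-(2 / 3) : ℝ))) := by
            intro u
            have hm : Measurable fun v => w (v - u) := hwm.comp (measurable_id.sub_const u)
            rw [lintegral_const_mul _ (hm.const_mul 2), lintegral_const_mul _ hm,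
              lintegral_sub_right_eq_self w u, hwi]
          simp_rw [this]
          rw [lintegral_mul_const _ mi, i1, one_mul]
    _ = _ := by
        rw [← two_mul, ← mul_assoc, ← ENNReal.ofReal_ofNat 2, ← ENNReal.ofReal_mul (by norm_num),
          ← ENNReal.ofReal_mul (by norm_num)]
        congr 1
        ring

/-- Almost every pair of times in the unit square is separated, up to the order of `ε`. -/
lemma volume_not_separatedPairs_le {ε : ℝ} (hε : 0 < ε) :
    volume {p : ℝ × ℝ | p ∈ Icc (0 : ℝ) 1 ×ˢ Icc (0 : ℝ) 1 ∧ p ∉ separatedPairs ε ∧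
      p.swap ∉ separatedPairs ε} ≤ ENNReal.ofReal (12 * ε) := by
  -- Strips along the sides contribute $\varepsilon+\varepsilon+2\varepsilon+2\varepsilon$ and the
  -- band around the diagonal $6\varepsilon$, which makes $12\varepsilon$.
  have hsub : {p : ℝ × ℝ | p ∈ Icc (0 : ℝ) 1 ×ˢ Icc (0 : ℝ) 1 ∧ p ∉ separatedPairs ε ∧
      p.swap ∉ separatedPairs ε} ⊆
      (Icc 0 ε ×ˢ Icc 0 1 ∪ Icc 0 1 ×ˢ Icc 0 ε) ∪
      (Icc (1 - 2 * ε) 1 ×ˢ Icc 0 1 ∪ Icc 0 1 ×ˢ Icc (1 - 2 * ε) 1) ∪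
      {p : ℝ × ℝ | p.1 ∈ Icc (0 : ℝ) 1 ∧ p.1 - 3 * ε ≤ p.2 ∧ p.2 ≤ p.1 + 3 * ε} := by
    rintro ⟨u, v⟩ ⟨⟨⟨a, b⟩, ⟨c, d⟩⟩, h1, h2⟩
    simp only at a b c d
    by_contra hcon
    simp only [mem_union, mem_prod, mem_Icc, mem_ofPred_eq, not_or, not_and, not_le] at hcon
    obtain ⟨⟨⟨g1, g2⟩, ⟨g3, g4⟩⟩, g5⟩ := hcon
    have f1 : ε < u := by by_contra hh; linarith [g1 ⟨a, by linarith⟩ c]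
    have f2 : ε < v := by by_contra hh; linarith [g2 ⟨a, b⟩ c]
    have f3 : u < 1 - 2 * ε := by by_contra hh; linarith [g3 ⟨by linarith, b⟩ c]
    have f4 : v < 1 - 2 * ε := by by_contra hh; linarith [g4 ⟨a, b⟩ (by linarith)]
    rcases le_total u v with h | h
    · refine h1 ⟨f1.le, ?_, by simp only; linarith⟩
      simp only
      exact (g5 ⟨a, b⟩ (by linarith)).le
    · refine h2 ⟨f2.le, ?_, by simp only [Prod.swap]; linarith⟩
      simp only [Prod.swap]
      by_contra hh
      linarith [g5 ⟨a, b⟩ (by linarith)]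
  have hdiag : volume {p : ℝ × ℝ | p.1 ∈ Icc (0 : ℝ) 1 ∧ p.1 - 3 * ε ≤ p.2 ∧ p.2 ≤ p.1 + 3 * ε}
      ≤ ENNReal.ofReal (6 * ε) := by
    have hm : MeasurableSet {p : ℝ × ℝ | p.1 ∈ Icc (0 : ℝ) 1 ∧ p.1 - 3 * ε ≤ p.2 ∧
        p.2 ≤ p.1 + 3 * ε} :=
      IsClosed.measurableSet <| (isClosed_Icc.preimage continuous_fst).and <|
        (isClosed_le (by fun_prop) (by fun_prop)).and (isClosed_le (by fun_prop) (by fun_prop))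
    rw [Measure.volume_eq_prod, Measure.prod_apply hm]
    calc _ ≤ ∫⁻ u, (Icc (0 : ℝ) 1).indicator (fun _ => ENNReal.ofReal (6 * ε)) u := by
          refine lintegral_mono fun u => ?_
          by_cases hu : u ∈ Icc (0 : ℝ) 1
          · rw [indicator_of_mem hu]
            have : Prod.mk u ⁻¹' {p : ℝ × ℝ | p.1 ∈ Icc (0 : ℝ) 1 ∧ p.1 - 3 * ε ≤ p.2 ∧
              p.2 ≤ p.1 + 3 * ε} ⊆ Icc (u - 3 * ε) (u + 3 * ε) := fun v hv => ⟨hv.2.1, hv.2.2⟩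
            refine (measure_mono this).trans ?_
            rw [Real.volume_Icc]
            exact ENNReal.ofReal_le_ofReal (by linarith)
          · have : Prod.mk u ⁻¹' {p : ℝ × ℝ | p.1 ∈ Icc (0 : ℝ) 1 ∧ p.1 - 3 * ε ≤ p.2 ∧
              p.2 ≤ p.1 + 3 * ε} = ∅ := by
              ext v
              simp only [mem_preimage, mem_ofPred_eq, mem_empty_iff_false, iff_false]
              exact fun h => hu h.1
            rw [this]; simp
      _ = _ := by rw [lintegral_indicator measurableSet_Icc]; simp
  refine (measure_mono hsub).trans ((measure_union_le _ _).trans ((add_le_add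
    ((measure_union_le _ _).trans (add_le_add (measure_union_le _ _) (measure_union_le _ _)))
    hdiag).trans ?_))
  rw [Measure.volume_eq_prod, Measure.prod_prod, Measure.prod_prod, Measure.prod_prod,
    Measure.prod_prod]
  simp only [Real.volume_Icc, sub_zero, ENNReal.ofReal_one, mul_one, one_mul, sub_sub_cancel]
  rw [← ENNReal.ofReal_add hε.le hε.le, ← ENNReal.ofReal_add (by positivity) (by positivity),
    ← ENNReal.ofReal_add (by positivity) (by positivity),
    ← ENNReal.ofReal_add (by positivity) (by positivity)]
  exact ENNReal.ofReal_le_ofReal (by linarith)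

/-! ### The Gaussian process as a curve in a Hilbert space -/

section
open scoped InnerProductSpace

lemma extendProcess_coe {Ω : Type*} (X : Icc (0 : ℝ) 1 → Ω → ℝ) (t : Icc (0 : ℝ) 1) :
    extendProcess X t = X t := by
  rw [extendProcess, projIcc_val]

section
variable {Ω : Type*} [MeasurableSpace Ω] {P : Measure Ω} {X : Icc (0 : ℝ) 1 → Ω → ℝ}

lemma measurable_extendProcess_uncurry (hX : Measurable fun p : Icc (0 : ℝ) 1 × Ω => X p.1 p.2) :
    Measurable fun p : ℝ × Ω => extendProcess X p.1 p.2 :=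
  hX.comp (((continuous_projIcc (h := zero_le_one (α := ℝ))).measurable.comp
    measurable_fst).prodMk measurable_snd)

lemma isGaussianProcess_extendProcess (hX : IsGaussianProcess X P) :
    IsGaussianProcess (extendProcess X) P :=
  hX.comp_right (projIcc 0 1 zero_le_one)

lemma hasGaussianLaw_extendProcess_pi (hX : IsGaussianProcess X P) {ι : Type*} [Fintype ι]
    (τ : ι → ℝ) : HasGaussianLaw (fun ω i => extendProcess X (τ i) ω) P := by
  have h := ((isGaussianProcess_extendProcess hX).comp_right τ).hasGaussianLaw Finset.univ
  let A : (↥(Finset.univ : Finset ι) → ℝ) →L[ℝ] (ι → ℝ) :=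
    ContinuousLinearMap.pi fun i => ContinuousLinearMap.proj ⟨i, Finset.mem_univ i⟩
  exact h.map A

/-- The increment of the process over `[u, u + ε]`. -/
noncomputable def increment (X : Icc (0 : ℝ) 1 → Ω → ℝ) (ε u : ℝ) (ω : Ω) : ℝ :=
  extendProcess X (u + ε) ω - extendProcess X u ω

/-- The midpoint of the process over `[u, u + ε]`. -/
noncomputable def midpointValue (X : Icc (0 : ℝ) 1 → Ω → ℝ) (ε u : ℝ) (ω : Ω) : ℝ :=
  1 / 2 * (extendProcess X (u + ε) ω + extendProcess X u ω)

lemma hasGaussianLaw_increments_midpoints (hX : IsGaussianProcess X P) (ε u v : ℝ) :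
    HasGaussianLaw (fun ω i => (![increment X ε u, increment X ε v, midpointValue X ε u,
      midpointValue X ε v] : Fin 4 → Ω → ℝ) i ω) P := by
  have h := hasGaussianLaw_matrix (hasGaussianLaw_extendProcess_pi hX ![u, u + ε, v, v + ε])
    ![![-1, 1, 0, 0], ![0, 0, -1, 1], ![1 / 2, 1 / 2, 0, 0], ![0, 0, 1 / 2, 1 / 2]]
  convert h using 1
  ext ω i
  fin_cases i <;> simp [Fin.sum_univ_four, increment, midpointValue] <;> ring

lemma integral_increment_eq_zero (hX : IsGaussianProcess X P) (h0 : ∀ t, ∫ ω, X t ω ∂P = 0)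
    (ε u : ℝ) : ∫ ω, increment X ε u ω ∂P = 0 := by
  have i := fun t => ((isGaussianProcess_extendProcess hX).hasGaussianLaw_eval t).integrable
  simp only [increment]
  rw [integral_sub (i _) (i _)]
  simp [extendProcess, h0]

lemma integral_midpointValue_eq_zero (hX : IsGaussianProcess X P) (h0 : ∀ t, ∫ ω, X t ω ∂P = 0)
    (ε u : ℝ) : ∫ ω, midpointValue X ε u ω ∂P = 0 := by
  have i := fun t => ((isGaussianProcess_extendProcess hX).hasGaussianLaw_eval t).integrable
  simp only [midpointValue]
  rw [integral_const_mul, integral_add (i _) (i _)]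
  simp [extendProcess, h0]

/-- A centered Gaussian process, seen as a curve in a Hilbert space. -/
lemma exists_hilbert_curve (hX : IsGaussianProcess X P) (h0 : ∀ t, ∫ ω, X t ω ∂P = 0) :
    ∃ Y : ℝ → Lp ℝ 2 P, ∀ s t, ⟪Y s, Y t⟫_ℝ = cov[extendProcess X s, extendProcess X t; P] := by
  have m := fun t => ((isGaussianProcess_extendProcess hX).hasGaussianLaw_eval t).memLp_two
  have := hX.isProbabilityMeasure
  refine ⟨fun t => (m t).toLp, fun s t => ?_⟩
  rw [L2.inner_def, covariance_eq_sub (m s) (m t)]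
  have z : ∀ t, ∫ ω, extendProcess X t ω ∂P = 0 := fun t => h0 _
  rw [z, z, mul_zero, sub_zero]
  refine integral_congr_ae ?_
  filter_upwards [(m s).coeFn_toLp, (m t).coeFn_toLp] with ω h1 h2
  rw [h1, h2]
  simp [mul_comm]

variable {Y : ℝ → Lp ℝ 2 P}

lemma covFun_eq_inner (hX : IsGaussianProcess X P) (h0 : ∀ t, ∫ ω, X t ω ∂P = 0)
    (hY : ∀ s t, ⟪Y s, Y t⟫_ℝ = cov[extendProcess X s, extendProcess X t; P]) (s t : ℝ) :
    covFun X P s t = ⟪Y s, Y t⟫_ℝ := by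
  have m := fun t => ((isGaussianProcess_extendProcess hX).hasGaussianLaw_eval t).memLp_two
  have := hX.isProbabilityMeasure
  have z : ∀ t, ∫ ω, extendProcess X t ω ∂P = 0 := fun t => h0 _
  rw [hY, covariance_eq_sub (m s) (m t), z, z, mul_zero, sub_zero]
  rfl

lemma cov_increment_increment (hX : IsGaussianProcess X P)
    (hY : ∀ s t, ⟪Y s, Y t⟫_ℝ = cov[extendProcess X s, extendProcess X t; P]) (ε u v : ℝ) :
    cov[increment X ε u, increment X ε v; P] = ⟪Y (u + ε) - Y u, Y (v + ε) - Y v⟫_ℝ := by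
  have m := fun t => ((isGaussianProcess_extendProcess hX).hasGaussianLaw_eval t).memLp_two
  have := hX.isProbabilityMeasure
  unfold increment
  rw [covariance_fun_sub_fun_sub (m _) (m _) (m _) (m _)]
  simp only [inner_sub_left, inner_sub_right, hY]
  ring

lemma cov_midpointValue_increment (hX : IsGaussianProcess X P)
    (hY : ∀ s t, ⟪Y s, Y t⟫_ℝ = cov[extendProcess X s, extendProcess X t; P]) (ε u v : ℝ) :
    cov[midpointValue X ε u, increment X ε v; P]
      = ⟪(1 / 2 : ℝ) • (Y (u + ε) + Y u), Y (v + ε) - Y v⟫_ℝ := by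
  have m := fun t => ((isGaussianProcess_extendProcess hX).hasGaussianLaw_eval t).memLp_two
  have := hX.isProbabilityMeasure
  have e : midpointValue X ε u
      = (1 / 2 : ℝ) • (extendProcess X (u + ε) + extendProcess X u) := by
    ext ω; simp [midpointValue]
  have e' : increment X ε v = extendProcess X (v + ε) - extendProcess X v := rfl
  rw [e, e', covariance_smul_left, covariance_add_left (m _) (m _) ((m _).sub (m _)),
    covariance_sub_right (m _) (m _) (m _), covariance_sub_right (m _) (m _) (m _)]
  simp only [real_inner_smul_left, inner_add_left, inner_sub_right, hY]
  ring

lemma variance_increment (hX : IsGaussianProcess X P)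
    (hY : ∀ s t, ⟪Y s, Y t⟫_ℝ = cov[extendProcess X s, extendProcess X t; P]) (ε u : ℝ) :
    Var[increment X ε u; P] = ‖Y (u + ε) - Y u‖ ^ 2 := by
  rw [← covariance_self, cov_increment_increment hX hY, real_inner_self_eq_norm_sq]
  exact ((isGaussianProcess_extendProcess hX).aemeasurable _).sub
    ((isGaussianProcess_extendProcess hX).aemeasurable _)

lemma canonicalMetricSq_eq_norm (hX : IsGaussianProcess X P) (h0 : ∀ t, ∫ ω, X t ω ∂P = 0)
    (hY : ∀ s t, ⟪Y s, Y t⟫_ℝ = cov[extendProcess X s, extendProcess X t; P]) (s t : ℝ) :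
    canonicalMetricSq X P s t = ‖Y t - Y s‖ ^ 2 := by
  have m := fun t => ((isGaussianProcess_extendProcess hX).hasGaussianLaw_eval t).memLp_two
  have h := variance_increment hX hY (t - s) s
  rw [add_sub_cancel] at h
  rw [← h, variance_of_integral_eq_zero]
  · simp only [canonicalMetricSq, increment, add_sub_cancel]
  · exact (((m _).sub (m _)).aemeasurable)
  · exact integral_increment_eq_zero hX h0 _ _

lemma hilbert_curve_projIcc
    (hY : ∀ s t, ⟪Y s, Y t⟫_ℝ = cov[extendProcess X s, extendProcess X t; P]) (t : ℝ) :
    Y t = Y (projIcc 0 1 zero_le_one t) := by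
  have e : extendProcess X (projIcc (0 : ℝ) 1 zero_le_one t : ℝ) = extendProcess X t := by
    rw [extendProcess_coe]; rfl
  rw [← sub_eq_zero, ← inner_self_eq_zero (𝕜 := ℝ)]
  simp only [inner_sub_left, inner_sub_right, hY, e]
  ring

variable {δsq : ℝ → ℝ}

lemma univariate_nonneg (hreg : RegularityHypotheses 3 X P δsq) {r : ℝ} (hr : r ∈ Icc (0 : ℝ) 1) :
    0 ≤ δsq r := by
  have h := hreg.metric_le 0 (by simp) r hr
  rw [sub_zero, abs_of_nonneg hr.1] at h
  exact (integral_nonneg fun _ => sq_nonneg _).trans h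

/-- The bound holds for all real times because the projection onto $[0,1]$ does not increase
distances, so increments reaching beyond time 1 need no separate treatment. -/
lemma norm_hilbert_curve_sub_sq_le (hX : IsGaussianProcess X P) (h0 : ∀ t, ∫ ω, X t ω ∂P = 0)
    (hY : ∀ s t, ⟪Y s, Y t⟫_ℝ = cov[extendProcess X s, extendProcess X t; P])
    (hreg : RegularityHypotheses 3 X P δsq) {s t r : ℝ} (h : |t - s| ≤ r) (hr : r ≤ 1) :
    ‖Y t - Y s‖ ^ 2 ≤ δsq r := by
  rw [hilbert_curve_projIcc hY t, hilbert_curve_projIcc hY s,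
    ← canonicalMetricSq_eq_norm hX h0 hY]
  have hp := abs_projIcc_sub_projIcc (a := (0 : ℝ)) (b := 1) (c := t) (d := s) zero_le_one
  refine (hreg.metric_le _ (projIcc _ _ _ _).2 _ (projIcc _ _ _ _).2).trans
    (hreg.monotoneOn_univariate ⟨abs_nonneg _, ?_⟩ ⟨(abs_nonneg _).trans h, hr⟩ ?_) <;> linarith

lemma univariate_isLittleO (hreg : RegularityHypotheses 3 X P δsq) :
    Tendsto (fun r => δsq r * r ^ (-(1 / 3) : ℝ)) (𝓝[>] 0) (𝓝 0) := by
  have h := hreg.isLittleO_univariate.tendsto_div_nhds_zero.pow 2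
  rw [zero_pow (by norm_num)] at h
  refine h.congr' ?_
  filter_upwards [Ioc_mem_nhdsGT (zero_lt_one (α := ℝ))] with r hr
  rw [div_pow, Real.sq_sqrt (univariate_nonneg hreg ⟨hr.1.le, hr.2⟩), ← Real.rpow_natCast,
    ← Real.rpow_mul hr.1.le, Real.rpow_neg hr.1.le, div_eq_mul_inv]
  norm_num

/-- Near 0 the bound comes from the little-o assumption; away from 0 it comes from monotonicity,
$\delta^2(r)\le\delta^2(1)$. -/
lemma exists_univariate_le (hreg : RegularityHypotheses 3 X P δsq) :
    ∃ K : ℝ, 0 ≤ K ∧ ∀ r ∈ Ioc (0 : ℝ) 1, δsq r ≤ K * r ^ (1 / 3 : ℝ) := by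
  have h := (univariate_isLittleO hreg).eventually (gt_mem_nhds (zero_lt_one (α := ℝ)))
  obtain ⟨r₀, hr₀, hr⟩ := (mem_nhdsGT_iff_exists_Ioo_subset' (zero_lt_one (α := ℝ))).1 h
  rw [mem_Ioi] at hr₀
  have n1 := univariate_nonneg hreg (r := 1) (by simp)
  refine ⟨max 1 (δsq 1 * r₀ ^ (-(1 / 3) : ℝ)), le_max_of_le_left zero_le_one, fun r hr1 => ?_⟩
  have hinv : r ^ (-(1 / 3) : ℝ) * r ^ (1 / 3 : ℝ) = 1 := by
    rw [← Real.rpow_add hr1.1]; norm_num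
  have hpos : 0 < r ^ (1 / 3 : ℝ) := Real.rpow_pos_of_pos hr1.1 _
  rcases lt_or_ge r r₀ with h1 | h1
  · have h2 : δsq r * r ^ (-(1 / 3) : ℝ) < 1 := hr ⟨hr1.1, h1⟩
    calc δsq r = δsq r * r ^ (-(1 / 3) : ℝ) * r ^ (1 / 3 : ℝ) := by rw [mul_assoc, hinv, mul_one]
      _ ≤ 1 * r ^ (1 / 3 : ℝ) := by gcongr
      _ ≤ _ := by gcongr; exact le_max_left _ _
  · have h3 : r ^ (-(1 / 3) : ℝ) ≤ r₀ ^ (-(1 / 3) : ℝ) :=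
      Real.rpow_le_rpow_of_nonpos hr₀ h1 (by norm_num)
    calc δsq r ≤ δsq 1 := hreg.monotoneOn_univariate ⟨hr1.1.le, hr1.2⟩ (by simp) hr1.2
      _ = δsq 1 * r ^ (-(1 / 3) : ℝ) * r ^ (1 / 3 : ℝ) := by rw [mul_assoc, hinv, mul_one]
      _ ≤ δsq 1 * r₀ ^ (-(1 / 3) : ℝ) * r ^ (1 / 3 : ℝ) := by gcongr
      _ ≤ _ := by gcongr; exact le_max_right _ _

lemma exists_norm_hilbert_curve_sub_le (hX : IsGaussianProcess X P)
    (h0 : ∀ t, ∫ ω, X t ω ∂P = 0)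
    (hY : ∀ s t, ⟪Y s, Y t⟫_ℝ = cov[extendProcess X s, extendProcess X t; P])
    (hreg : RegularityHypotheses 3 X P δsq) :
    ∃ L : ℝ, 0 ≤ L ∧ ∀ s ∈ Icc (0 : ℝ) 1, ∀ t ∈ Icc (0 : ℝ) 1,
      ‖Y t - Y s‖ ≤ L * |t - s| ^ (1 / 6 : ℝ) := by
  obtain ⟨K, hK0, hK⟩ := exists_univariate_le hreg
  refine ⟨√K, Real.sqrt_nonneg K, fun s hs t ht => ?_⟩
  rcases eq_or_ne t s with rfl | hne
  · simp
  have hr : 0 < |t - s| := abs_pos.2 (sub_ne_zero.2 hne)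
  have hr1 : |t - s| ≤ 1 := abs_le.2 ⟨by linarith [hs.2, ht.1], by linarith [hs.1, ht.2]⟩
  refine abs_le_of_sq_le_sq' ?_ (by positivity) |>.2
  refine (norm_hilbert_curve_sub_sq_le hX h0 hY hreg le_rfl hr1).trans ((hK _ ⟨hr, hr1⟩).trans ?_)
  rw [mul_pow, Real.sq_sqrt hK0, ← Real.rpow_natCast (_ ^ _), ← Real.rpow_mul hr.le]
  norm_num

lemma norm_hilbert_curve_le (hX : IsGaussianProcess X P) (h0 : ∀ t, ∫ ω, X t ω ∂P = 0)
    (hY : ∀ s t, ⟪Y s, Y t⟫_ℝ = cov[extendProcess X s, extendProcess X t; P])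
    (hreg : RegularityHypotheses 3 X P δsq) (t : ℝ) : ‖Y t‖ ≤ ‖Y 1‖ := by
  rw [hilbert_curve_projIcc hY t]
  have h := hreg.monotoneOn_variance (projIcc (0 : ℝ) 1 zero_le_one t).2
    (by simp : (1 : ℝ) ∈ Icc (0 : ℝ) 1) (projIcc (0 : ℝ) 1 zero_le_one t).2.2
  simp only [covFun_eq_inner hX h0 hY, real_inner_self_eq_norm_sq] at h
  exact abs_le_of_sq_le_sq' h (norm_nonneg _) |>.2

lemma continuous_hilbert_curve (hX : IsGaussianProcess X P) (h0 : ∀ t, ∫ ω, X t ω ∂P = 0)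
    (hY : ∀ s t, ⟪Y s, Y t⟫_ℝ = cov[extendProcess X s, extendProcess X t; P])
    (hreg : RegularityHypotheses 3 X P δsq) : Continuous Y := by
  obtain ⟨L, hL0, hL⟩ := exists_norm_hilbert_curve_sub_le hX h0 hY hreg
  have hp : Continuous fun t : ℝ => (projIcc (0 : ℝ) 1 zero_le_one t : ℝ) :=
    continuous_subtype_val.comp continuous_projIcc
  refine continuous_iff_continuousAt.2 fun s => tendsto_iff_norm_sub_tendsto_zero.2 ?_
  have hlim : Tendsto (fun t : ℝ => L * |(projIcc (0 : ℝ) 1 zero_le_one t : ℝ)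
      - projIcc (0 : ℝ) 1 zero_le_one s| ^ (1 / 6 : ℝ)) (𝓝 s) (𝓝 (L * |(projIcc (0 : ℝ) 1 zero_le_one s : ℝ)
      - projIcc (0 : ℝ) 1 zero_le_one s| ^ (1 / 6 : ℝ))) :=
    ((((hp.tendsto s).sub_const _).abs).rpow_const (Or.inr (by norm_num))).const_mul L
  rw [sub_self, abs_zero, Real.zero_rpow (by norm_num), mul_zero] at hlim
  refine squeeze_zero (fun _ => norm_nonneg _) (fun t => ?_) hlim
  rw [hilbert_curve_projIcc hY t, hilbert_curve_projIcc hY s]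
  exact hL _ (projIcc _ _ _ _).2 _ (projIcc _ _ _ _).2

end

end

/-! ### Second moment of the averaged trapezoidal error -/

section
open scoped InnerProductSpace

/-- The square of the integral is written as a double integral and exchanged with the expectation.
Absolute values are taken only after the expectation, so the cancellation in $E[T_uT_v]$ survives.
The uniform bound `hTK` justifies Fubini. -/
lemma lintegral_enorm_integral_sq_le {Ω : Type*} [MeasurableSpace Ω] {P : Measure Ω} [SFinite P]
    {T : ℝ → Ω → ℝ} (hT : Measurable fun p : ℝ × Ω => T p.1 p.2) {S : Set ℝ}
    (hS : volume S < ⊤) {K : ENNReal} (hK : K < ⊤)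
    (hTK : ∀ u v, ∫⁻ ω, ‖T u ω * T v ω‖ₑ ∂P ≤ K) :
    ∫⁻ ω, ‖∫ u in S, T u ω‖ₑ ^ 2 ∂P ≤
      ∫⁻ p in S ×ˢ S, ‖∫ ω, T p.1 ω * T p.2 ω ∂P‖ₑ := by
  set ν := (volume : Measure ℝ).restrict S with hν
  have : IsFiniteMeasure ν := ⟨by rw [hν, Measure.restrict_apply_univ]; exact hS⟩
  have hm : Measurable fun q : (ℝ × ℝ) × Ω => T q.1.1 q.2 * T q.1.2 q.2 :=
    (hT.comp ((measurable_fst.comp measurable_fst).prodMk measurable_snd)).mul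
      (hT.comp ((measurable_snd.comp measurable_fst).prodMk measurable_snd))
  have hint : Integrable (fun q : (ℝ × ℝ) × Ω => T q.1.1 q.2 * T q.1.2 q.2)
      ((ν.prod ν).prod P) := by
    refine ⟨hm.aestronglyMeasurable, ?_⟩
    rw [HasFiniteIntegral, lintegral_prod _ hm.enorm.aemeasurable]
    refine (lintegral_mono fun p : ℝ × ℝ => hTK p.1 p.2).trans_lt ?_
    rw [lintegral_const]
    exact ENNReal.mul_lt_top hK (measure_lt_top _ _)
  have hsq : ∀ ω, (∫ u, T u ω ∂ν) ^ 2 = ∫ p : ℝ × ℝ, T p.1 ω * T p.2 ω ∂(ν.prod ν) := by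
    intro ω
    rw [sq]
    exact (integral_prod_mul (μ := ν) (ν := ν) (fun u => T u ω) (fun u => T u ω)).symm
  have hi2 : Integrable (fun ω => (∫ u, T u ω ∂ν) ^ 2) P := by
    simp only [hsq]
    exact hint.integral_prod_right
  calc ∫⁻ ω, ‖∫ u, T u ω ∂ν‖ₑ ^ 2 ∂P = ∫⁻ ω, ENNReal.ofReal ((∫ u, T u ω ∂ν) ^ 2) ∂P := by
        refine lintegral_congr fun ω => ?_
        rw [← sq_abs, ENNReal.ofReal_pow (abs_nonneg _), Real.enorm_eq_ofReal_abs]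
    _ = ENNReal.ofReal (∫ ω, (∫ u, T u ω ∂ν) ^ 2 ∂P) :=
        (ofReal_integral_eq_lintegral_ofReal hi2 (ae_of_all _ fun _ => sq_nonneg _)).symm
    _ = ENNReal.ofReal (∫ p : ℝ × ℝ, ∫ ω, T p.1 ω * T p.2 ω ∂P ∂(ν.prod ν)) := by
        simp only [hsq]
        rw [integral_integral_swap]
        exact hint.swap
    _ ≤ ‖∫ p : ℝ × ℝ, ∫ ω, T p.1 ω * T p.2 ω ∂P ∂(ν.prod ν)‖ₑ := Real.ofReal_le_enorm _
    _ ≤ ∫⁻ p : ℝ × ℝ, ‖∫ ω, T p.1 ω * T p.2 ω ∂P‖ₑ ∂(ν.prod ν) := enorm_integral_le_lintegral_enorm _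
    _ = _ := by rw [hν, Measure.prod_restrict]; rfl

section
variable {Ω : Type*} [MeasurableSpace Ω] {P : Measure Ω} {X : Icc (0 : ℝ) 1 → Ω → ℝ}
  {Y : ℝ → Lp ℝ 2 P} {δsq : ℝ → ℝ} {f : ℝ → ℝ} {M : ℝ}

/-- The local error of the trapezoidal rule along the process. -/
noncomputable def pathError (f : ℝ → ℝ) (X : Icc (0 : ℝ) 1 → Ω → ℝ) (ε u : ℝ) (ω : Ω) : ℝ :=
  trapezoidError f (midpointValue X ε u ω) (increment X ε u ω)

lemma measurable_pathError (hX : Measurable fun p : Icc (0 : ℝ) 1 × Ω => X p.1 p.2)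
    (hf : ContDiff ℝ 1 f) (ε : ℝ) : Measurable fun p : ℝ × Ω => pathError f X ε p.1 p.2 := by
  have h1 := measurable_extendProcess_uncurry hX
  have h2 : Measurable fun p : ℝ × Ω => extendProcess X (p.1 + ε) p.2 :=
    h1.comp ((measurable_fst.add_const ε).prodMk measurable_snd)
  exact (continuous_trapezoidError hf).measurable.comp
    (((h2.add h1).const_mul (1 / 2 : ℝ)).prodMk (h2.sub h1))

lemma hasGaussianLaw_increment (hX : IsGaussianProcess X P) (ε u : ℝ) :
    HasGaussianLaw (increment X ε u) P :=
  (hasGaussianLaw_increments_midpoints hX ε u u).eval 0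

lemma hasGaussianLaw_midpointValue (hX : IsGaussianProcess X P) (ε u : ℝ) :
    HasGaussianLaw (midpointValue X ε u) P :=
  (hasGaussianLaw_increments_midpoints hX ε u u).eval 2

lemma variance_increment_le (hX : IsGaussianProcess X P) (h0 : ∀ t, ∫ ω, X t ω ∂P = 0)
    (hY : ∀ s t, ⟪Y s, Y t⟫_ℝ = cov[extendProcess X s, extendProcess X t; P])
    (hreg : RegularityHypotheses 3 X P δsq) {ε : ℝ} (hε : ε ∈ Ioc (0 : ℝ) 1) (u : ℝ) :
    Var[increment X ε u; P] ≤ δsq ε := by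
  rw [variance_increment hX hY]
  refine norm_hilbert_curve_sub_sq_le hX h0 hY hreg ?_ hε.2
  rw [add_sub_cancel_left, abs_of_pos hε.1]

lemma integrable_pathError_mul (hX : IsGaussianProcess X P) (hf : ContDiff ℝ 3 f)
    (h3 : ∀ x, |deriv (deriv (deriv f)) x| ≤ M) (ε u v : ℝ) :
    Integrable (fun ω => pathError f X ε u ω * pathError f X ε v ω) P :=
  integrable_trapezoidError_mul hf h3 (hasGaussianLaw_increment hX ε u)
    (hasGaussianLaw_increment hX ε v) (hasGaussianLaw_midpointValue hX ε u).aemeasurable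
    (hasGaussianLaw_midpointValue hX ε v).aemeasurable

lemma integral_pathError_mul_self_le (hX : IsGaussianProcess X P) (h0 : ∀ t, ∫ ω, X t ω ∂P = 0)
    (hY : ∀ s t, ⟪Y s, Y t⟫_ℝ = cov[extendProcess X s, extendProcess X t; P])
    (hreg : RegularityHypotheses 3 X P δsq) (hf : ContDiff ℝ 3 f)
    (h3 : ∀ x, |deriv (deriv (deriv f)) x| ≤ M) {ε : ℝ} (hε : ε ∈ Ioc (0 : ℝ) 1) (u v : ℝ) :
    |∫ ω, pathError f X ε u ω * pathError f X ε v ω ∂P|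
      ≤ M ^ 2 * gaussianMomentBound * δsq ε ^ 3 := by
  refine (abs_integral_trapezoidError_mul_le_crude hf h3 (hasGaussianLaw_increment hX ε u)
    (hasGaussianLaw_increment hX ε v) (integral_increment_eq_zero hX h0 ε u)
    (integral_increment_eq_zero hX h0 ε v)).trans ?_
  have hb := gaussianMomentBound_nonneg
  gcongr
  calc _ ≤ √(δsq ε) ^ 3 * √(δsq ε) ^ 3 := by
        gcongr
        · exact variance_increment_le hX h0 hY hreg hε u
        · exact variance_increment_le hX h0 hY hreg hε v
    _ = δsq ε ^ 3 := by
        rw [← mul_pow, Real.mul_self_sqrt (univariate_nonneg hreg ⟨hε.1.le, hε.2⟩)]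

lemma lintegral_pathError_mul_le (hX : IsGaussianProcess X P) (h0 : ∀ t, ∫ ω, X t ω ∂P = 0)
    (hY : ∀ s t, ⟪Y s, Y t⟫_ℝ = cov[extendProcess X s, extendProcess X t; P])
    (hreg : RegularityHypotheses 3 X P δsq) (hf : ContDiff ℝ 3 f)
    (h3 : ∀ x, |deriv (deriv (deriv f)) x| ≤ M) {ε : ℝ} (hε : ε ∈ Ioc (0 : ℝ) 1) (u v : ℝ) :
    ∫⁻ ω, ‖pathError f X ε u ω * pathError f X ε v ω‖ₑ ∂P
      ≤ 2 * ENNReal.ofReal (M ^ 2 * gaussianMomentBound * δsq ε ^ 3) := by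
  have key : ∀ w, ∫⁻ ω, ENNReal.ofReal (pathError f X ε w ω * pathError f X ε w ω) ∂P
      ≤ ENNReal.ofReal (M ^ 2 * gaussianMomentBound * δsq ε ^ 3) := by
    intro w
    rw [← ofReal_integral_eq_lintegral_ofReal (integrable_pathError_mul hX hf h3 ε w w)
      (ae_of_all _ fun _ => mul_self_nonneg _)]
    exact ENNReal.ofReal_le_ofReal ((le_abs_self _).trans
      (integral_pathError_mul_self_le hX h0 hY hreg hf h3 hε w w))
  have m : AEMeasurable (fun ω => ENNReal.ofReal (pathError f X ε u ω * pathError f X ε u ω)) P :=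
    (integrable_pathError_mul hX hf h3 ε u u).aestronglyMeasurable.aemeasurable.ennreal_ofReal
  calc ∫⁻ ω, ‖pathError f X ε u ω * pathError f X ε v ω‖ₑ ∂P
      ≤ ∫⁻ ω, (ENNReal.ofReal (pathError f X ε u ω * pathError f X ε u ω)
        + ENNReal.ofReal (pathError f X ε v ω * pathError f X ε v ω)) ∂P := by
        refine lintegral_mono fun ω => ?_
        simp only
        rw [← ENNReal.ofReal_add (mul_self_nonneg _) (mul_self_nonneg _),
          Real.enorm_eq_ofReal_abs]
        refine ENNReal.ofReal_le_ofReal (abs_le.2 ⟨?_, ?_⟩) <;>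
          nlinarith [sq_nonneg (pathError f X ε u ω + pathError f X ε v ω),
            sq_nonneg (pathError f X ε u ω - pathError f X ε v ω)]
    _ ≤ _ := by
        rw [lintegral_add_left' m, two_mul]
        exact add_le_add (key u) (key v)

end

end

section
open scoped InnerProductSpace

section
variable {Ω : Type*} [MeasurableSpace Ω] {P : Measure Ω} {X : Icc (0 : ℝ) 1 → Ω → ℝ}
  {Y : ℝ → Lp ℝ 2 P} {δsq : ℝ → ℝ} {f : ℝ → ℝ} {M B L : ℝ}

/-- The rectangular increment of a function of two variables over a square of side `ε`. -/
def rectIncrement (F : ℝ → ℝ → ℝ) (ε : ℝ) (p : ℝ × ℝ) : ℝ :=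
  F p.1 p.2 - F p.1 (p.2 + ε) - F (p.1 + ε) p.2 + F (p.1 + ε) (p.2 + ε)

/-- Since $Q(s,t)=\tfrac12(Q_s+Q_t-\delta^2(s,t))$, the one-variable terms drop out of a mixed
difference. -/
lemma cov_increment_eq_rectIncrement (hX : IsGaussianProcess X P)
    (h0 : ∀ t, ∫ ω, X t ω ∂P = 0)
    (hY : ∀ s t, ⟪Y s, Y t⟫_ℝ = cov[extendProcess X s, extendProcess X t; P]) (ε u v : ℝ) :
    cov[increment X ε u, increment X ε v; P]
      = -(1 / 2) * rectIncrement (canonicalMetricSq X P) ε (u, v) := by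
  rw [cov_increment_increment hX hY]
  simp only [rectIncrement, canonicalMetricSq_eq_norm hX h0 hY, norm_sub_sq_real, inner_sub_left,
    inner_sub_right]
  simp only [real_inner_comm]
  ring

lemma abs_integral_pathError_mul_le_of_separated (hX : IsGaussianProcess X P)
    (h0 : ∀ t, ∫ ω, X t ω ∂P = 0)
    (hY : ∀ s t, ⟪Y s, Y t⟫_ℝ = cov[extendProcess X s, extendProcess X t; P])
    (hreg : RegularityHypotheses 3 X P δsq) (hB : ∀ t ∈ Icc (0 : ℝ) 1, ‖Y t‖ ≤ B)
    (hL : ∀ s ∈ Icc (0 : ℝ) 1, ∀ t ∈ Icc (0 : ℝ) 1, ‖Y t - Y s‖ ≤ L * |t - s| ^ (1 / 6 : ℝ))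
    (hf : ContDiff ℝ 5 f)
    (h3 : ∀ x, |deriv (deriv (deriv f)) x| ≤ M)
    (h4 : ∀ x, |deriv (deriv (deriv (deriv f))) x| ≤ M)
    (h5 : ∀ x, |deriv (deriv (deriv (deriv (deriv f)))) x| ≤ M)
    {ε : ℝ} (hε : ε ∈ Ioc (0 : ℝ) 1) {p : ℝ × ℝ} (hp : p ∈ separatedPairs ε) :
    |∫ ω, pathError f X ε p.1 ω * pathError f X ε p.2 ω ∂P| ≤
      16 * M ^ 2 * gaussianMomentBound * δsq ε ^ 2
          * |rectIncrement (canonicalMetricSq X P) ε p|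
        + 128 * M ^ 2 * gaussianMomentBound * δsq ε ^ 2 * (3 * B * L + 4 * L ^ 2) ^ 2 * ε ^ 2
          * (p.1 ^ (-(5 / 6) : ℝ) + (p.2 - p.1) ^ (-(5 / 6) : ℝ)) ^ 2 := by
  obtain ⟨u, v⟩ := p
  obtain ⟨hu, huv, hv⟩ := hp
  simp only at hu huv hv
  have hb := gaussianMomentBound_nonneg
  have hQ := hreg.monotoneOn_variance
  have hQ' := hreg.concaveOn_variance
  have m1 := hreg.monotoneOn_right
  have c1 := hreg.concaveOn_right
  have m2 := hreg.monotoneOn_left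
  have c2 := hreg.concaveOn_or_convexOn_left
  simp only [canonicalMetricSq_eq_norm hX h0 hY, covFun_eq_inner hX h0 hY,
    real_inner_self_eq_norm_sq] at hQ hQ' m1 c1 m2 c2
  obtain ⟨r1, r2, r3, r4⟩ := abs_inner_midpoint_increment_le hB hL hQ hQ' m1 c1 m2 c2 hε.1
    (hε.1.trans_le hu) huv (by linarith [hε.1])
  set R := (3 * B * L + 4 * L ^ 2) * (ε * (u ^ (-(5 / 6) : ℝ) + (v - u) ^ (-(5 / 6) : ℝ))) with hR
  rw [← cov_midpointValue_increment hX hY] at r1 r2 r3 r4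
  have key := abs_integral_trapezoidError_mul_le hf h3 h4 h5
    (hasGaussianLaw_increments_midpoints hX ε u v) (integral_increment_eq_zero hX h0 ε u)
    (integral_increment_eq_zero hX h0 ε v) (integral_midpointValue_eq_zero hX h0 ε u)
    (integral_midpointValue_eq_zero hX h0 ε v)
    (variance_increment_le hX h0 hY hreg hε u) (variance_increment_le hX h0 hY hreg hε v)
  rw [cov_increment_eq_rectIncrement hX h0 hY, abs_mul] at key
  have sq : ∀ x : ℝ, |x| ≤ R → x ^ 2 ≤ R ^ 2 := fun x hx => sq_le_sq.2 (hx.trans (le_abs_self _))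
  refine key.trans ?_
  calc _ ≤ 32 * M ^ 2 * gaussianMomentBound * (δsq ε ^ 2 *
        (|-(1 / 2)| * |rectIncrement (canonicalMetricSq X P) ε (u, v)|
          + (R ^ 2 + R ^ 2 + R ^ 2 + R ^ 2))) := by
        have := sq _ r1
        have := sq _ r2
        have := sq _ r3
        have := sq _ r4
        gcongr
    _ = _ := by
        rw [hR, abs_of_neg (by norm_num : (-(1 / 2) : ℝ) < 0)]
        ring

lemma lintegral_separatedPairs_pathError_le (hX : IsGaussianProcess X P)
    (h0 : ∀ t, ∫ ω, X t ω ∂P = 0)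
    (hY : ∀ s t, ⟪Y s, Y t⟫_ℝ = cov[extendProcess X s, extendProcess X t; P])
    (hreg : RegularityHypotheses 3 X P δsq) (hB : ∀ t ∈ Icc (0 : ℝ) 1, ‖Y t‖ ≤ B)
    (hL : ∀ s ∈ Icc (0 : ℝ) 1, ∀ t ∈ Icc (0 : ℝ) 1, ‖Y t - Y s‖ ≤ L * |t - s| ^ (1 / 6 : ℝ))
    (hf : ContDiff ℝ 5 f)
    (h3 : ∀ x, |deriv (deriv (deriv f)) x| ≤ M)
    (h4 : ∀ x, |deriv (deriv (deriv (deriv f))) x| ≤ M)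
    (h5 : ∀ x, |deriv (deriv (deriv (deriv (deriv f)))) x| ≤ M)
    {μpos μneg : Measure (ℝ × ℝ)} (hμ : HasMixedDerivMeasure (canonicalMetricSq X P) μpos μneg)
    {ε : ℝ} (hε : ε ∈ Ioc (0 : ℝ) 1) {C : ℝ} (hC0 : 0 ≤ C)
    (hC : (μpos + μneg) (offDiagonalSimplex ε) ≤ ENNReal.ofReal (C * ε ^ (-(2 / 3) : ℝ))) :
    ∫⁻ p in separatedPairs ε, ‖∫ ω, pathError f X ε p.1 ω * pathError f X ε p.2 ω ∂P‖ₑ ≤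
      ENNReal.ofReal (M ^ 2 * gaussianMomentBound * (36 * C + 768 * (3 * B * L + 4 * L ^ 2) ^ 2)
        * δsq ε ^ 2 * (ε ^ 2 * ε ^ (-(2 / 3) : ℝ))) := by
  have hb := gaussianMomentBound_nonneg
  have hε0 := hε.1
  have hYc := continuous_hilbert_curve hX h0 hY hreg
  have hF : Continuous fun p : ℝ × ℝ => canonicalMetricSq X P p.1 p.2 := by
    simp only [canonicalMetricSq_eq_norm hX h0 hY]
    fun_prop
  have hbd : ∀ s t, |canonicalMetricSq X P s t| ≤ (2 * ‖Y 1‖) ^ 2 := by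
    intro s t
    rw [canonicalMetricSq_eq_norm hX h0 hY, abs_of_nonneg (by positivity)]
    gcongr
    have h1 := norm_hilbert_curve_le hX h0 hY hreg s
    have h2 := norm_hilbert_curve_le hX h0 hY hreg t
    linarith [norm_sub_le (Y t) (Y s)]
  have rect := lintegral_rectangular_increment_le hμ hF hbd hε0
    (hC.trans_lt ENNReal.ofReal_lt_top)
  have mrect : Measurable fun p => ENNReal.ofReal
      |rectIncrement (canonicalMetricSq X P) ε p| := by
    refine (Continuous.measurable ?_).ennreal_ofReal
    simp only [rectIncrement]
    exact ((((hF.comp (continuous_fst.prodMk continuous_snd)).sub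
      (hF.comp (continuous_fst.prodMk (continuous_snd.add continuous_const)))).sub
      (hF.comp ((continuous_fst.add continuous_const).prodMk continuous_snd))).add
      (hF.comp ((continuous_fst.add continuous_const).prodMk
        (continuous_snd.add continuous_const)))).abs
  set a := 16 * M ^ 2 * gaussianMomentBound * δsq ε ^ 2 with ha
  set b := 128 * M ^ 2 * gaussianMomentBound * δsq ε ^ 2 * (3 * B * L + 4 * L ^ 2) ^ 2 * ε ^ 2
    with hbdef
  have a0 : 0 ≤ a := by positivity
  have b0 : 0 ≤ b := by positivity
  have e0 : 0 ≤ ε ^ (-(2 / 3) : ℝ) := by positivity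
  calc _ ≤ ∫⁻ p in separatedPairs ε, (ENNReal.ofReal a *
          ENNReal.ofReal |rectIncrement (canonicalMetricSq X P) ε p| + ENNReal.ofReal b *
          ENNReal.ofReal ((p.1 ^ (-(5 / 6) : ℝ) + (p.2 - p.1) ^ (-(5 / 6) : ℝ)) ^ 2)) := by
        refine setLIntegral_mono' (isClosed_separatedPairs ε).measurableSet fun p hp => ?_
        rw [Real.enorm_eq_ofReal_abs, ← ENNReal.ofReal_mul a0, ← ENNReal.ofReal_mul b0,
          ← ENNReal.ofReal_add (by positivity) (by positivity)]
        exact ENNReal.ofReal_le_ofReal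
          (abs_integral_pathError_mul_le_of_separated hX h0 hY hreg hB hL hf h3 h4 h5 hε hp)
    _ = ENNReal.ofReal a * (∫⁻ p in separatedPairs ε,
          ENNReal.ofReal |rectIncrement (canonicalMetricSq X P) ε p|) + ENNReal.ofReal b *
        ∫⁻ p in separatedPairs ε,
          ENNReal.ofReal ((p.1 ^ (-(5 / 6) : ℝ) + (p.2 - p.1) ^ (-(5 / 6) : ℝ)) ^ 2) := by
        rw [lintegral_add_left (mrect.const_mul _), lintegral_const_mul' _ _ ENNReal.ofReal_ne_top,
          lintegral_const_mul' _ _ ENNReal.ofReal_ne_top]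
    _ ≤ ENNReal.ofReal a * (ENNReal.ofReal (9 / 4 * ε ^ 2) *
          ENNReal.ofReal (C * ε ^ (-(2 / 3) : ℝ)))
        + ENNReal.ofReal b * ENNReal.ofReal (6 * ε ^ (-(2 / 3) : ℝ)) := by
        gcongr
        · exact rect.trans (by gcongr)
        · exact lintegral_separatedPairs_rpow_le hε0
    _ = ENNReal.ofReal (a * ((9 / 4 * ε ^ 2) * (C * ε ^ (-(2 / 3) : ℝ)))
        + b * (6 * ε ^ (-(2 / 3) : ℝ))) := by
        rw [← ENNReal.ofReal_mul (by positivity), ← ENNReal.ofReal_mul a0,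
          ← ENNReal.ofReal_mul b0, ← ENNReal.ofReal_add (by positivity) (by positivity)]
    _ = _ := by
        congr 1
        rw [ha, hbdef]
        ring

/-- The square is covered by the separated pairs, their mirror image, which contributes equally by
symmetry, and an exceptional set of area $O(\varepsilon)$ on which the crude bound suffices. -/
lemma lintegral_unitSquare_pathError_le (hX : IsGaussianProcess X P)
    (h0 : ∀ t, ∫ ω, X t ω ∂P = 0)
    (hY : ∀ s t, ⟪Y s, Y t⟫_ℝ = cov[extendProcess X s, extendProcess X t; P])
    (hreg : RegularityHypotheses 3 X P δsq) (hB : ∀ t ∈ Icc (0 : ℝ) 1, ‖Y t‖ ≤ B)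
    (hL : ∀ s ∈ Icc (0 : ℝ) 1, ∀ t ∈ Icc (0 : ℝ) 1, ‖Y t - Y s‖ ≤ L * |t - s| ^ (1 / 6 : ℝ))
    (hf : ContDiff ℝ 5 f)
    (h3 : ∀ x, |deriv (deriv (deriv f)) x| ≤ M)
    (h4 : ∀ x, |deriv (deriv (deriv (deriv f))) x| ≤ M)
    (h5 : ∀ x, |deriv (deriv (deriv (deriv (deriv f)))) x| ≤ M)
    {μpos μneg : Measure (ℝ × ℝ)} (hμ : HasMixedDerivMeasure (canonicalMetricSq X P) μpos μneg)
    {ε : ℝ} (hε : ε ∈ Ioc (0 : ℝ) 1) {C : ℝ} (hC0 : 0 ≤ C)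
    (hC : (μpos + μneg) (offDiagonalSimplex ε) ≤ ENNReal.ofReal (C * ε ^ (-(2 / 3) : ℝ))) :
    ∫⁻ p in Icc (0 : ℝ) 1 ×ˢ Icc (0 : ℝ) 1,
        ‖∫ ω, pathError f X ε p.1 ω * pathError f X ε p.2 ω ∂P‖ₑ ≤
      ENNReal.ofReal (M ^ 2 * gaussianMomentBound * (12 * (δsq ε ^ 3 * ε)
        + (72 * C + 1536 * (3 * B * L + 4 * L ^ 2) ^ 2)
          * (δsq ε ^ 2 * (ε ^ 2 * ε ^ (-(2 / 3) : ℝ))))) := by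
  have hb := gaussianMomentBound_nonneg
  have hε0 := hε.1
  have hδ := univariate_nonneg hreg ⟨hε.1.le, hε.2⟩
  set Ψ : ℝ × ℝ → ENNReal :=
    fun p => ‖∫ ω, pathError f X ε p.1 ω * pathError f X ε p.2 ω ∂P‖ₑ with hΨ
  have hsymm : ∀ p, Ψ p.swap = Ψ p := fun p => by
    simp only [hΨ, Prod.fst_swap, Prod.snd_swap, mul_comm]
  set bad := {p : ℝ × ℝ | p ∈ Icc (0 : ℝ) 1 ×ˢ Icc (0 : ℝ) 1 ∧ p ∉ separatedPairs ε ∧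
      p.swap ∉ separatedPairs ε} with hbad
  have hcov : Icc (0 : ℝ) 1 ×ˢ Icc (0 : ℝ) 1 ⊆
      bad ∪ (separatedPairs ε ∪ Prod.swap ⁻¹' separatedPairs ε) := by
    intro p hp
    by_cases h1 : p ∈ separatedPairs ε
    · exact Or.inr (Or.inl h1)
    · by_cases h2 : p.swap ∈ separatedPairs ε
      · exact Or.inr (Or.inr h2)
      · exact Or.inl ⟨hp, h1, h2⟩
  have hswap : ∫⁻ p in Prod.swap ⁻¹' separatedPairs ε, Ψ p = ∫⁻ p in separatedPairs ε, Ψ p := by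
    have hmp : MeasurePreserving (Prod.swap : ℝ × ℝ → ℝ × ℝ) volume volume :=
      Measure.measurePreserving_swap
    have := hmp.setLIntegral_comp_preimage_emb MeasurableEquiv.prodComm.measurableEmbedding Ψ
      (separatedPairs ε)
    rw [← this]
    simp only [hsymm]
  have hsep := lintegral_separatedPairs_pathError_le hX h0 hY hreg hB hL hf h3 h4 h5 hμ hε hC0 hC
  have hbadI : ∫⁻ p in bad, Ψ p ≤
      ENNReal.ofReal (M ^ 2 * gaussianMomentBound * δsq ε ^ 3) * ENNReal.ofReal (12 * ε) := by
    calc _ ≤ ∫⁻ _ in bad, ENNReal.ofReal (M ^ 2 * gaussianMomentBound * δsq ε ^ 3) := by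
          refine lintegral_mono fun p => ?_
          simp only [hΨ]
          rw [Real.enorm_eq_ofReal_abs]
          exact ENNReal.ofReal_le_ofReal (integral_pathError_mul_self_le hX h0 hY hreg
            (hf.of_le (by norm_num)) h3 hε _ _)
      _ ≤ _ := by
          rw [setLIntegral_const]
          gcongr
          exact volume_not_separatedPairs_le hε0
  have e0 : 0 ≤ ε ^ (-(2 / 3) : ℝ) := by positivity
  calc _ ≤ ∫⁻ p in bad ∪ (separatedPairs ε ∪ Prod.swap ⁻¹' separatedPairs ε), Ψ p :=
        lintegral_mono_set hcov
    _ ≤ (∫⁻ p in bad, Ψ p) + ((∫⁻ p in separatedPairs ε, Ψ p)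
        + ∫⁻ p in Prod.swap ⁻¹' separatedPairs ε, Ψ p) :=
        (lintegral_union_le _ _ _).trans (by gcongr; exact lintegral_union_le _ _ _)
    _ ≤ _ := by
        rw [hswap]
        refine (add_le_add hbadI (add_le_add hsep hsep)).trans ?_
        rw [← ENNReal.ofReal_mul (by positivity), ← ENNReal.ofReal_add (by positivity)
          (by positivity), ← ENNReal.ofReal_add (by positivity) (by positivity)]
        refine ENNReal.ofReal_le_ofReal (le_of_eq ?_)
        ring

end

end

section
open scoped InnerProductSpace

section
variable {Ω : Type*} [MeasurableSpace Ω] {P : Measure Ω} {X : Icc (0 : ℝ) 1 → Ω → ℝ}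
  {δsq : ℝ → ℝ} {f : ℝ → ℝ} {M : ℝ}

lemma aestronglyMeasurable_average [SFinite P] {T : ℝ → Ω → ℝ}
    (hT : Measurable fun p : ℝ × Ω => T p.1 p.2) (ε a b : ℝ) :
    AEStronglyMeasurable (fun ω => 1 / ε * ∫ u in a..b, T u ω) P := by
  have h : StronglyMeasurable fun p : Ω × ℝ => T p.2 p.1 := (hT.comp measurable_swap).stronglyMeasurable
  simp only [intervalIntegral]
  exact ((h.integral_prod_right (ν := volume.restrict (Ioc a b))).sub
    (h.integral_prod_right (ν := volume.restrict (Ioc b a)))).aestronglyMeasurable.const_mul _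

/-- After division by $\varepsilon^2$, both contributions are powers of the ratio
$\delta^2(\varepsilon)\varepsilon^{-1/3}$, which tends to 0 by assumption: the cube comes from the
exceptional set, the square from the separated pairs. -/
lemma exists_lintegral_average_pathError_le [IsProbabilityMeasure P]
    (hXm : Measurable fun p : Icc (0 : ℝ) 1 × Ω => X p.1 p.2)
    (hX : IsGaussianProcess X P) (h0 : ∀ t, ∫ ω, X t ω ∂P = 0)
    (hreg : RegularityHypotheses 3 X P δsq) (hf : ContDiff ℝ 5 f)
    (h3 : ∀ x, |deriv (deriv (deriv f)) x| ≤ M)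
    (h4 : ∀ x, |deriv (deriv (deriv (deriv f))) x| ≤ M)
    (h5 : ∀ x, |deriv (deriv (deriv (deriv (deriv f)))) x| ≤ M)
    {t : ℝ} (ht : t ∈ Icc (0 : ℝ) 1) :
    ∃ c : ℝ, ∀ᶠ ε : ℝ in 𝓝[>] 0,
      ∫⁻ ω, ‖1 / ε * ∫ u in (0 : ℝ)..t, pathError f X ε u ω‖ₑ ^ 2 ∂P ≤
        ENNReal.ofReal (M ^ 2 * gaussianMomentBound * (12 * (δsq ε * ε ^ (-(1 / 3) : ℝ)) ^ 3
          + c * (δsq ε * ε ^ (-(1 / 3) : ℝ)) ^ 2)) := by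
  obtain ⟨Y, hY⟩ := exists_hilbert_curve hX h0
  obtain ⟨L, -, hL⟩ := exists_norm_hilbert_curve_sub_le hX h0 hY hreg
  have hB : ∀ t ∈ Icc (0 : ℝ) 1, ‖Y t‖ ≤ ‖Y 1‖ := fun t _ => norm_hilbert_curve_le hX h0 hY hreg t
  obtain ⟨μpos, μneg, hμ, C, hC⟩ := hreg.mixed_deriv
  refine ⟨72 * |C| + 1536 * (3 * ‖Y 1‖ * L + 4 * L ^ 2) ^ 2, ?_⟩
  filter_upwards [hC, Ioc_mem_nhdsGT (zero_lt_one (α := ℝ))] with ε hCε hε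
  have hε0 := hε.1
  have hf3 : ContDiff ℝ 3 f := hf.of_le (by norm_num)
  have hC' : (μpos + μneg) (offDiagonalSimplex ε) ≤
      ENNReal.ofReal (|C| * ε ^ (-(2 / 3) : ℝ)) := by
    refine hCε.trans (ENNReal.ofReal_le_ofReal ?_)
    have : (-(((3 : ℕ) : ℝ) - 1) / ((3 : ℕ) : ℝ)) = -(2 / 3) := by norm_num
    rw [this]
    gcongr
    exact le_abs_self C
  have main := (lintegral_enorm_integral_sq_le (P := P)
    (measurable_pathError hXm (hf.of_le (by norm_num)) ε) (S := Ioc 0 t) (by simp)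
    (ENNReal.mul_lt_top (by simp) ENNReal.ofReal_lt_top)
    (lintegral_pathError_mul_le hX h0 hY hreg hf3 h3 hε)).trans
    ((lintegral_mono_set (prod_mono (Ioc_subset_Icc_self.trans (Icc_subset_Icc_right ht.2))
      (Ioc_subset_Icc_self.trans (Icc_subset_Icc_right ht.2)))).trans
    (lintegral_unitSquare_pathError_le hX h0 hY hreg hB hL hf h3 h4 h5 hμ hε (abs_nonneg C) hC'))
  simp only [intervalIntegral.integral_of_le ht.1, enorm_mul, mul_pow]
  rw [lintegral_const_mul' _ _ (by simp)]
  refine (mul_le_mul_right main _).trans (le_of_eq ?_)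
  rw [Real.enorm_of_nonneg (by positivity), ← ENNReal.ofReal_pow (by positivity),
    ← ENNReal.ofReal_mul (by positivity)]
  congr 1
  have e1 : (ε ^ (-(1 / 3) : ℝ)) ^ 3 = ε⁻¹ := by
    rw [← Real.rpow_natCast, ← Real.rpow_mul hε0.le, ← Real.rpow_neg_one]; norm_num
  have e2 : (ε ^ (-(1 / 3) : ℝ)) ^ 2 = ε ^ (-(2 / 3) : ℝ) := by
    rw [← Real.rpow_natCast, ← Real.rpow_mul hε0.le]; norm_num
  rw [e1, e2]
  field_simp

lemma tendstoInMeasure_average_pathError [IsProbabilityMeasure P]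
    (hXm : Measurable fun p : Icc (0 : ℝ) 1 × Ω => X p.1 p.2)
    (hX : IsGaussianProcess X P) (h0 : ∀ t, ∫ ω, X t ω ∂P = 0)
    (hreg : RegularityHypotheses 3 X P δsq) (hf : ContDiff ℝ 5 f)
    (h3 : ∀ x, |deriv (deriv (deriv f)) x| ≤ M)
    (h4 : ∀ x, |deriv (deriv (deriv (deriv f))) x| ≤ M)
    (h5 : ∀ x, |deriv (deriv (deriv (deriv (deriv f)))) x| ≤ M)
    {t : ℝ} (ht : t ∈ Icc (0 : ℝ) 1) :
    TendstoInMeasure P (fun (ε : ℝ) ω => 1 / ε * ∫ u in (0 : ℝ)..t, pathError f X ε u ω)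
      (𝓝[>] 0) 0 := by
  obtain ⟨c, hc⟩ := exists_lintegral_average_pathError_le hXm hX h0 hreg hf h3 h4 h5 ht
  refine tendstoInMeasure_of_tendsto_eLpNorm two_ne_zero (fun ε => aestronglyMeasurable_average
    (measurable_pathError hXm (hf.of_le (by norm_num)) ε) ε 0 t) aestronglyMeasurable_zero ?_
  simp only [sub_zero]
  have hx := univariate_isLittleO hreg
  have hlim : Tendsto (fun ε => ENNReal.ofReal (M ^ 2 * gaussianMomentBound *
      (12 * (δsq ε * ε ^ (-(1 / 3) : ℝ)) ^ 3 + c * (δsq ε * ε ^ (-(1 / 3) : ℝ)) ^ 2)))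
      (𝓝[>] 0) (𝓝 0) := by
    have := ENNReal.tendsto_ofReal ((((hx.pow 3).const_mul 12).add ((hx.pow 2).const_mul c)).const_mul
      (M ^ 2 * gaussianMomentBound))
    simpa using this
  have h2 := tendsto_of_tendsto_of_tendsto_of_le_of_le' tendsto_const_nhds hlim
    (Eventually.of_forall fun _ => zero_le) hc
  have h4 := Tendsto.ennrpow_const (1 / 2 : ℝ) h2
  rw [ENNReal.zero_rpow_of_pos (by norm_num)] at h4
  refine h4.congr fun ε => ?_
  rw [eLpNorm_eq_lintegral_rpow_enorm_toReal two_ne_zero ENNReal.ofNat_ne_top]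
  simp

end

end

/-! ### An integrable bound for the paths by dyadic chaining -/

section
open scoped InnerProductSpace

/-- A Young-type substitute for a maximum: summing the powers over an index set bounds all members
at once, linearly in their moments and without taking roots. -/
lemma le_add_pow_div_pow {x c : ℝ} (hx : 0 ≤ x) (hc : 0 < c) (n : ℕ) :
    x ≤ c + (c⁻¹) ^ n * x ^ (n + 1) := by
  rcases le_total x c with h | h
  · have : 0 ≤ (c⁻¹) ^ n * x ^ (n + 1) := by positivity
    linarith
  · have : 1 ≤ (c⁻¹ * x) ^ n := one_le_pow₀ (by rw [inv_mul_eq_div, le_div_iff₀ hc]; linarith)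
    rw [pow_succ, ← mul_assoc, ← mul_pow]
    nlinarith

/-- The dyadic point of level `n` just below `u`. -/
noncomputable def dyadicFloor (n : ℕ) (u : ℝ) : ℝ := ⌊u * 2 ^ n⌋₊ / 2 ^ n

lemma dyadicFloor_mem {u : ℝ} (hu : u ∈ Icc (0 : ℝ) 1) (n : ℕ) :
    dyadicFloor n u ∈ Icc (0 : ℝ) 1 ∧ |u - dyadicFloor n u| ≤ (1 / 2) ^ n := by
  have h1 : (⌊u * 2 ^ n⌋₊ : ℝ) ≤ u * 2 ^ n := Nat.floor_le (mul_nonneg hu.1 (by positivity))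
  have h2 : u * 2 ^ n < ⌊u * 2 ^ n⌋₊ + 1 := Nat.lt_floor_add_one _
  have hp : (0 : ℝ) < 2 ^ n := by positivity
  have h3 : dyadicFloor n u ≤ u := by rw [dyadicFloor, div_le_iff₀ hp]; exact h1
  refine ⟨⟨by unfold dyadicFloor; positivity, h3.trans hu.2⟩, ?_⟩
  rw [abs_of_nonneg (by linarith), dyadicFloor, one_div, inv_pow, ← one_div, sub_le_iff_le_add,
    ← add_div, le_div_iff₀ hp]
  linarith

/-- Doubling a number doubles its integer part, up to adding 1. Consecutive approximations are
therefore equal or the endpoints of one interval of the finer grid. -/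
lemma dyadicFloor_succ {u : ℝ} (hu : u ∈ Icc (0 : ℝ) 1) (n : ℕ) :
    dyadicFloor (n + 1) u = dyadicFloor n u ∨ ∃ j : ℕ, j < 2 ^ (n + 1) ∧
      dyadicFloor n u = (j : ℝ) / 2 ^ (n + 1) ∧
      dyadicFloor (n + 1) u = ((j : ℝ) + 1) / 2 ^ (n + 1) := by
  have hpos : 0 ≤ u * 2 ^ n := mul_nonneg hu.1 (by positivity)
  have h1 : (⌊u * 2 ^ n⌋₊ : ℝ) ≤ u * 2 ^ n := Nat.floor_le hpos
  have h2 : u * 2 ^ n < ⌊u * 2 ^ n⌋₊ + 1 := Nat.lt_floor_add_one _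
  have e : u * 2 ^ (n + 1) = 2 * (u * 2 ^ n) := by ring
  have hle : 2 * ⌊u * 2 ^ n⌋₊ ≤ ⌊u * 2 ^ (n + 1)⌋₊ := by
    rw [Nat.le_floor_iff (by rw [e]; positivity), e]; push_cast; linarith
  have hlt : ⌊u * 2 ^ (n + 1)⌋₊ < 2 * ⌊u * 2 ^ n⌋₊ + 2 := by
    rw [Nat.floor_lt (by rw [e]; positivity), e]; push_cast; linarith
  have htop : ⌊u * 2 ^ (n + 1)⌋₊ ≤ 2 ^ (n + 1) := by
    rw [← Nat.cast_le (α := ℝ)]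
    refine (Nat.floor_le (by rw [e]; positivity)).trans ?_
    push_cast
    nlinarith [hu.2, pow_pos (zero_lt_two (α := ℝ)) (n + 1)]
  have heq : dyadicFloor n u = ((2 * ⌊u * 2 ^ n⌋₊ : ℕ) : ℝ) / 2 ^ (n + 1) := by
    rw [dyadicFloor, pow_succ]; push_cast; field_simp
  have hcase : ⌊u * 2 ^ (n + 1)⌋₊ = 2 * ⌊u * 2 ^ n⌋₊ ∨
      ⌊u * 2 ^ (n + 1)⌋₊ = 2 * ⌊u * 2 ^ n⌋₊ + 1 := by omega
  rcases hcase with h | h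
  · left
    rw [heq, dyadicFloor, h]
  · refine Or.inr ⟨2 * ⌊u * 2 ^ n⌋₊, by rw [h] at htop; exact htop, heq, ?_⟩
    rw [dyadicFloor, h]
    push_cast
    ring

/-- A majorant of the dyadic increments of level `n + 1` of the function `x`. -/
noncomputable def dyadicMajorant (x : ℝ → ℝ) (n : ℕ) : ℝ :=
  (19 / 20) ^ n + (((19 / 20) ^ n)⁻¹) ^ 11 *
    ∑ j ∈ Finset.range (2 ^ (n + 1)), |x (((j : ℝ) + 1) / 2 ^ (n + 1)) - x (j / 2 ^ (n + 1))| ^ 12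

lemma dyadicMajorant_nonneg (x : ℝ → ℝ) (n : ℕ) : 0 ≤ dyadicMajorant x n := by
  unfold dyadicMajorant; positivity

lemma abs_dyadicFloor_succ_sub_le (x : ℝ → ℝ) {u : ℝ} (hu : u ∈ Icc (0 : ℝ) 1) (n : ℕ) :
    |x (dyadicFloor (n + 1) u) - x (dyadicFloor n u)| ≤ dyadicMajorant x n := by
  rcases dyadicFloor_succ hu n with h | ⟨j, hj, h1, h2⟩
  · rw [h, sub_self, abs_zero]
    exact dyadicMajorant_nonneg x n
  · rw [h1, h2]
    refine (le_add_pow_div_pow (abs_nonneg _) (by positivity : (0 : ℝ) < (19 / 20) ^ n) 11).trans ?_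
    unfold dyadicMajorant
    gcongr
    exact Finset.single_le_sum (s := Finset.range (2 ^ (n + 1))) (f := fun j : ℕ =>
      |x (((j : ℝ) + 1) / 2 ^ (n + 1)) - x (j / 2 ^ (n + 1))| ^ 12)
      (fun _ _ => by positivity) (Finset.mem_range.2 hj)

lemma abs_dyadicFloor_le (x : ℝ → ℝ) {u : ℝ} (hu : u ∈ Icc (0 : ℝ) 1) (n : ℕ) :
    |x (dyadicFloor n u)| ≤ |x (dyadicFloor 0 u)| + ∑ k ∈ Finset.range n, dyadicMajorant x k := by
  induction n with
  | zero => simp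
  | succ n ih =>
    rw [Finset.sum_range_succ]
    have h1 := abs_dyadicFloor_succ_sub_le x hu n
    have h2 := abs_sub_abs_le_abs_sub (x (dyadicFloor (n + 1) u)) (x (dyadicFloor n u))
    linarith

lemma abs_dyadicFloor_zero_le (x : ℝ → ℝ) {u : ℝ} (hu : u ∈ Icc (0 : ℝ) 1) :
    |x (dyadicFloor 0 u)| ≤ |x 0| + |x 1| := by
  have h : ⌊u⌋₊ ≤ 1 := by
    rw [← Nat.cast_le (α := ℝ)]; exact (Nat.floor_le hu.1).trans (by simpa using hu.2)
  have : ⌊u⌋₊ = 0 ∨ ⌊u⌋₊ = 1 := by omega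
  rcases this with h | h <;> simp [dyadicFloor, h]

/-- A random variable dominating all values of the process at dyadic times. -/
noncomputable def pathMajorant (x : ℝ → ℝ) : ENNReal :=
  ENNReal.ofReal (|x 0| + |x 1|) + ∑' n, ENNReal.ofReal (dyadicMajorant x n)

lemma enorm_dyadicFloor_le (x : ℝ → ℝ) {u : ℝ} (hu : u ∈ Icc (0 : ℝ) 1) (n : ℕ) :
    ‖x (dyadicFloor n u)‖ₑ ≤ pathMajorant x := by
  rw [Real.enorm_eq_ofReal_abs]
  refine (ENNReal.ofReal_le_ofReal ((abs_dyadicFloor_le x hu n).trans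
    (add_le_add_left (abs_dyadicFloor_zero_le x hu) _))).trans ?_
  rw [ENNReal.ofReal_add (by positivity)
    (Finset.sum_nonneg fun k _ => dyadicMajorant_nonneg x k),
    ENNReal.ofReal_sum_of_nonneg fun k _ => dyadicMajorant_nonneg x k, pathMajorant]
  gcongr
  exact ENNReal.sum_le_tsum _

section
variable {Ω : Type*} [MeasurableSpace Ω] {P : Measure Ω} {X : Icc (0 : ℝ) 1 → Ω → ℝ}
  {Y : ℝ → Lp ℝ 2 P} {L : ℝ} {δsq : ℝ → ℝ}

lemma measurable_extendProcess (hX : Measurable fun p : Icc (0 : ℝ) 1 × Ω => X p.1 p.2) (t : ℝ) :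
    Measurable (extendProcess X t) :=
  (measurable_extendProcess_uncurry hX).comp (measurable_const.prodMk measurable_id)

lemma measurable_dyadicMajorant (hX : Measurable fun p : Icc (0 : ℝ) 1 × Ω => X p.1 p.2) (n : ℕ) :
    Measurable fun ω => dyadicMajorant (fun t => extendProcess X t ω) n := by
  have := measurable_extendProcess hX
  unfold dyadicMajorant
  fun_prop

lemma measurable_pathMajorant (hX : Measurable fun p : Icc (0 : ℝ) 1 × Ω => X p.1 p.2) :
    Measurable fun ω => pathMajorant fun t => extendProcess X t ω := by
  have h1 := measurable_extendProcess hX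
  have h2 := fun n => (measurable_dyadicMajorant hX n).ennreal_ofReal
  unfold pathMajorant
  exact Measurable.add (by fun_prop) (Measurable.tsum h2)

/-- Hölder exponent $1/6$ in $L^2$ makes the twelfth moment quadratic in the distance. Its sum over
the dyadic intervals of one level then decays geometrically. -/
lemma integral_abs_sub_pow_le (hX : IsGaussianProcess X P) (h0 : ∀ t, ∫ ω, X t ω ∂P = 0)
    (hY : ∀ s t, ⟪Y s, Y t⟫_ℝ = cov[extendProcess X s, extendProcess X t; P])
    (hL : ∀ s ∈ Icc (0 : ℝ) 1, ∀ t ∈ Icc (0 : ℝ) 1, ‖Y t - Y s‖ ≤ L * |t - s| ^ (1 / 6 : ℝ))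
    {s t : ℝ} (hs : s ∈ Icc (0 : ℝ) 1) (ht : t ∈ Icc (0 : ℝ) 1) :
    Integrable (fun ω => |(extendProcess X t ω) - extendProcess X s ω| ^ 12) P ∧
    ∫ ω, |(extendProcess X t ω) - extendProcess X s ω| ^ 12 ∂P
      ≤ gaussianMomentBound * L ^ 12 * |t - s| ^ 2 := by
  have hG := hasGaussianLaw_increment hX (t - s) s
  have hi := (memLp_abs_pow_of_hasGaussianLaw hG 12)
  have hm := integral_abs_pow_of_hasGaussianLaw hG (integral_increment_eq_zero hX h0 _ _) 12
  have hp := hX.isProbabilityMeasure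
  rw [variance_increment hX hY, Real.sqrt_sq (norm_nonneg _)] at hm
  simp only [increment, add_sub_cancel] at hm hi
  refine ⟨hi.integrable (by norm_num), ?_⟩
  rw [hm]
  have h12 := pow_le_pow_left₀ (norm_nonneg _) (hL s hs t ht) 12
  rw [mul_pow, ← Real.rpow_natCast (_ ^ _), ← Real.rpow_mul (abs_nonneg _)] at h12
  norm_num at h12
  calc _ ≤ L ^ 12 * (t - s) ^ 2 * gaussianMomentBound := by
        gcongr
        · exact gaussianAbsMoment_nonneg _
        · exact gaussianAbsMoment_le (by norm_num)
    _ = _ := by rw [sq_abs]; ring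

lemma lintegral_dyadicMajorant_le (hX : IsGaussianProcess X P) (h0 : ∀ t, ∫ ω, X t ω ∂P = 0)
    (hY : ∀ s t, ⟪Y s, Y t⟫_ℝ = cov[extendProcess X s, extendProcess X t; P])
    (hL : ∀ s ∈ Icc (0 : ℝ) 1, ∀ t ∈ Icc (0 : ℝ) 1, ‖Y t - Y s‖ ≤ L * |t - s| ^ (1 / 6 : ℝ))
    (n : ℕ) :
    ∫⁻ ω, ENNReal.ofReal (dyadicMajorant (fun t => extendProcess X t ω) n) ∂P ≤
      ENNReal.ofReal ((1 + gaussianMomentBound * L ^ 12) * (19 / 20) ^ n) := by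
  have hp := hX.isProbabilityMeasure
  have hb := gaussianMomentBound_nonneg
  have hmem : ∀ j : ℕ, j ≤ 2 ^ (n + 1) → (j : ℝ) / 2 ^ (n + 1) ∈ Icc (0 : ℝ) 1 := fun j hj =>
    ⟨by positivity, by rw [div_le_one (by positivity)]; exact_mod_cast hj⟩
  have key : ∀ j ∈ Finset.range (2 ^ (n + 1)), _ := fun j hj =>
    integral_abs_sub_pow_le hX h0 hY hL (hmem j (Finset.mem_range.1 hj).le)
      (by simpa using hmem (j + 1) (Finset.mem_range.1 hj))
  have hint : Integrable (fun ω => dyadicMajorant (fun t => extendProcess X t ω) n) P := by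
    unfold dyadicMajorant
    exact (integrable_const _).add ((integrable_finsetSum _ fun j hj => (key j hj).1).const_mul _)
  rw [← ofReal_integral_eq_lintegral_ofReal hint (ae_of_all _ fun _ => dyadicMajorant_nonneg _ _)]
  refine ENNReal.ofReal_le_ofReal ?_
  unfold dyadicMajorant
  rw [integral_add (integrable_const _)
    ((integrable_finsetSum _ fun j hj => (key j hj).1).const_mul _), integral_const_mul,
    integral_finsetSum _ fun j hj => (key j hj).1]
  have hsum : ∑ j ∈ Finset.range (2 ^ (n + 1)), ∫ ω,
      |(extendProcess X (((j : ℝ) + 1) / 2 ^ (n + 1)) ω)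
      - extendProcess X (j / 2 ^ (n + 1)) ω| ^ 12 ∂P ≤
      gaussianMomentBound * L ^ 12 * (1 / 2) ^ n := by
    refine (Finset.sum_le_sum fun j hj => (key j hj).2).trans ?_
    have e : ∀ j : ℕ, ((j : ℝ) + 1) / 2 ^ (n + 1) - j / 2 ^ (n + 1) = 1 / 2 ^ (n + 1) :=
      fun j => by ring
    simp only [e, sq_abs]
    rw [Finset.sum_const, Finset.card_range, nsmul_eq_mul]
    push_cast
    rw [show (2 : ℝ) ^ (n + 1) * (gaussianMomentBound * L ^ 12 * (1 / 2 ^ (n + 1)) ^ 2)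
      = gaussianMomentBound * L ^ 12 * (1 / 2 ^ (n + 1)) by field_simp]
    gcongr
    rw [one_div_pow]
    gcongr <;> norm_num
  -- The ratio $19/20$ is close enough to 1 that $(19/20)^{12}\ge1/2$, so the inverse eleventh power
  -- is beaten by the decay $2^{-n}$ of the moments, and the majorants remain summable.
  have hq : (((19 / 20 : ℝ) ^ n)⁻¹) ^ 11 * (1 / 2) ^ n ≤ (19 / 20) ^ n := by
    rw [← inv_pow, ← pow_mul, mul_comm n 11, pow_mul, ← mul_pow]
    exact pow_le_pow_left₀ (by norm_num) (by norm_num) n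
  calc _ ≤ (19 / 20 : ℝ) ^ n + (((19 / 20 : ℝ) ^ n)⁻¹) ^ 11 *
        (gaussianMomentBound * L ^ 12 * (1 / 2) ^ n) := by
        simp only [integral_const, probReal_univ, one_smul]
        gcongr
    _ = (19 / 20 : ℝ) ^ n + gaussianMomentBound * L ^ 12 *
        ((((19 / 20 : ℝ) ^ n)⁻¹) ^ 11 * (1 / 2) ^ n) := by ring
    _ ≤ (19 / 20 : ℝ) ^ n + gaussianMomentBound * L ^ 12 * (19 / 20) ^ n := by gcongr
    _ = _ := by ring

lemma lintegral_pathMajorant_lt_top (hXm : Measurable fun p : Icc (0 : ℝ) 1 × Ω => X p.1 p.2)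
    (hX : IsGaussianProcess X P) (h0 : ∀ t, ∫ ω, X t ω ∂P = 0)
    (hreg : RegularityHypotheses 3 X P δsq) :
    ∫⁻ ω, pathMajorant (fun t => extendProcess X t ω) ∂P < ⊤ := by
  obtain ⟨Y, hY⟩ := exists_hilbert_curve hX h0
  obtain ⟨L, -, hL⟩ := exists_norm_hilbert_curve_sub_le hX h0 hY hreg
  have hb := gaussianMomentBound_nonneg
  have h1 := measurable_extendProcess hXm
  unfold pathMajorant
  rw [lintegral_add_left (by fun_prop), lintegral_tsum fun n =>
    (measurable_dyadicMajorant hXm n).ennreal_ofReal.aemeasurable]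
  refine ENNReal.add_lt_top.2 ⟨?_, ?_⟩
  · have i := fun t => ((isGaussianProcess_extendProcess hX).hasGaussianLaw_eval t).integrable
    exact ((i 0).abs.add (i 1).abs).lintegral_lt_top
  · refine (ENNReal.tsum_le_tsum fun n =>
      lintegral_dyadicMajorant_le hX h0 hY hL n).trans_lt ?_
    rw [← ENNReal.ofReal_tsum_of_nonneg (fun n => by positivity)
      ((summable_geometric_of_lt_one (by norm_num) (by norm_num)).mul_left _)]
    exact ENNReal.ofReal_lt_top

lemma lintegral_enorm_sub_le (hX : IsGaussianProcess X P)
    (hY : ∀ s t, ⟪Y s, Y t⟫_ℝ = cov[extendProcess X s, extendProcess X t; P])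
    (h0 : ∀ t, ∫ ω, X t ω ∂P = 0) (s t : ℝ) :
    ∫⁻ ω, ‖(extendProcess X t ω) - extendProcess X s ω‖ₑ ∂P ≤ ENNReal.ofReal ‖Y t - Y s‖ := by
  have hp := hX.isProbabilityMeasure
  have m : MemLp (fun ω => extendProcess X t ω - extendProcess X s ω) 2 P :=
    ((isGaussianProcess_extendProcess hX).hasGaussianLaw_eval t).memLp_two.sub
    ((isGaussianProcess_extendProcess hX).hasGaussianLaw_eval s).memLp_two
  have hi := m.integrable (by norm_num)
  have h := integral_mul_le_sqrt_mul_sqrt (P := P) m.abs (memLp_const (1 : ℝ))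
    (fun _ => abs_nonneg _) (fun _ => zero_le_one)
  have hd := canonicalMetricSq_eq_norm hX h0 hY s t
  simp only [Pi.abs_apply, mul_one, sq_abs, one_pow, integral_const, probReal_univ, one_smul, Real.sqrt_one] at h
  rw [canonicalMetricSq] at hd
  rw [hd, Real.sqrt_sq (norm_nonneg _)] at h
  simp only [Real.enorm_eq_ofReal_abs]
  rw [← ofReal_integral_eq_lintegral_ofReal hi.abs (ae_of_all _ fun _ => abs_nonneg _)]
  exact ENNReal.ofReal_le_ofReal h

/-- No path continuity is available. At a fixed time, the dyadic values obey the bound and converge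
to $X_u$ in $L^1$, so the expected excess of $|X_u|$ over the majorant is zero. -/
lemma ae_enorm_extendProcess_le (hXm : Measurable fun p : Icc (0 : ℝ) 1 × Ω => X p.1 p.2)
    (hX : IsGaussianProcess X P) (h0 : ∀ t, ∫ ω, X t ω ∂P = 0)
    (hreg : RegularityHypotheses 3 X P δsq) (u : ℝ) :
    ∀ᵐ ω ∂P, ‖(extendProcess X u ω)‖ₑ ≤ pathMajorant fun t => extendProcess X t ω := by
  obtain ⟨Y, hY⟩ := exists_hilbert_curve hX h0
  have hYc := continuous_hilbert_curve hX h0 hY hreg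
  wlog hu : u ∈ Icc (0 : ℝ) 1 generalizing u
  · have := this (projIcc 0 1 zero_le_one u) (projIcc 0 1 zero_le_one u).2
    rwa [extendProcess_coe] at this
  have hm := measurable_extendProcess hXm
  have hS := measurable_pathMajorant hXm
  -- Subtraction in `ENNReal` is truncated, so this integral measures exactly the excess.
  have hz : ∫⁻ ω, (‖(extendProcess X u ω)‖ₑ - pathMajorant fun t => extendProcess X t ω) ∂P = 0 := by
    have hfl : Tendsto (fun n => dyadicFloor n u) atTop (𝓝 u) := by
      refine tendsto_iff_dist_tendsto_zero.2 (squeeze_zero (fun _ => dist_nonneg) (fun n => ?_)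
        (tendsto_pow_atTop_nhds_zero_of_lt_one (r := (1 / 2 : ℝ)) (by norm_num) (by norm_num)))
      rw [dist_comm, Real.dist_eq]
      exact (dyadicFloor_mem hu n).2
    have hlim : Tendsto (fun n => ENNReal.ofReal ‖Y u - Y (dyadicFloor n u)‖) atTop (𝓝 0) := by
      have := ENNReal.tendsto_ofReal (((hYc.tendsto u).comp hfl).const_sub (Y u)).norm
      simpa using this
    refine le_antisymm (ge_of_tendsto' hlim fun n => ?_) zero_le
    refine le_trans (lintegral_mono fun ω => ?_) (lintegral_enorm_sub_le hX hY h0 _ _)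
    simp only
    rw [tsub_le_iff_left]
    have h1 := enorm_dyadicFloor_le (fun t => extendProcess X t ω) hu n
    calc ‖(extendProcess X u ω)‖ₑ
        = ‖(extendProcess X (dyadicFloor n u) ω)
          + (extendProcess X u ω - extendProcess X (dyadicFloor n u) ω)‖ₑ := by congr 1; ring
      _ ≤ _ := (enorm_add_le _ _).trans (by gcongr)
  filter_upwards [(lintegral_eq_zero_iff ((hm u).enorm.sub hS)).1 hz] with ω hω
  exact tsub_eq_zero_iff_le.1 hω

/-- Fubini exchanges the order of the null sets: almost every path is essentially bounded in time,
which is all that the Lebesgue integrals see. -/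
lemma ae_ae_enorm_extendProcess_le [SFinite P]
    (hXm : Measurable fun p : Icc (0 : ℝ) 1 × Ω => X p.1 p.2)
    (hX : IsGaussianProcess X P) (h0 : ∀ t, ∫ ω, X t ω ∂P = 0)
    (hreg : RegularityHypotheses 3 X P δsq) :
    ∀ᵐ ω ∂P, ∀ᵐ u : ℝ, ‖(extendProcess X u ω)‖ₑ ≤ pathMajorant fun t => extendProcess X t ω := by
  refine (Measure.ae_ae_comm ?_).1 (ae_of_all _ (ae_enorm_extendProcess_le hXm hX h0 hreg))
  exact measurableSet_le (measurable_extendProcess_uncurry hXm).enorm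
    ((measurable_pathMajorant hXm).comp measurable_snd)

end

end

/-! ### Averages of increments of a function of the process -/

section
open scoped InnerProductSpace

lemma lintegral_enorm_average_le {Ω : Type*} [MeasurableSpace Ω] {P : Measure Ω} [SFinite P]
    {T : ℝ → Ω → ℝ} (hT : Measurable fun p : ℝ × Ω => T p.1 p.2) {ε : ℝ} (hε : 0 < ε)
    {η : ENNReal} (h : ∀ s ∈ Ioc 0 ε, ∫⁻ ω, ‖T s ω‖ₑ ∂P ≤ η) :
    ∫⁻ ω, ‖1 / ε * ∫ s in (0 : ℝ)..ε, T s ω‖ₑ ∂P ≤ η := by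
  simp only [intervalIntegral.integral_of_le hε.le, enorm_mul]
  rw [lintegral_const_mul' _ _ (by simp)]
  calc _ ≤ ‖1 / ε‖ₑ * ∫⁻ ω, (∫⁻ s in Ioc 0 ε, ‖T s ω‖ₑ) ∂P := by
        gcongr with ω
        exact enorm_integral_le_lintegral_enorm _
    _ = ‖1 / ε‖ₑ * ∫⁻ s in Ioc 0 ε, ∫⁻ ω, ‖T s ω‖ₑ ∂P := by
        rw [lintegral_lintegral_swap]
        exact (hT.comp measurable_swap).enorm.aemeasurable
    _ ≤ ‖1 / ε‖ₑ * ∫⁻ _ in Ioc 0 ε, η := by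
        gcongr 1
        exact setLIntegral_mono' measurableSet_Ioc h
    _ = η := by
        rw [setLIntegral_const, Real.volume_Ioc, sub_zero, Real.enorm_of_nonneg (by positivity),
          mul_left_comm, ← ENNReal.ofReal_mul (by positivity), one_div_mul_cancel hε.ne']
        simp

lemma tendstoInMeasure_sub {Ω ι : Type*} [MeasurableSpace Ω] {P : Measure Ω} {l : Filter ι}
    {A A' : ι → Ω → ℝ} {a a' : Ω → ℝ} (h : TendstoInMeasure P A l a)
    (h' : TendstoInMeasure P A' l a') :
    TendstoInMeasure P (fun i ω => A i ω - A' i ω) l (fun ω => a ω - a' ω) := by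
  rw [tendstoInMeasure_iff_dist] at *
  intro η hη
  have hs := (h (η / 2) (by positivity)).add (h' (η / 2) (by positivity))
  rw [add_zero] at hs
  refine tendsto_of_tendsto_of_tendsto_of_le_of_le tendsto_const_nhds hs (fun _ => zero_le)
    fun i => (measure_mono fun ω hω => ?_).trans (measure_union_le _ _)
  by_contra hcon
  simp only [mem_union, mem_ofPred_eq, not_or, not_le] at hcon hω
  linarith [dist_sub_sub_le (A i ω) (A' i ω) (a ω) (a' ω)]

lemma tendstoInMeasure_add_const {Ω ι : Type*} [MeasurableSpace Ω] {P : Measure Ω} {l : Filter ι}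
    {A : ι → Ω → ℝ} (h : TendstoInMeasure P A l 0) (a : Ω → ℝ) :
    TendstoInMeasure P (fun i ω => a ω + A i ω) l a := by
  rw [tendstoInMeasure_iff_norm] at *
  simpa using h

section
variable {Ω : Type*} [MeasurableSpace Ω] {P : Measure Ω} {X : Icc (0 : ℝ) 1 → Ω → ℝ}
  {δsq : ℝ → ℝ} {f : ℝ → ℝ} {K B : ℝ}

/-- A shift of variables leaves only averages over $[t,t+\varepsilon]$ and $[0,\varepsilon]$. They
converge because $u\mapsto f(X_u)$ is continuous in $L^1$ when $f$ is Lipschitz. -/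
lemma tendstoInMeasure_average_increment [IsProbabilityMeasure P]
    (hXm : Measurable fun p : Icc (0 : ℝ) 1 × Ω => X p.1 p.2)
    (hX : IsGaussianProcess X P) (h0 : ∀ t, ∫ ω, X t ω ∂P = 0)
    (hreg : RegularityHypotheses 3 X P δsq) (hf : Continuous f) (hB : ∀ x, |f x| ≤ B)
    (hK : ∀ x y, |f x - f y| ≤ K * |x - y|) (t : ℝ) :
    TendstoInMeasure P (fun (ε : ℝ) ω => 1 / ε * ∫ u in (0 : ℝ)..t,
        (f (extendProcess X (u + ε) ω) - f (extendProcess X u ω)))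
      (𝓝[>] 0) (fun ω => f (extendProcess X t ω) - f (extendProcess X 0 ω)) := by
  obtain ⟨Y, hY⟩ := exists_hilbert_curve hX h0
  have hYc := continuous_hilbert_curve hX h0 hY hreg
  set g : ℝ → Ω → ℝ := fun u ω => f (extendProcess X u ω) with hg
  have hgm : Measurable fun p : ℝ × Ω => g p.1 p.2 :=
    hf.measurable.comp (measurable_extendProcess_uncurry hXm)
  have hgm' : ∀ t, Measurable fun p : ℝ × Ω => g (t + p.1) p.2 := fun t =>
    hgm.comp ((measurable_fst.const_add t).prodMk measurable_snd)
  have hgt : ∀ t, Measurable (g t) := fun t => hf.measurable.comp (measurable_extendProcess hXm t)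
  have hgi : ∀ ω a b, IntervalIntegrable (fun u => g u ω) volume a b := fun ω a b =>
    ((intervalIntegrable_const (c := B)).mono_fun
      (hgm.comp (measurable_id.prodMk measurable_const)).aestronglyMeasurable
      (ae_of_all _ fun u => (hB _).trans (le_abs_self B)))
  have hgi' : ∀ ω t a b, IntervalIntegrable (fun u => g (t + u) ω) volume a b := fun ω t a b =>
    ((intervalIntegrable_const (c := B)).mono_fun
      ((hgm' t).comp (measurable_id.prodMk measurable_const)).aestronglyMeasurable
      (ae_of_all _ fun u => (hB _).trans (le_abs_self B)))
  have hL1 : ∀ s t, ∫⁻ ω, ‖g t ω - g s ω‖ₑ ∂P ≤ ENNReal.ofReal |K| * ENNReal.ofReal ‖Y t - Y s‖ := by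
    intro s t
    refine le_trans ?_ (mul_le_mul_right (lintegral_enorm_sub_le hX hY h0 s t) _)
    rw [← lintegral_const_mul' _ _ ENNReal.ofReal_ne_top]
    refine lintegral_mono fun ω => ?_
    simp only [Real.enorm_eq_ofReal_abs]
    rw [← ENNReal.ofReal_mul (abs_nonneg _)]
    refine ENNReal.ofReal_le_ofReal ((hK _ _).trans ?_)
    gcongr
    exact le_abs_self K
  have hconv : ∀ a : ℝ, TendstoInMeasure P
      (fun (ε : ℝ) ω => 1 / ε * ∫ s in (0 : ℝ)..ε, (g (a + s) ω - g a ω)) (𝓝[>] 0) 0 := by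
    intro a
    refine tendstoInMeasure_of_tendsto_eLpNorm one_ne_zero (fun ε => aestronglyMeasurable_average
      (T := fun s ω => g (a + s) ω - g a ω)
      ((hgm' a).sub ((hgt a).comp measurable_snd)) ε 0 ε) aestronglyMeasurable_zero ?_
    simp only [sub_zero, eLpNorm_one_eq_lintegral_enorm]
    rw [ENNReal.tendsto_nhds_zero]
    intro η hη
    have hlim : Tendsto (fun s => ENNReal.ofReal |K| * ENNReal.ofReal ‖Y (a + s) - Y a‖) (𝓝 0)
        (𝓝 0) := by
      have h1 : Continuous fun s => ENNReal.ofReal ‖Y (a + s) - Y a‖ :=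
        ENNReal.continuous_ofReal.comp (by fun_prop)
      have h2 := ENNReal.Tendsto.const_mul (h1.tendsto 0)
        (Or.inr (ENNReal.ofReal_ne_top (r := |K|)))
      simpa using h2
    obtain ⟨ρ, hρ, hball⟩ := Metric.eventually_nhds_iff.1 ((ENNReal.tendsto_nhds_zero.1 hlim) η hη)
    filter_upwards [Ioo_mem_nhdsGT hρ] with ε hε
    refine lintegral_enorm_average_le (T := fun s ω => g (a + s) ω - g a ω)
      ((hgm' a).sub ((hgt a).comp measurable_snd)) hε.1 fun s hs => ?_
    refine (hL1 a (a + s)).trans (hball ?_)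
    rw [Real.dist_eq, sub_zero, abs_of_pos hs.1]
    exact hs.2.trans_lt hε.2
  have key : ∀ ε : ℝ, 0 < ε → ∀ ω, 1 / ε * ∫ u in (0 : ℝ)..t, (g (u + ε) ω - g u ω) =
      (g t ω - g 0 ω) + ((1 / ε * ∫ s in (0 : ℝ)..ε, (g (t + s) ω - g t ω))
        - 1 / ε * ∫ s in (0 : ℝ)..ε, (g (0 + s) ω - g 0 ω)) := by
    intro ε hε ω
    have i1 : IntervalIntegrable (fun u => g (u + ε) ω) volume 0 t := by
      simpa only [add_comm ε] using hgi' ω ε 0 t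
    rw [intervalIntegral.integral_sub i1 (hgi ω _ _),
      intervalIntegral.integral_sub (hgi' ω _ _ _) intervalIntegrable_const,
      intervalIntegral.integral_sub (hgi' ω _ _ _) intervalIntegrable_const,
      intervalIntegral.integral_const, intervalIntegral.integral_const,
      intervalIntegral.integral_comp_add_right (fun u => g u ω),
      intervalIntegral.integral_comp_add_left (fun u => g u ω),
      intervalIntegral.integral_comp_add_left (fun u => g u ω)]
    have a1 := intervalIntegral.integral_add_adjacent_intervals (hgi ω 0 ε) (hgi ω ε (t + ε))
    have a2 := intervalIntegral.integral_add_adjacent_intervals (hgi ω 0 t) (hgi ω t (t + ε))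
    simp only [zero_add, add_zero, sub_zero, smul_eq_mul]
    field_simp
    linarith
  have hsum : TendstoInMeasure P (fun (ε : ℝ) ω =>
      (1 / ε * ∫ s in (0 : ℝ)..ε, (g (t + s) ω - g t ω))
        - 1 / ε * ∫ s in (0 : ℝ)..ε, (g (0 + s) ω - g 0 ω)) (𝓝[>] 0) 0 := by
    have := tendstoInMeasure_sub (hconv t) (hconv 0)
    simp only [Pi.zero_apply, sub_zero] at this
    exact this
  refine (tendstoInMeasure_add_const hsum _).congr' ?_ EventuallyEq.rfl
  filter_upwards [self_mem_nhdsWithin] with ε hε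
  exact ae_of_all _ fun ω => (key ε hε ω).symm

end

end

/-! ### Localization and conclusion -/

section
open scoped InnerProductSpace

/-- The bump function equals 1 on a ball strictly larger than the prescribed one, so the functions
agree near each point considered and their derivatives agree as well. -/
lemma exists_hasCompactSupport_eq_of_abs_le {f : ℝ → ℝ} {n : ℕ} (hf : ContDiff ℝ n f) (R : ℝ) :
    ∃ g : ℝ → ℝ, ContDiff ℝ n g ∧ HasCompactSupport g ∧
      ∀ x, |x| ≤ R → g x = f x ∧ deriv g x = deriv f x := by
  let χ : ContDiffBump (0 : ℝ) := ⟨|R| + 1, |R| + 2, by positivity, by linarith⟩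
  refine ⟨fun x => χ x * f x, χ.contDiff.mul hf, χ.hasCompactSupport.mul_right, fun x hx => ?_⟩
  have h : (fun x => χ x * f x) =ᶠ[𝓝 x] f := by
    filter_upwards [Metric.isOpen_ball.mem_nhds (show x ∈ Metric.ball (0 : ℝ) (|R| + 1) by
      rw [mem_ball_zero_iff, Real.norm_eq_abs]; linarith [le_abs_self R])] with y hy
    rw [χ.one_of_mem_closedBall (Metric.ball_subset_closedBall hy), one_mul]
  exact ⟨h.eq_of_nhds, h.deriv_eq⟩

/-- Half of the tolerance pays for the exceptional event and half for the approximating convergence.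
The event must not depend on the filter index `i`. -/
lemma tendstoInMeasure_of_eq_outside {Ω ι : Type*} [MeasurableSpace Ω] {P : Measure Ω}
    {l : Filter ι} {A : ι → Ω → ℝ} {a : Ω → ℝ} {A' : ℕ → ι → Ω → ℝ} {a' : ℕ → Ω → ℝ}
    {E : ℕ → Set Ω} (hE : Tendsto (fun n => P (E n)) atTop (𝓝 0))
    (h : ∀ n, TendstoInMeasure P (A' n) l (a' n))
    (hA : ∀ n, ∀ᶠ i in l, ∀ᵐ ω ∂P, ω ∉ E n → A i ω = A' n i ω ∧ a ω = a' n ω) :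
    TendstoInMeasure P A l a := by
  intro η hη
  rw [ENNReal.tendsto_nhds_zero]
  intro κ hκ
  have hκ2 : 0 < κ / 2 := ENNReal.half_pos hκ.ne'
  obtain ⟨n, hn⟩ := ((ENNReal.tendsto_nhds_zero.1 hE) _ hκ2).exists
  filter_upwards [hA n, (ENNReal.tendsto_nhds_zero.1 (h n η hη)) _ hκ2] with i hi hi'
  calc P {ω | η ≤ edist (A i ω) (a ω)}
      ≤ P (E n ∪ {ω | η ≤ edist (A' n i ω) (a' n ω)}) := by
        refine measure_mono_ae ?_
        filter_upwards [hi] with ω hω hmem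
        by_cases hω' : ω ∈ E n
        · exact Or.inl hω'
        · obtain ⟨e1, e2⟩ := hω hω'
          refine Or.inr ?_
          change η ≤ edist (A' n i ω) (a' n ω)
          rw [← e1, ← e2]
          exact hmem
    _ ≤ κ / 2 + κ / 2 := (measure_union_le _ _).trans (add_le_add hn hi')
    _ = κ := ENNReal.add_halves κ

/-- This is the definition of the trapezoidal error, with the endpoints recovered as midpoint plus
or minus half the increment. -/
lemma symmetricIntegrand_add_pathError {Ω : Type*} (f : ℝ → ℝ) (X : Icc (0 : ℝ) 1 → Ω → ℝ) (ε : ℝ) (ω : Ω) (u : ℝ) :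
    symmetricIntegrand (fun u ω => deriv f (X u ω)) X ε ω u + pathError f X ε u ω
      = f (extendProcess X (u + ε) ω) - f (extendProcess X u ω) := by
  have e1 : midpointValue X ε u ω + increment X ε u ω / 2 = extendProcess X (u + ε) ω := by
    simp only [midpointValue, increment]; ring
  have e2 : midpointValue X ε u ω - increment X ε u ω / 2 = extendProcess X u ω := by
    simp only [midpointValue, increment]; ring
  simp only [pathError, trapezoidError, e1, e2]
  simp only [symmetricIntegrand, extendProcess, increment]
  ring

section
variable {Ω : Type*} [MeasurableSpace Ω] {P : Measure Ω} {X : Icc (0 : ℝ) 1 → Ω → ℝ}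
  {δsq : ℝ → ℝ} {f : ℝ → ℝ}

lemma ae_add_right {p : ℝ → Prop} (h : ∀ᵐ u, p u) (ε : ℝ) : ∀ᵐ u, p (u + ε) :=
  (measurePreserving_add_right volume ε).quasiMeasurePreserving.ae h

lemma intervalIntegrable_symmetricIntegrand
    (hXm : Measurable fun p : Icc (0 : ℝ) 1 × Ω => X p.1 p.2) {φ : ℝ → ℝ} (hφ : Continuous φ)
    {ω : Ω} {r : ℝ} (hr : ∀ᵐ u : ℝ, |(extendProcess X u ω)| ≤ r) (ε a b : ℝ) :
    IntervalIntegrable (symmetricIntegrand (fun u ω => φ (X u ω)) X ε ω) volume a b := by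
  obtain ⟨C, hC⟩ := (isCompact_Icc (a := -r) (b := r)).exists_bound_of_continuousOn hφ.continuousOn
  have m1 : Measurable fun u => extendProcess X u ω :=
    (measurable_extendProcess_uncurry hXm).comp (measurable_id.prodMk measurable_const)
  have m2 : Measurable fun u => extendProcess X (u + ε) ω := m1.comp (measurable_id.add_const ε)
  have hm : Measurable (symmetricIntegrand (fun u ω => φ (X u ω)) X ε ω) :=
    (m2.sub m1).mul (((hφ.measurable.comp m2).add (hφ.measurable.comp m1)).const_mul (1 / 2 : ℝ))
  refine (intervalIntegrable_const (c := (r + r) * (1 / 2 * (C + C)))).mono_fun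
    hm.aestronglyMeasurable (ae_restrict_of_ae ?_)
  filter_upwards [hr, ae_add_right hr ε] with u h1 h2
  have c1 := hC _ (abs_le.1 h1)
  have c2 := hC _ (abs_le.1 h2)
  refine le_trans ?_ (le_abs_self _)
  rw [symmetricIntegrand, norm_mul, norm_mul, Real.norm_of_nonneg (by norm_num : (0 : ℝ) ≤ 1 / 2)]
  have r0 : 0 ≤ r := (abs_nonneg _).trans h1
  gcongr
  · exact (norm_sub_le _ _).trans (add_le_add h2 h1)
  · exact (norm_add_le _ _).trans (add_le_add c2 c1)

lemma ae_exists_ae_abs_le [IsProbabilityMeasure P]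
    (hXm : Measurable fun p : Icc (0 : ℝ) 1 × Ω => X p.1 p.2)
    (hX : IsGaussianProcess X P) (h0 : ∀ t, ∫ ω, X t ω ∂P = 0)
    (hreg : RegularityHypotheses 3 X P δsq) :
    ∀ᵐ ω ∂P, ∃ r : ℝ, ∀ᵐ u : ℝ, |(extendProcess X u ω)| ≤ r := by
  filter_upwards [ae_ae_enorm_extendProcess_le hXm hX h0 hreg,
    ae_lt_top (measurable_pathMajorant hXm) (lintegral_pathMajorant_lt_top hXm hX h0 hreg).ne]
    with ω h1 h2
  refine ⟨(pathMajorant fun t => extendProcess X t ω).toReal, ?_⟩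
  filter_upwards [h1] with u hu
  rwa [Real.enorm_eq_ofReal_abs, ENNReal.ofReal_le_iff_le_toReal h2.ne] at hu

lemma tendstoInMeasure_symmetric_of_hasCompactSupport [IsProbabilityMeasure P]
    (hXm : Measurable fun p : Icc (0 : ℝ) 1 × Ω => X p.1 p.2)
    (hX : IsGaussianProcess X P) (h0 : ∀ t, ∫ ω, X t ω ∂P = 0)
    (hreg : RegularityHypotheses 3 X P δsq) (hf : ContDiff ℝ 5 f) (hfs : HasCompactSupport f)
    {t : ℝ} (ht : t ∈ Icc (0 : ℝ) 1) :
    TendstoInMeasure P (fun (ε : ℝ) ω => 1 / ε * ∫ u in (0 : ℝ)..t,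
        symmetricIntegrand (fun u ω => deriv f (X u ω)) X ε ω u)
      (𝓝[>] 0) (fun ω => f (extendProcess X t ω) - f (extendProcess X 0 ω)) := by
  have c1 : ContDiff ℝ 4 (deriv f) := hf.deriv'
  have c2 : ContDiff ℝ 3 (deriv (deriv f)) := c1.deriv'
  have c3 : ContDiff ℝ 2 (deriv (deriv (deriv f))) := c2.deriv'
  have c4 : ContDiff ℝ 1 (deriv (deriv (deriv (deriv f)))) := c3.deriv'
  have c5 : Continuous (deriv (deriv (deriv (deriv (deriv f))))) := c4.continuous_deriv le_rfl
  obtain ⟨B, hB⟩ := hf.continuous.bounded_above_of_compact_support hfs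
  obtain ⟨K, hK⟩ := c1.continuous.bounded_above_of_compact_support hfs.deriv
  obtain ⟨M3, h3⟩ := c3.continuous.bounded_above_of_compact_support hfs.deriv.deriv.deriv
  obtain ⟨M4, h4⟩ := c4.continuous.bounded_above_of_compact_support hfs.deriv.deriv.deriv.deriv
  obtain ⟨M5, h5⟩ := c5.bounded_above_of_compact_support hfs.deriv.deriv.deriv.deriv.deriv
  have hlip : ∀ x y, |f x - f y| ≤ K * |x - y| := fun x y =>
    abs_sub_le_of_deriv_bound (fun z => (hf.differentiable (by norm_num) z).hasDerivAt) y x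
      fun z _ => hK z
  have t1 := tendstoInMeasure_average_increment hXm hX h0 hreg hf.continuous hB hlip t
  have t2 := tendstoInMeasure_average_pathError (M := max M3 (max M4 M5)) hXm hX h0 hreg hf
    (fun x => (h3 x).trans (le_max_left _ _))
    (fun x => (h4 x).trans ((le_max_left _ _).trans (le_max_right _ _)))
    (fun x => (h5 x).trans ((le_max_right _ _).trans (le_max_right _ _))) ht
  have t3 := tendstoInMeasure_sub t1 t2
  simp only [Pi.zero_apply, sub_zero] at t3
  refine t3.congr_left fun ε => ?_
  filter_upwards [ae_exists_ae_abs_le hXm hX h0 hreg] with ω ⟨r, hr⟩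
  have i1 := intervalIntegrable_symmetricIntegrand hXm c1.continuous hr ε 0 t
  have m1 : Measurable fun u => f (extendProcess X u ω) := hf.continuous.measurable.comp
    ((measurable_extendProcess_uncurry hXm).comp (measurable_id.prodMk measurable_const))
  have i2 : IntervalIntegrable (fun u => f (extendProcess X (u + ε) ω) - f (extendProcess X u ω))
      volume 0 t :=
    ((intervalIntegrable_const (c := B)).mono_fun
      (m1.comp (measurable_id.add_const ε)).aestronglyMeasurable
      (ae_of_all _ fun u => (hB _).trans (le_abs_self B))).sub
    ((intervalIntegrable_const (c := B)).mono_fun m1.aestronglyMeasurable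
      (ae_of_all _ fun u => (hB _).trans (le_abs_self B)))
  have e : ∀ u, pathError f X ε u ω = (f (extendProcess X (u + ε) ω) - f (extendProcess X u ω))
      - symmetricIntegrand (fun u ω => deriv f (X u ω)) X ε ω u := fun u => by
    rw [← symmetricIntegrand_add_pathError, add_sub_cancel_left]
  simp only [e]
  rw [intervalIntegral.integral_sub i2 i1]
  ring

end

theorem mainTheorem5 {Ω : Type*} [MeasurableSpace Ω] (P : Measure Ω) [IsProbabilityMeasure P]
    (X : Icc (0 : ℝ) 1 → Ω → ℝ)
    (hX_meas : Measurable fun p : Icc (0 : ℝ) 1 × Ω => X p.1 p.2)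
    (hX_gauss : IsGaussianProcess X P)
    (hX_centered : ∀ t, ∫ ω, X t ω ∂P = 0)
    (δsq : ℝ → ℝ) (hX : RegularityHypotheses 3 X P δsq)
    (f : ℝ → ℝ) (hf : ContDiff ℝ 6 f) (t : Icc (0 : ℝ) 1) :
    ∃ I : Ω → ℝ,
      IsSymmetricIntegral P (fun u ω => deriv f (X u ω)) X t I ∧
      ∀ᵐ ω ∂P, f (X t ω) = f (X 0 ω) + I ω := by
  have hm := measurable_extendProcess hX_meas
  have hmt : Measurable fun ω => f (X t ω) := hf.continuous.measurable.comp
    (hX_meas.comp (measurable_const.prodMk measurable_id))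
  have hm0 : Measurable fun ω => f (X 0 ω) := hf.continuous.measurable.comp
    (hX_meas.comp (measurable_const.prodMk measurable_id))
  -- With this choice of integral the change of variables formula is an identity; integrability and
  -- convergence remain.
  refine ⟨fun ω => f (X t ω) - f (X 0 ω), ⟨(hmt.sub hm0).aemeasurable, fun ε _ => ?_, ?_⟩,
    ae_of_all _ fun ω => by ring⟩
  · filter_upwards [ae_exists_ae_abs_le hX_meas hX_gauss hX_centered hX] with ω ⟨r, hr⟩
    exact intervalIntegrable_symmetricIntegrand hX_meas
      (hf.continuous_deriv (by norm_num)) hr ε 0 t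
  choose g hg hgs hgeq using fun n : ℕ => exists_hasCompactSupport_eq_of_abs_le (n := 6) hf n
  -- Outside the event that the majorant is at least `n`, the path takes values in $[-n,n]$ at
  -- almost every time and at the two endpoints, so `f` may be replaced by `g n`. Markov's
  -- inequality makes these events small.
  refine tendstoInMeasure_of_eq_outside
    (E := fun n : ℕ => {ω | (n : ENNReal) ≤ pathMajorant fun t => extendProcess X t ω})
    ?_ (fun n => tendstoInMeasure_symmetric_of_hasCompactSupport hX_meas hX_gauss hX_centered hX
      ((hg n).of_le (by norm_num)) (hgs n) t.2) fun n => ?_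
  · have hfin := lintegral_pathMajorant_lt_top hX_meas hX_gauss hX_centered hX
    have hlim := ENNReal.Tendsto.const_div ENNReal.tendsto_nat_nhds_top (Or.inr hfin.ne)
    rw [ENNReal.div_top] at hlim
    refine tendsto_of_tendsto_of_tendsto_of_le_of_le' tendsto_const_nhds hlim
      (Eventually.of_forall fun _ => zero_le) ?_
    filter_upwards [eventually_gt_atTop 0] with n hn
    exact meas_ge_le_lintegral_div (measurable_pathMajorant hX_meas).aemeasurable
      (by exact_mod_cast hn.ne') (ENNReal.natCast_ne_top n)
  · refine Eventually.of_forall fun ε => ?_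
    filter_upwards [ae_ae_enorm_extendProcess_le hX_meas hX_gauss hX_centered hX,
      ae_enorm_extendProcess_le hX_meas hX_gauss hX_centered hX t,
      ae_enorm_extendProcess_le hX_meas hX_gauss hX_centered hX 0] with ω h1 ht h0 hω
    have hle : ∀ x : ℝ, ‖x‖ₑ ≤ pathMajorant (fun t => extendProcess X t ω) → |x| ≤ n := by
      intro x hx
      have h2 := hx.trans (not_le.1 hω).le
      rw [Real.enorm_eq_ofReal_abs, ENNReal.ofReal_le_iff_le_toReal (ENNReal.natCast_ne_top n)] at h2
      simpa using h2
    refine ⟨?_, ?_⟩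
    · congr 1
      refine intervalIntegral.integral_congr_ae ?_
      filter_upwards [h1, ae_add_right h1 ε] with u hu hu' _
      have d1 := (hgeq n _ (hle _ hu)).2
      have d2 := (hgeq n _ (hle _ hu')).2
      simp only [symmetricIntegrand]
      change _ * (1 / 2 * (deriv f (extendProcess X (u + ε) ω) + deriv f (extendProcess X u ω)))
        = _ * (1 / 2 * (deriv (g n) (extendProcess X (u + ε) ω)
          + deriv (g n) (extendProcess X u ω)))
      rw [d1, d2]
    · rw [(hgeq n _ (hle _ ht)).1, (hgeq n _ (hle _ h0)).1, extendProcess_coe]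
      rw [extendProcess, projIcc_of_le_left zero_le_one le_rfl]
      rfl

end
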